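/- A metric graph is a graph $G$ on $n \ge 2$ vertices which are distinct points of a metric space $M$; every edge is as long as the distance $d_M$ of its endpoints, and $d_G$ denotes the shortest path distance in $G$ ($\infty$ if there is no path). The dilation of $G$ is the least $t \in [0,\infty]$ with $d_G(u,v) \le t \cdot d_M(u,v)$ for all vertices $u,v$. For a positive integer $k$ let $t^*$ be the minimum dilation of $(V(G), E(G)\cup S^*)$ over all sets $S^* \subseteq V(G)\times V(G)$ of at most $k$ edges. There is an algorithm on the real RAM (exact real arithmetic $+,-,\cdot,/$ and comparisons at unit cost, no rounding) which, given a metric graph $G$ (as adjacency matrix and distance matrix), positive integers $k$ and $r$, and a real $\delta > 0$, constructs a set $S \subseteq V(G)\times V(G)$ of at most $fk$ edges such that the dilation of $(V(G), E(G)\cup S)$ is at most $(1+\delta)\, g\, t^*$, where $$ f = 2\,\sqrt[r]{2}\; k^{1/r} \quad\text{and}\quad g = 2r . $$ In other words, for every integer $r \ge 1$ and every $\delta>0$ it is an $(f,(1+\delta)g)$-bicriteria approximation for the problem of adding $k$ edges to a metric graph to minimise its dilation. For every integer $r \ge 1$ there is a constant $C_r$, independent of $G$, $M$, $n$, $k$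 and $\delta$, such that the algorithm makes at most $C_r\, n^3\bigl(\log n + \max(0,\log\tfrac1\delta)\bigr)$ elementary steps. -/

import Mathlib

open scoped ENNReal

/-! ### Metric graphs, dilation, optimal augmentation -/

namespace MetricGraph

variable {M : Type*} [MetricSpace M] {n : ℕ}

/-- Length of a walk of a graph whose vertices `0, …, n - 1` are placed at the points `p i` of a
metric space; every edge is as long as the distance of its endpoints. -/
noncomputable def walkLength (p : Fin n ↪ M) {G : SimpleGraph (Fin n)} {u v : Fin n}
    (w : G.Walk u v) : ℝ≥0∞ :=
  (w.darts.map fun e => edist (p e.fst) (p e.snd)).sum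

/-- Shortest path distance in `G` (`∞` if there is no path). -/
noncomputable def graphDist (p : Fin n ↪ M) (G : SimpleGraph (Fin n)) (u v : Fin n) : ℝ≥0∞ :=
  ⨅ w : G.Walk u v, walkLength p w

/-- The dilation of `G`: the least `t` such that all graph distances are at most `t` times the
metric distances (`∞` if `G` is disconnected). -/
noncomputable def dilation (p : Fin n ↪ M) (G : SimpleGraph (Fin n)) : ℝ≥0∞ :=
  sInf {t : ℝ≥0∞ | ∀ u v : Fin n, graphDist p G u v ≤ t * edist (p u) (p v)}

/-- The minimum dilation that can be obtained from `G` by adding a set `S` of `k` edges.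
Adding an edge never increases the dilation, so "at most `k`" and "exactly `k`" agree as soon as
there are `k` pairs of vertices. -/
noncomputable def optDilation (p : Fin n ↪ M) (G : SimpleGraph (Fin n)) (k : ℕ) : ℝ≥0∞ :=
  ⨅ (S : SimpleGraph (Fin n)) (_ : S.edgeSet.ncard ≤ k), dilation p (G ⊔ S)

end MetricGraph

/-! ### The real RAM

A program works on two-dimensional arrays of natural numbers (used as indices and counters) and of
real numbers.  Exact real arithmetic `+, -, *, /` and comparisons are elementary operations; there
is no rounding, root or logarithm, and no way to turn a real number into an integer except by
comparisons.  Natural numbers can only be added, subtracted, halved and compared.  Program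
constants are natural numbers. -/

namespace RealRAM

/-- Memory contents: `nat a i j` is the cell `(i, j)` of the integer array `a`, `real a i j` is
the cell `(i, j)` of the real array `a`. -/
structure State where
  nat : ℕ → ℕ → ℕ → ℕ
  real : ℕ → ℕ → ℕ → ℝ

/-- Integer expressions; subtraction is truncated at `0`. -/
inductive NExpr where
  | lit (c : ℕ)
  | get (a : ℕ) (i j : NExpr)
  | add (x y : NExpr)
  | sub (x y : NExpr)
  | half (x : NExpr)

/-- Real expressions. -/
inductive RExpr where
  | ofNat (x : NExpr)
  | get (a : ℕ) (i j : NExpr)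
  | add (x y : RExpr)
  | sub (x y : RExpr)
  | mul (x y : RExpr)
  | div (x y : RExpr)

/-- Tests. -/
inductive BExpr where
  | natLt (x y : NExpr)
  | realLt (x y : RExpr)
  | neg (b : BExpr)
  | conj (b c : BExpr)

/-- Programs. -/
inductive Cmd where
  | skip
  | setNat (a : ℕ) (i j e : NExpr)
  | setReal (a : ℕ) (i j : NExpr) (e : RExpr)
  | seq (c d : Cmd)
  | cond (b : BExpr) (c d : Cmd)
  | loop (b : BExpr) (c : Cmd)

/-- Value of an integer expression. -/
def NExpr.eval (s : State) : NExpr → ℕ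
  | .lit c => c
  | .get a i j => s.nat a (i.eval s) (j.eval s)
  | .add x y => x.eval s + y.eval s
  | .sub x y => x.eval s - y.eval s
  | .half x => x.eval s / 2

/-- Number of elementary operations needed to evaluate an integer expression. -/
def NExpr.cost : NExpr → ℕ
  | .lit _ => 1
  | .get _ i j => i.cost + j.cost + 1
  | .add x y => x.cost + y.cost + 1
  | .sub x y => x.cost + y.cost + 1
  | .half x => x.cost + 1

/-- Value of a real expression. -/
noncomputable def RExpr.eval (s : State) : RExpr → ℝ
  | .ofNat x => (x.eval s : ℝ)
  | .get a i j => s.real a (i.eval s) (j.eval s)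
  | .add x y => x.eval s + y.eval s
  | .sub x y => x.eval s - y.eval s
  | .mul x y => x.eval s * y.eval s
  | .div x y => x.eval s / y.eval s

/-- Number of elementary operations needed to evaluate a real expression. -/
def RExpr.cost : RExpr → ℕ
  | .ofNat x => x.cost + 1
  | .get _ i j => i.cost + j.cost + 1
  | .add x y => x.cost + y.cost + 1
  | .sub x y => x.cost + y.cost + 1
  | .mul x y => x.cost + y.cost + 1
  | .div x y => x.cost + y.cost + 1

/-- Truth of a test. -/
def BExpr.holds (s : State) : BExpr → Prop
  | .natLt x y => x.eval s < y.eval s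
  | .realLt x y => x.eval s < y.eval s
  | .neg b => ¬ b.holds s
  | .conj b c => b.holds s ∧ c.holds s

/-- Number of elementary operations needed to evaluate a test. -/
def BExpr.cost : BExpr → ℕ
  | .natLt x y => x.cost + y.cost + 1
  | .realLt x y => x.cost + y.cost + 1
  | .neg b => b.cost + 1
  | .conj b c => b.cost + c.cost + 1

/-- Write one integer cell. -/
def State.setNat (s : State) (a i j v : ℕ) : State where
  nat a' i' j' := if a' = a ∧ i' = i ∧ j' = j then v else s.nat a' i' j'
  real := s.real

/-- Write one real cell. -/
noncomputable def State.setReal (s : State) (a i j : ℕ) (v : ℝ) : State where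
  nat := s.nat
  real a' i' j' := if a' = a ∧ i' = i ∧ j' = j then v else s.real a' i' j'

/-- `Exec c s T s'`: started in the state `s`, the program `c` halts in the state `s'` after
exactly `T` elementary steps. -/
inductive Exec : Cmd → State → ℕ → State → Prop
  | skip (s : State) : Exec .skip s 1 s
  | setNat (s : State) (a : ℕ) (i j e : NExpr) :
      Exec (.setNat a i j e) s (i.cost + j.cost + e.cost + 1)
        (s.setNat a (i.eval s) (j.eval s) (e.eval s))
  | setReal (s : State) (a : ℕ) (i j : NExpr) (e : RExpr) :
      Exec (.setReal a i j e) s (i.cost + j.cost + e.cost + 1)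
        (s.setReal a (i.eval s) (j.eval s) (e.eval s))
  | seq {c d : Cmd} {s s' s'' : State} {T T' : ℕ} :
      Exec c s T s' → Exec d s' T' s'' → Exec (.seq c d) s (T + T') s''
  | condTrue {b : BExpr} {c d : Cmd} {s s' : State} {T : ℕ} :
      b.holds s → Exec c s T s' → Exec (.cond b c d) s (b.cost + T + 1) s'
  | condFalse {b : BExpr} {c d : Cmd} {s s' : State} {T : ℕ} :
      ¬ b.holds s → Exec d s T s' → Exec (.cond b c d) s (b.cost + T + 1) s'
  | loopTrue {b : BExpr} {c : Cmd} {s s' s'' : State} {T T' : ℕ} :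
      b.holds s → Exec c s T s' → Exec (.loop b c) s' T' s'' →
        Exec (.loop b c) s (b.cost + T + T' + 1) s''
  | loopFalse {b : BExpr} {c : Cmd} {s : State} :
      ¬ b.holds s → Exec (.loop b c) s (b.cost + 1) s

open Classical in
/-- The initial memory: the number `n` of vertices, the budget `k` and the parameter `r` are in the
cells `(0, 0)` of the integer arrays `0`, `1`, `2`, the adjacency matrix of `G` is in the integer
array `3`, the distance matrix of the vertices is in the real array `0`, and `δ` is in the
cell `(0, 0)` of the real array `1`.  All other cells hold `0`. -/
noncomputable def input {M : Type*} [MetricSpace M] {n : ℕ} (p : Fin n ↪ M)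
    (G : SimpleGraph (Fin n)) (k r : ℕ) (δ : ℝ) : State where
  nat
    | 0, 0, 0 => n
    | 1, 0, 0 => k
    | 2, 0, 0 => r
    | 3, i, j => if ∃ (hi : i < n) (hj : j < n), G.Adj ⟨i, hi⟩ ⟨j, hj⟩ then 1 else 0
    | _, _, _ => 0
  real
    | 0, i, j => if h : i < n ∧ j < n then dist (p ⟨i, h.1⟩) (p ⟨j, h.2⟩) else 0
    | 1, 0, 0 => δ
    | _, _, _ => 0

/-- The set of edges read off the integer array `4` when the program has halted: the pair of
distinct vertices `i`, `j` belongs to it if the cell `(i, j)` or the cell `(j, i)` is not `0`. -/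
def output (n : ℕ) (s : State) : SimpleGraph (Fin n) :=
  SimpleGraph.fromRel fun i j => s.nat 4 i j ≠ 0

end RealRAM

/-! The algorithm rests on a procedure which, for a given `t ≥ 1`, either finds few edges that bring
the dilation down to `2 * r * t`, or shows that `k` additional edges cannot bring it down to `t`. A
search over `t` turns this procedure into an approximation of the optimal dilation `t*`.

**A given dilation `t`.** All pairs of points are treated in the order of nondecreasing distance, and
a pair `(u, v)` gets a new edge unless it is already known to be well connected. After each
insertion, all pairs `(a, b)` such that the detour `a - u - v - b` along the new edge is not much
longer than the edge (`IsLinked`) become *linked*. A chain of fewer than `2 * r` links gives a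
sufficiently short path: all links stem from edges not longer than the present pair. This is why the
edges found yield dilation `2 * r * t` (`GreedyInv.reject`, `GreedyInv.dilation_le`). As to their
number, suppose that a set `S'` of at most `k` edges achieves dilation `t`. When a pair `(u, v)` gets
an edge, a shortest path for it passes through endpoints `a`, `b` of edges of `S'` which are linked
by the new edge, but have not been connected by fewer than `2 * r` links before
(`IsGraphDist.exists_endpoints`). The pairs `(a, b)` obtained in this way are therefore the edges of
a graph on at most `2 * k` vertices without cycles of length at most `2 * r` (`GreedyInv.accept`). By
the Moore bound for irregular graphs (`SimpleGraph.LocallyAcyclic.ncard_edgeSet_pow_le`) their number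
`m` satisfies `m ^ r ≤ (2 * k) ^ (r + 1)`. A larger number of insertions shows `t ≤ t*`.

**Time.** Link distances are cut off at `2 * r`. They are natural numbers which never increase, and a
pair which gets linked at the insertion of an edge had distance at least `2` before. Hence the
decrease of the sum of all link distances pays for the updates (`run_insertLink`, `run_linkBox`), and
one call of the procedure takes `O(r * n ^ 3)` steps (`run_attempt`). To test a pair in linear time,
the program keeps, for all `u` and `b`, the distance from `u` to the nearest vertex with few links to
`b` (`IsNearest`).

**The search.** A first estimate comes from the minimum spanning tree of all points: its edges are
contracted one after the other, and for each of them the ratio of its distance in the contracted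
graph to its length is recorded. If more than `k` of the ratios are at least `τ`, then `t* ≥ τ / n`
by a dimension count: `k` linear conditions have a nontrivial solution in `k + 1` unknowns
(`CoarseInv.le_of_card`). On the other hand, adding the pairs with ratio larger than `τ` gives
dilation at most `n * max 1 τ` (`CoarseInv.optDilation_le`). This leaves a range `[t₀, n ^ 2 * t₀]`
for a finite `t*`, so that `O(log n)` doublings and `O(1 + max 0 (log (1 / δ)))` bisections suffice
(`run_doubling`, `run_bisection`).

Missing paths are represented by a number `B` larger than all lengths that matter if `t*` is finite
(`IsGraphDist`). If `t*` is infinite, nothing has to be shown about the dilation. -/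

/-! ### Graphs without short cycles have few edges -/

namespace SimpleGraph

variable {W : Type*}

/-- Every subgraph with at most `m` edges is a forest; for finite graphs this says that all cycles
are longer than `m`. -/
def LocallyAcyclic (H : SimpleGraph W) (m : ℕ) : Prop :=
  ∀ F ≤ H, F.edgeSet.Finite → F.edgeSet.ncard ≤ m → F.IsAcyclic

theorem locallyAcyclic_bot (m : ℕ) : (⊥ : SimpleGraph W).LocallyAcyclic m := by
  intro F hF _ _
  rw [le_bot_iff.mp hF]
  exact isAcyclic_bot

/-- Joining two vertices at hop distance at least `m` creates no cycle of length at most `m`. -/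
theorem LocallyAcyclic.sup_edge {H : SimpleGraph W} {m : ℕ} (hH : H.LocallyAcyclic m) {a b : W}
    (hab : ∀ p : H.Walk a b, m ≤ p.length) : (H ⊔ edge a b).LocallyAcyclic m := by
  classical
  intro F hF hfin hcard
  by_cases hmem : s(a, b) ∈ F.edgeSet
  · have hsub : F.deleteEdges {s(a, b)} ≤ H := by
      intro x y hxy
      rw [deleteEdges_adj] at hxy
      have := hF hxy.1
      rw [sup_adj, edge_adj] at this
      rcases this with h | h
      · exact h
      · exact absurd (by rcases h.1 with ⟨rfl, rfl⟩ | ⟨rfl, rfl⟩ <;> simp [Sym2.eq_swap]) hxy.2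
    have hes : (F.deleteEdges {s(a, b)}).edgeSet = F.edgeSet \ {s(a, b)} := by simp
    have hlt : (F.deleteEdges {s(a, b)}).edgeSet.ncard < m := by
      rw [hes]
      exact lt_of_lt_of_le (Set.ncard_sdiff_singleton_lt_of_mem hmem hfin) hcard
    have hfin' : (F.deleteEdges {s(a, b)}).edgeSet.Finite := hes ▸ hfin.subset Set.sdiff_subset
    have hac := hH _ hsub hfin' hlt.le
    have hnr : ¬ (F.deleteEdges {s(a, b)}).Reachable a b := by
      rintro ⟨p⟩
      have hp := p.toPath.2
      have h1 := hab ((p.toPath : (F.deleteEdges {s(a, b)}).Walk a b).mapLe hsub)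
      rw [Walk.length_mapLe] at h1
      have h2 : (p.toPath : (F.deleteEdges {s(a, b)}).Walk a b).length ≤
          (F.deleteEdges {s(a, b)}).edgeSet.ncard := by
        rw [← Walk.length_edges, ← List.toFinset_card_of_nodup hp.isTrail.edges_nodup,
          ← Set.ncard_coe_finset]
        refine Set.ncard_le_ncard ?_ hfin'
        intro e he
        exact Walk.edges_subset_edgeSet _ (by simpa using he)
      omega
    refine (IsAcyclic.sup_edge_of_not_reachable hnr hac).anti ?_
    intro x y hxy
    by_cases h : s(x, y) = s(a, b)
    · right
      rw [edge_adj]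
      refine ⟨?_, hxy.ne⟩
      rw [Sym2.eq_iff] at h
      tauto
    · left
      rw [deleteEdges_adj]
      exact ⟨hxy, h⟩
  · refine hH F ?_ hfin hcard
    intro x y hxy
    have := hF hxy
    rw [sup_adj, edge_adj] at this
    rcases this with h | h
    · exact h
    · exact absurd (by rcases h.1 with ⟨rfl, rfl⟩ | ⟨rfl, rfl⟩ <;> simpa [adj_comm] using hxy) hmem

theorem LocallyAcyclic.induce {H : SimpleGraph W} {m : ℕ} (hH : H.LocallyAcyclic m) (s : Set W) :
    (H.induce s).LocallyAcyclic m := by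
  intro F hF hfin hcard
  have hmap : F.map (Function.Embedding.subtype (· ∈ s)) ≤ H := by
    intro x y hxy
    rw [map_adj] at hxy
    obtain ⟨a, b, hab, rfl, rfl⟩ := hxy
    exact hF hab
  have hes := edgeSet_map (Function.Embedding.subtype (· ∈ s)) F
  refine IsAcyclic.of_map (Function.Embedding.subtype (· ∈ s)) (hH _ hmap ?_ ?_)
  · rw [hes]
    exact hfin.image _
  · rw [hes]
    exact (Set.ncard_image_le hfin).trans hcard

/-- Two walks without backtracking between the same vertices agree if together they are too short
to contain a cycle. -/
theorem LocallyAcyclic.support_eq {H : SimpleGraph W} {m : ℕ} (hH : H.LocallyAcyclic m) {v w : W}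
    (p q : H.Walk v w) (hp : p.edges.IsChain (· ≠ ·)) (hq : q.edges.IsChain (· ≠ ·))
    (hlen : p.length + q.length ≤ m) : p.support = q.support := by
  classical
  set E : Finset (Sym2 W) := p.edges.toFinset ∪ q.edges.toFinset with hE
  have hEH : (E : Set (Sym2 W)) ⊆ H.edgeSet := by
    intro e he
    simp only [hE, Finset.coe_union, List.coe_toFinset, Set.mem_union, Set.mem_ofPred_eq] at he
    rcases he with h | h
    · exact p.edges_subset_edgeSet h
    · exact q.edges_subset_edgeSet h
  have hle : fromEdgeSet (E : Set (Sym2 W)) ≤ H := by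
    rw [← edgeSet_subset_edgeSet, edgeSet_fromEdgeSet]
    exact Set.sdiff_subset.trans hEH
  have hes : (fromEdgeSet (E : Set (Sym2 W))).edgeSet = E := by
    rw [edgeSet_fromEdgeSet]
    refine Set.Subset.antisymm Set.sdiff_subset fun e he => ⟨he, ?_⟩
    exact H.not_isDiag_of_mem_edgeSet (hEH he)
  have hcard : E.card ≤ m := by
    refine (Finset.card_union_le _ _).trans ?_
    have h1 := List.toFinset_card_le p.edges
    have h2 := List.toFinset_card_le q.edges
    rw [Walk.length_edges] at h1 h2
    omega
  have hac : (fromEdgeSet (E : Set (Sym2 W))).IsAcyclic := by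
    refine hH _ hle ?_ ?_
    · rw [hes]; exact E.finite_toSet
    · rw [hes, Set.ncard_coe_finset]; exact hcard
  have hpe : ∀ e ∈ p.edges, e ∈ (fromEdgeSet (E : Set (Sym2 W))).edgeSet := by
    intro e he; rw [hes]; simp [hE, he]
  have hqe : ∀ e ∈ q.edges, e ∈ (fromEdgeSet (E : Set (Sym2 W))).edgeSet := by
    intro e he; rw [hes]; simp [hE, he]
  have hp' : (p.transfer _ hpe).IsPath := (hac.isPath_iff_isChain _).2 (by simpa using hp)
  have hq' : (q.transfer _ hqe).IsPath := (hac.isPath_iff_isChain _).2 (by simpa using hq)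
  have := congrArg (fun P : (fromEdgeSet (E : Set (Sym2 W))).Path v w => P.1.support)
    ((hac.subsingleton_path v w).elim ⟨_, hp'⟩ ⟨_, hq'⟩)
  simpa using this

/-- Jensen's inequality for the logarithm of a sum. -/
theorem log_card_add_le_log_sum {ι : Type*} (s : Finset ι) (hs : s.Nonempty) (c : ι → ℝ)
    (hc : ∀ i ∈ s, 0 < c i) :
    Real.log s.card + (∑ i ∈ s, Real.log (c i)) / s.card ≤ Real.log (∑ i ∈ s, c i) := by
  have hpos : (0 : ℝ) < s.card := by exact_mod_cast hs.card_pos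
  have h := strictConcaveOn_log_Ioi.concaveOn.le_map_sum (t := s) (w := fun _ => (s.card : ℝ)⁻¹)
    (p := c) (fun _ _ => by positivity) (by simp [hpos.ne']) (fun i hi => hc i hi)
  simp only [smul_eq_mul, ← Finset.mul_sum] at h
  have hsum : 0 < ∑ i ∈ s, c i := Finset.sum_pos hc hs
  rw [Real.log_mul (by positivity) hsum.ne', Real.log_inv] at h
  rw [div_eq_inv_mul]
  linarith

theorem sum_neighborFinset_comm [Fintype W] (H : SimpleGraph W) [DecidableRel H.Adj]
    (f : W → W → ℝ) :
    ∑ v, ∑ w ∈ H.neighborFinset v, f v w = ∑ w, ∑ v ∈ H.neighborFinset w, f v w := by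
  refine Finset.sum_comm' fun v w => ?_
  simp [adj_comm]

section Finite

variable [Fintype W] [DecidableEq W] (H : SimpleGraph W) [DecidableRel H.Adj]

/-- The end vertices of the walks without backtracking which have `j + 1` edges and start with the
step from `v` to `w`. -/
def nonbacktrackingEnds : ℕ → W → W → Finset W
  | 0, _, w => {w}
  | j + 1, v, w => ((H.neighborFinset w).erase v).biUnion fun x => nonbacktrackingEnds j w x

theorem exists_walk_of_mem_nonbacktrackingEnds (j : ℕ) (v w z : W) (hvw : H.Adj v w)
    (hz : z ∈ H.nonbacktrackingEnds j v w) :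
    ∃ p : H.Walk w z, p.length = j ∧ (Walk.cons hvw p).edges.IsChain (· ≠ ·) := by
  induction j generalizing v w with
  | zero =>
    rw [nonbacktrackingEnds, Finset.mem_singleton] at hz
    subst hz
    exact ⟨Walk.nil, rfl, by simp⟩
  | succ j ih =>
    rw [nonbacktrackingEnds, Finset.mem_biUnion] at hz
    obtain ⟨x, hx, hz⟩ := hz
    rw [Finset.mem_erase, mem_neighborFinset] at hx
    obtain ⟨p, hp, hc⟩ := ih w x hx.2 hz
    refine ⟨Walk.cons hx.2 p, by simp [hp], ?_⟩
    rw [Walk.edges_cons, Walk.edges_cons, List.isChain_cons_cons]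
    refine ⟨?_, by simpa using hc⟩
    intro h
    rw [Sym2.eq_iff] at h
    rcases h with ⟨h1, h2⟩ | ⟨h1, h2⟩
    · exact hvw.ne h1
    · exact hx.1 h1.symm

variable {H}

theorem LocallyAcyclic.disjoint_nonbacktrackingEnds {r j : ℕ} (hH : H.LocallyAcyclic (2 * r))
    (hj : j + 1 ≤ r) {w x y : W} (hx : H.Adj w x) (hy : H.Adj w y) (hxy : x ≠ y) :
    Disjoint (H.nonbacktrackingEnds j w x) (H.nonbacktrackingEnds j w y) := by
  rw [Finset.disjoint_left]
  intro z hz1 hz2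
  obtain ⟨p, hp, hpc⟩ := H.exists_walk_of_mem_nonbacktrackingEnds j w x z hx hz1
  obtain ⟨q, hq, hqc⟩ := H.exists_walk_of_mem_nonbacktrackingEnds j w y z hy hz2
  have := hH.support_eq _ _ hpc hqc (by simp only [Walk.length_cons, hp, hq]; omega)
  rw [Walk.support_cons, Walk.support_cons, ← p.cons_tail_support, ← q.cons_tail_support] at this
  simp only [List.cons.injEq, true_and] at this
  exact hxy this.1

theorem nonbacktrackingEnds_nonempty (hdeg : ∀ v, 2 ≤ H.degree v) (j : ℕ) (v w : W) :
    (H.nonbacktrackingEnds j v w).Nonempty := by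
  induction j generalizing v w with
  | zero => exact ⟨w, by simp [nonbacktrackingEnds]⟩
  | succ j ih =>
    have h : 0 < ((H.neighborFinset w).erase v).card := by
      have := Finset.pred_card_le_card_erase (s := H.neighborFinset w) (a := v)
      rw [card_neighborFinset_eq_degree] at this
      have := hdeg w
      omega
    obtain ⟨x, hx⟩ := Finset.card_pos.mp h
    obtain ⟨z, hz⟩ := ih w x
    exact ⟨z, Finset.mem_biUnion.mpr ⟨x, hx, hz⟩⟩

theorem LocallyAcyclic.sum_log_card_nonbacktrackingEnds {r : ℕ} (hH : H.LocallyAcyclic (2 * r))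
    (hdeg : ∀ v, 2 ≤ H.degree v) (j : ℕ) (hj : j + 1 ≤ r) :
    (j : ℝ) * ∑ v, (H.degree v : ℝ) * Real.log ((H.degree v : ℝ) - 1) ≤
      ∑ v, ∑ w ∈ H.neighborFinset v, Real.log (H.nonbacktrackingEnds j v w).card := by
  induction j with
  | zero => simp [nonbacktrackingEnds]
  | succ j ih =>
    have ih := ih (by omega)
    have key : ∑ v, (H.degree v : ℝ) * Real.log ((H.degree v : ℝ) - 1) +
        ∑ v, ∑ w ∈ H.neighborFinset v, Real.log (H.nonbacktrackingEnds j v w).card ≤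
        ∑ v, ∑ w ∈ H.neighborFinset v, Real.log (H.nonbacktrackingEnds (j + 1) v w).card := by
      rw [sum_neighborFinset_comm H
        (fun v w => Real.log (H.nonbacktrackingEnds (j + 1) v w).card), ← Finset.sum_add_distrib]
      refine Finset.sum_le_sum fun w _ => ?_
      have hd : (2 : ℝ) ≤ H.degree w := by exact_mod_cast hdeg w
      set l : W → ℝ := fun x => Real.log (H.nonbacktrackingEnds j w x).card with hl
      have step : ∀ v ∈ H.neighborFinset w,
          Real.log ((H.degree w : ℝ) - 1) +
            (∑ x ∈ H.neighborFinset w, l x - l v) / ((H.degree w : ℝ) - 1) ≤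
          Real.log (H.nonbacktrackingEnds (j + 1) v w).card := by
        intro v hv
        have hce : (((H.neighborFinset w).erase v).card : ℝ) = (H.degree w : ℝ) - 1 := by
          rw [Finset.card_erase_of_mem hv, card_neighborFinset_eq_degree, Nat.cast_sub]
          · simp
          · have := hdeg w; omega
        have hne : ((H.neighborFinset w).erase v).Nonempty := by
          rw [← Finset.card_pos]
          have : (0 : ℝ) < (((H.neighborFinset w).erase v).card : ℝ) := by rw [hce]; linarith
          exact_mod_cast this
        have hJ := log_card_add_le_log_sum ((H.neighborFinset w).erase v) hne
          (fun x => ((H.nonbacktrackingEnds j w x).card : ℝ))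
          (fun x _ => by exact_mod_cast (nonbacktrackingEnds_nonempty hdeg j w x).card_pos)
        rw [hce, Finset.sum_erase_eq_sub hv] at hJ
        refine hJ.trans (le_of_eq ?_)
        rw [nonbacktrackingEnds, Finset.card_biUnion]
        · push_cast; rfl
        · intro x hx y hy hxy
          rw [Finset.mem_coe, Finset.mem_erase, mem_neighborFinset] at hx hy
          exact hH.disjoint_nonbacktrackingEnds (by omega) hx.2 hy.2 hxy
      refine le_trans (le_of_eq ?_) (Finset.sum_le_sum step)
      rw [Finset.sum_add_distrib, Finset.sum_const, ← Finset.sum_div, Finset.sum_sub_distrib,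
        Finset.sum_const, card_neighborFinset_eq_degree, nsmul_eq_mul, nsmul_eq_mul]
      have : (H.degree w : ℝ) - 1 ≠ 0 := by linarith
      field_simp
    push_cast
    linarith

/-- The Moore bound under the additional assumption that all degrees are at least two. -/
theorem LocallyAcyclic.card_edgeFinset_pow_le_of_two_le_degree [Nonempty W] {r : ℕ} (hr : 1 ≤ r)
    (hH : H.LocallyAcyclic (2 * r)) (hdeg : ∀ v, 2 ≤ H.degree v) :
    H.edgeFinset.card ^ r ≤ Fintype.card W ^ (r + 1) := by
  set m := H.edgeFinset.card with hm
  set N := Fintype.card W with hN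
  have hN0 : (0 : ℝ) < N := by exact_mod_cast Fintype.card_pos
  have hsumdeg : ∑ v, (H.degree v : ℝ) = 2 * m := by
    exact_mod_cast H.sum_degrees_eq_twice_card_edges
  have hm0 : (0 : ℝ) < m := by
    have : ∑ v : W, (2 : ℝ) ≤ ∑ v, (H.degree v : ℝ) :=
      Finset.sum_le_sum fun v _ => by exact_mod_cast hdeg v
    rw [hsumdeg, Finset.sum_const, nsmul_eq_mul, Finset.card_univ] at this
    nlinarith
  set x : ℝ := m / N with hx
  have hx0 : 0 < x := by positivity
  -- the tangent of the logarithm at the average `x` of the halved degrees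
  have hlow : 2 * m * Real.log x ≤ ∑ v, (H.degree v : ℝ) * Real.log ((H.degree v : ℝ) - 1) := by
    have h1 : ∀ v ∈ Finset.univ, (H.degree v : ℝ) * (Real.log x + 1) - 2 * x ≤
        (H.degree v : ℝ) * Real.log ((H.degree v : ℝ) - 1) := by
      intro v _
      have hd : (2 : ℝ) ≤ H.degree v := by exact_mod_cast hdeg v
      have hd1 : (0 : ℝ) < (H.degree v : ℝ) - 1 := by linarith
      have hlog := Real.log_le_sub_one_of_pos (x := x / ((H.degree v : ℝ) - 1)) (by positivity)
      rw [Real.log_div hx0.ne' hd1.ne'] at hlog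
      have h2 : (H.degree v : ℝ) * (x / ((H.degree v : ℝ) - 1)) ≤ 2 * x := by
        rw [mul_div_assoc', div_le_iff₀ hd1]
        nlinarith
      nlinarith
    have h2 := Finset.sum_le_sum h1
    rw [Finset.sum_sub_distrib, ← Finset.sum_mul, hsumdeg, Finset.sum_const, nsmul_eq_mul,
      Finset.card_univ] at h2
    have h3 : (N : ℝ) * (2 * x) = 2 * m := by rw [hx]; field_simp
    rw [← hN] at h2
    linarith
  have hA := hH.sum_log_card_nonbacktrackingEnds hdeg (r - 1) (by omega)
  have hB : ∀ v ∈ Finset.univ, (H.degree v : ℝ) * Real.log ((H.degree v : ℝ) - 1) +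
      ∑ w ∈ H.neighborFinset v, Real.log (H.nonbacktrackingEnds (r - 1) v w).card ≤
      (H.degree v : ℝ) * Real.log N := by
    intro v _
    have hd : (2 : ℝ) ≤ H.degree v := by exact_mod_cast hdeg v
    have hJ := log_card_add_le_log_sum (H.neighborFinset v)
      (by rw [← Finset.card_pos, card_neighborFinset_eq_degree]; have := hdeg v; omega)
      (fun w => ((H.nonbacktrackingEnds (r - 1) v w).card : ℝ))
      (fun w _ => by exact_mod_cast (nonbacktrackingEnds_nonempty hdeg (r - 1) v w).card_pos)
    rw [card_neighborFinset_eq_degree] at hJ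
    have hle : Real.log (∑ w ∈ H.neighborFinset v, ((H.nonbacktrackingEnds (r - 1) v w).card : ℝ)) ≤
        Real.log N := by
      refine Real.log_le_log ?_ ?_
      · refine Finset.sum_pos (fun w _ => ?_) ?_
        · exact_mod_cast (nonbacktrackingEnds_nonempty hdeg (r - 1) v w).card_pos
        · rw [← Finset.card_pos, card_neighborFinset_eq_degree]; have := hdeg v; omega
      · rw [← Nat.cast_sum, ← Finset.card_biUnion]
        · exact_mod_cast Finset.card_le_univ _
        · intro x hx y hy hxy
          rw [Finset.mem_coe, mem_neighborFinset] at hx hy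
          exact hH.disjoint_nonbacktrackingEnds (by omega) hx hy hxy
    have hlog : Real.log ((H.degree v : ℝ) - 1) ≤ Real.log (H.degree v) :=
      Real.log_le_log (by linarith) (by linarith)
    have h3 := mul_le_mul_of_nonneg_left (hJ.trans hle) (by linarith : (0 : ℝ) ≤ H.degree v)
    have h4 : (H.degree v : ℝ) * ((∑ w ∈ H.neighborFinset v,
        Real.log (H.nonbacktrackingEnds (r - 1) v w).card) / H.degree v) =
        ∑ w ∈ H.neighborFinset v, Real.log (H.nonbacktrackingEnds (r - 1) v w).card := by
      field_simp
    rw [mul_add, h4] at h3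
    have h5 := mul_le_mul_of_nonneg_left hlog (by linarith : (0 : ℝ) ≤ H.degree v)
    linarith
  have hC := Finset.sum_le_sum hB
  rw [Finset.sum_add_distrib, ← Finset.sum_mul, hsumdeg] at hC
  have hr1 : ((r - 1 : ℕ) : ℝ) = r - 1 := by rw [Nat.cast_sub hr]; simp
  rw [hr1] at hA
  have hr0 : (0 : ℝ) ≤ (r : ℝ) - 1 := by
    have : (1 : ℝ) ≤ r := by exact_mod_cast hr
    linarith
  have hfin : (r : ℝ) * Real.log x ≤ Real.log N := by
    have h6 := mul_le_mul_of_nonneg_left hlow hr0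
    have h7 : 2 * (m : ℝ) * (r * Real.log x) ≤ 2 * m * Real.log N := by nlinarith
    exact le_of_mul_le_mul_left h7 (by positivity)
  rw [← Real.log_pow, Real.log_le_log_iff (by positivity) hN0, hx, div_pow,
    div_le_iff₀ (by positivity)] at hfin
  have : (m : ℝ) ^ r ≤ (N : ℝ) ^ (r + 1) := by rw [pow_succ]; linarith
  exact_mod_cast this

end Finite

/-- The Moore bound for irregular graphs: a graph on `N` vertices all of whose cycles are longer
than `2 r` has at most `N ^ (1 + 1 / r)` edges.  Vertices of degree at most one are removed first;
as there are more edges than vertices, this does not decrease the average degree. -/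
theorem LocallyAcyclic.ncard_edgeSet_pow_le {r : ℕ} (hr : 1 ≤ r) {W : Type*} [Fintype W]
    {H : SimpleGraph W} (hH : H.LocallyAcyclic (2 * r)) :
    H.edgeSet.ncard ^ r ≤ Fintype.card W ^ (r + 1) := by
  classical
  induction hN : Fintype.card W using Nat.strong_induction_on generalizing W with
  | _ N ih =>
    rw [← coe_edgeFinset, Set.ncard_coe_finset]
    by_cases hmN : H.edgeFinset.card ≤ N
    · rcases Nat.eq_zero_or_pos N with h0 | h0
      · have : H.edgeFinset.card = 0 := by omega
        rw [this, zero_pow (by omega)]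
        exact Nat.zero_le _
      · exact (Nat.pow_le_pow_left hmN r).trans (Nat.pow_le_pow_right h0 (Nat.le_succ r))
    · push Not at hmN
      by_cases hdeg : ∀ v, 2 ≤ H.degree v
      · have : Nonempty W := by
          by_contra hne
          rw [not_nonempty_iff] at hne
          have : H.edgeFinset.card = 0 := by
            rw [Finset.card_eq_zero, Finset.eq_empty_iff_forall_notMem]
            intro e _
            induction e with | _ a _ => exact hne.elim a
          omega
        rw [← hN]
        exact hH.card_edgeFinset_pow_le_of_two_le_degree hr hdeg
      · push Not at hdeg
        obtain ⟨v, hv⟩ := hdeg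
        have hcard : Fintype.card ({v}ᶜ : Set W) = N - 1 := by
          rw [Fintype.card_compl_set, hN]; simp
        have hNpos : 0 < N := by rw [← hN]; exact Fintype.card_pos_iff.mpr ⟨v⟩
        have hI := ih (N - 1) (by omega) (hH.induce {v}ᶜ) hcard
        rw [← coe_edgeFinset, Set.ncard_coe_finset, card_edgeFinset_induce_compl_singleton,
          card_edgeFinset_deleteIncidenceSet] at hI
        set m := H.edgeFinset.card with hm
        have hm' : m - 1 ≤ m - H.degree v := by omega
        have hI' := (Nat.pow_le_pow_left hm' r).trans hI
        rcases Nat.lt_or_ge N 2 with h1 | h2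
        · have hN1 : N = 1 := by omega
          subst hN1
          simp only [Nat.sub_self, zero_pow (Nat.succ_ne_zero r), Nat.le_zero] at hI'
          rw [Nat.pow_eq_zero] at hI'
          omega
        · -- `m / N ≤ (m - 1) / (N - 1)` because `N < m`
          have hcross : m * (N - 1) ≤ (m - 1) * N := by
            clear_value m
            obtain ⟨a, rfl⟩ : ∃ a, m = a + 1 := ⟨m - 1, by omega⟩
            obtain ⟨b, rfl⟩ : ∃ b, N = b + 1 := ⟨N - 1, by omega⟩
            simp only [Nat.add_sub_cancel]
            nlinarith
          have h3 := Nat.pow_le_pow_left hcross r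
          rw [mul_pow, mul_pow] at h3
          have h4 : m ^ r * (N - 1) ^ r ≤ (N - 1) ^ (r + 1) * N ^ r :=
            h3.trans (Nat.mul_le_mul_right _ hI')
          have h5 : (N - 1) ^ (r + 1) * N ^ r = ((N - 1) * N ^ r) * (N - 1) ^ r := by ring
          rw [h5] at h4
          have h6 := Nat.le_of_mul_le_mul_right h4 (by positivity [show 0 < N - 1 by omega])
          calc m ^ r ≤ (N - 1) * N ^ r := h6
            _ ≤ N * N ^ r := Nat.mul_le_mul_right _ (by omega)
            _ = N ^ (r + 1) := by ring

end SimpleGraph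

/-! ### Reasoning about programs -/

namespace RealRAM

/-- `Run c s Q`: started in the state `s`, the program `c` halts, and the number of steps and the
final state satisfy `Q`. -/
def Run (c : Cmd) (s : State) (Q : ℕ → State → Prop) : Prop :=
  ∃ T s', Exec c s T s' ∧ Q T s'

theorem Run.mono {c : Cmd} {s : State} {Q Q' : ℕ → State → Prop} (h : Run c s Q)
    (hQ : ∀ T s', Q T s' → Q' T s') : Run c s Q' := by
  obtain ⟨T, s', he, hq⟩ := h
  exact ⟨T, s', he, hQ T s' hq⟩

theorem run_skip {s : State} {Q : ℕ → State → Prop} (h : Q 1 s) : Run .skip s Q :=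
  ⟨_, _, .skip s, h⟩

theorem run_setNat {s : State} {Q : ℕ → State → Prop} {a : ℕ} {i j e : NExpr}
    (h : Q (i.cost + j.cost + e.cost + 1) (s.setNat a (i.eval s) (j.eval s) (e.eval s))) :
    Run (.setNat a i j e) s Q :=
  ⟨_, _, .setNat s a i j e, h⟩

theorem run_setReal {s : State} {Q : ℕ → State → Prop} {a : ℕ} {i j : NExpr} {e : RExpr}
    (h : Q (i.cost + j.cost + e.cost + 1) (s.setReal a (i.eval s) (j.eval s) (e.eval s))) :
    Run (.setReal a i j e) s Q :=
  ⟨_, _, .setReal s a i j e, h⟩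

theorem run_seq {c d : Cmd} {s : State} {Q : ℕ → State → Prop}
    (h : Run c s fun T s' => Run d s' fun T' s'' => Q (T + T') s'') : Run (.seq c d) s Q := by
  obtain ⟨T, s', he, T', s'', he', hq⟩ := h
  exact ⟨_, _, .seq he he', hq⟩

theorem run_cond {b : BExpr} {c d : Cmd} {s : State} {Q : ℕ → State → Prop}
    (h1 : b.holds s → Run c s fun T s' => Q (b.cost + T + 1) s')
    (h2 : ¬ b.holds s → Run d s fun T s' => Q (b.cost + T + 1) s') : Run (.cond b c d) s Q := by
  by_cases hb : b.holds s
  · obtain ⟨T, s', he, hq⟩ := h1 hb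
    exact ⟨_, _, .condTrue hb he, hq⟩
  · obtain ⟨T, s', he, hq⟩ := h2 hb
    exact ⟨_, _, .condFalse hb he, hq⟩

attribute [simp] NExpr.eval NExpr.cost RExpr.eval RExpr.cost BExpr.holds BExpr.cost

@[simp]
theorem State.setNat_real (s : State) (a i j v : ℕ) : (s.setNat a i j v).real = s.real := rfl

@[simp]
theorem State.setReal_nat (s : State) (a i j : ℕ) (v : ℝ) : (s.setReal a i j v).nat = s.nat := rfl

@[simp]
theorem State.setNat_nat_apply (s : State) (a i j v a' i' j' : ℕ) : (s.setNat a i j v).nat a' i' j' =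
    if a' = a ∧ i' = i ∧ j' = j then v else s.nat a' i' j' := rfl

@[simp]
theorem State.setReal_real_apply (s : State) (a i j : ℕ) (v : ℝ) (a' i' j' : ℕ) :
    (s.setReal a i j v).real a' i' j' =
      if a' = a ∧ i' = i ∧ j' = j then v else s.real a' i' j' := rfl

@[simp]
theorem State.setNat_nat_of_ne (s : State) {a i j v a' : ℕ} (h : a' ≠ a) :
    (s.setNat a i j v).nat a' = s.nat a' := by
  funext x y
  simp [h]

@[simp]
theorem State.setReal_real_of_ne (s : State) {a i j a' : ℕ} {v : ℝ} (h : a' ≠ a) :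
    (s.setReal a i j v).real a' = s.real a' := by
  funext x y
  simp [h]

/-- The states `s` and `s'` agree outside the integer arrays `A` and the real arrays `B`. -/
def Frame (A B : List ℕ) (s s' : State) : Prop :=
  (∀ a, a ∉ A → s'.nat a = s.nat a) ∧ ∀ a, a ∉ B → s'.real a = s.real a

theorem Frame.refl (A B : List ℕ) (s : State) : Frame A B s s := ⟨fun _ _ => rfl, fun _ _ => rfl⟩

theorem Frame.trans {A B : List ℕ} {s s' s'' : State} (h : Frame A B s s') (h' : Frame A B s' s'') :
    Frame A B s s'' :=
  ⟨fun a ha => (h'.1 a ha).trans (h.1 a ha), fun a ha => (h'.2 a ha).trans (h.2 a ha)⟩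

theorem Frame.mono {A B A' B' : List ℕ} {s s' : State} (h : Frame A B s s')
    (hA : A ⊆ A') (hB : B ⊆ B') : Frame A' B' s s' :=
  ⟨fun a ha => h.1 a fun h' => ha (hA h'), fun a ha => h.2 a fun h' => ha (hB h')⟩

/-- The integer arrays to which a program writes. -/
def Cmd.nats : Cmd → List ℕ
  | .skip => []
  | .setNat a _ _ _ => [a]
  | .setReal _ _ _ _ => []
  | .seq c d => c.nats ++ d.nats
  | .cond _ c d => c.nats ++ d.nats
  | .loop _ c => c.nats

/-- The real arrays to which a program writes. -/
def Cmd.reals : Cmd → List ℕ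
  | .skip => []
  | .setNat _ _ _ _ => []
  | .setReal a _ _ _ => [a]
  | .seq c d => c.reals ++ d.reals
  | .cond _ c d => c.reals ++ d.reals
  | .loop _ c => c.reals

theorem Exec.frame {c : Cmd} {s s' : State} {T : ℕ} (h : Exec c s T s') :
    Frame c.nats c.reals s s' := by
  induction h with
  | skip => exact Frame.refl _ _ _
  | setNat => exact ⟨fun a ha => State.setNat_nat_of_ne _ (by simpa [Cmd.nats] using ha),
      fun _ _ => rfl⟩
  | setReal => exact ⟨fun _ _ => rfl,
      fun a ha => State.setReal_real_of_ne _ (by simpa [Cmd.reals] using ha)⟩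
  | seq _ _ ih ih' =>
    refine Frame.trans (ih.mono ?_ ?_) (ih'.mono ?_ ?_) <;> simp [Cmd.nats, Cmd.reals]
  | condTrue _ _ ih => exact ih.mono (by simp [Cmd.nats]) (by simp [Cmd.reals])
  | condFalse _ _ ih => exact ih.mono (by simp [Cmd.nats]) (by simp [Cmd.reals])
  | loopTrue _ _ _ ih ih' => exact Frame.trans ih ih'
  | loopFalse => exact Frame.refl _ _ _

/-- A program changes only the arrays to which it writes. -/
theorem run_frame {c : Cmd} {s : State} {Q : ℕ → State → Prop}
    (h : Run c s fun T s' => Frame c.nats c.reals s s' → Q T s') : Run c s Q := by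
  obtain ⟨T, s', he, hq⟩ := h
  exact ⟨T, s', he, hq he.frame⟩

/-- Rule for loops with at most `N` iterations: the invariant `J` speaks about the number of finished
iterations, the number of steps spent on them, and the state. -/
theorem run_loop {b : BExpr} {c : Cmd} {s : State} {Q : ℕ → State → Prop} (N : ℕ)
    (J : ℕ → ℕ → State → Prop) (h0 : J 0 0 s)
    (hstep : ∀ j T s', Frame c.nats c.reals s s' → J j T s' → b.holds s' →
      j < N ∧ Run c s' fun T' s'' => J (j + 1) (T + (b.cost + T' + 1)) s'')
    (hend : ∀ j T s', Frame c.nats c.reals s s' → J j T s' → ¬ b.holds s' →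
      Q (T + (b.cost + 1)) s') :
    Run (.loop b c) s Q := by
  have key : ∀ m j T s', N - j = m → Frame c.nats c.reals s s' → J j T s' →
      ∃ T' s'', Exec (.loop b c) s' T' s'' ∧ Q (T + T') s'' := by
    intro m
    induction m using Nat.strong_induction_on with
    | _ m ih =>
      intro j T s' hm hF hJ
      by_cases hb : b.holds s'
      · obtain ⟨hj, T1, s1, he1, hJ1⟩ := hstep j T s' hF hJ hb
        obtain ⟨T2, s2, he2, hq⟩ := ih (N - (j + 1)) (by omega) _ _ s1 rfl (hF.trans he1.frame) hJ1
        refine ⟨_, _, .loopTrue hb he1 he2, ?_⟩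
        have : T + (b.cost + T1 + T2 + 1) = T + (b.cost + T1 + 1) + T2 := by ring
        rwa [this]
      · exact ⟨_, _, .loopFalse hb, hend j T s' hF hJ hb⟩
  obtain ⟨T', s'', he, hq⟩ := key _ 0 0 s rfl (Frame.refl _ _ _) h0
  exact ⟨T', s'', he, by simpa using hq⟩

/-- The integer in the cell `(0, 0)` of the array `a`. -/
@[simp] def nv (a : ℕ) : NExpr := .get a (.lit 0) (.lit 0)

/-- The real number in the cell `(0, 0)` of the array `a`. -/
@[simp] def rv (a : ℕ) : RExpr := .get a (.lit 0) (.lit 0)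

/-- Assignment to the cell `(0, 0)` of an integer array. -/
@[simp] def setN (a : ℕ) (e : NExpr) : Cmd := .setNat a (.lit 0) (.lit 0) e

/-- Assignment to the cell `(0, 0)` of a real array. -/
@[simp] def setR (a : ℕ) (e : RExpr) : Cmd := .setReal a (.lit 0) (.lit 0) e

/-- `for i = 0, …, b - 1 do c`, where `i` and `b` are the cells `(0, 0)` of two integer arrays. -/
def forLoop (i b : ℕ) (c : Cmd) : Cmd :=
  .seq (setN i (.lit 0))
    (.loop (.natLt (nv i) (nv b)) (.seq c (setN i (.add (nv i) (.lit 1)))))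

/-- Rule for counting loops with amortised running time: the invariant speaks about the number of
finished iterations, the number of steps spent on them, and the state. -/
theorem run_forLoop {i b : ℕ} {c : Cmd} {s : State} {Q : ℕ → State → Prop} (N : ℕ)
    (J : ℕ → ℕ → State → Prop) (hb : s.nat b 0 0 = N) (hbi : b ≠ i) (hbc : b ∉ c.nats)
    (hic : i ∉ c.nats) (hJ : ∀ j T s' v, J j T s' → J j T (s'.setNat i 0 0 v)) (h0 : J 0 0 s)
    (hstep : ∀ j T s', j < N → Frame (i :: c.nats) c.reals s s' → s'.nat i 0 0 = j → J j T s' →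
      Run c s' fun T' s'' => J (j + 1) (T + T' + 16) s'')
    (hend : ∀ T s', Frame (i :: c.nats) c.reals s s' → J N T s' → Q (T + 12) s') :
    Run (forLoop i b c) s Q := by
  have hbs : ∀ {s' : State}, Frame (i :: c.nats) c.reals s s' → s'.nat b 0 0 = N := fun h => by
    rw [h.1 b (by simp [hbi, hbc]), hb]
  have hset : ∀ {s' : State} (v : ℕ), Frame (i :: c.nats) c.reals s s' →
      Frame (i :: c.nats) c.reals s (s'.setNat i 0 0 v) := fun v h =>
    ⟨fun a ha => (State.setNat_nat_of_ne _ (by rintro rfl; simp at ha)).trans (h.1 a ha), h.2⟩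
  refine run_seq (run_setNat ?_)
  simp only [NExpr.eval, NExpr.cost]
  refine run_loop N (fun j T s' => j ≤ N ∧ s'.nat i 0 0 = j ∧ Frame (i :: c.nats) c.reals s s' ∧
    J j T s') ⟨Nat.zero_le _, by simp, hset 0 (Frame.refl _ _ _), hJ _ _ _ _ h0⟩ ?_ ?_
  · rintro j T s' - ⟨-, hij, hF, hI⟩ hbs'
    have hlt : j < N := by simpa [hij, hbs hF] using hbs'
    refine ⟨hlt, run_seq (run_frame ((hstep j T s' hlt hF hij hI).mono ?_))⟩
    intro T' s'' hI'' hF''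
    refine run_setNat ?_
    have hi'' : s''.nat i 0 0 = j := by rw [hF''.1 i hic, hij]
    simp only [nv, NExpr.eval, NExpr.cost, BExpr.cost, hi'']
    refine ⟨hlt, by simp, hset _ (hF.trans (hF''.mono (by simp) (by simp))), hJ _ _ _ _ ?_⟩
    convert hI'' using 1; ring
  · rintro j T s' - ⟨hj, hij, hF, hI⟩ hbs'
    have hlt : ¬ j < N := by simpa [hij, hbs hF] using hbs'
    obtain rfl : j = N := by omega
    have := hend T s' hF hI
    simp only [nv, NExpr.cost, BExpr.cost]
    convert this using 1; ring

/-- Rule for counting loops all of whose iterations take at most `τ` steps. -/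
theorem run_forLoop_le {i b : ℕ} {c : Cmd} {s : State} {Q : ℕ → State → Prop} (N τ : ℕ)
    (J : ℕ → State → Prop) (hb : s.nat b 0 0 = N) (hbi : b ≠ i) (hbc : b ∉ c.nats)
    (hic : i ∉ c.nats) (hJ : ∀ j s' v, J j s' → J j (s'.setNat i 0 0 v)) (h0 : J 0 s)
    (hstep : ∀ j s', j < N → Frame (i :: c.nats) c.reals s s' → s'.nat i 0 0 = j → J j s' →
      Run c s' fun T' s'' => T' ≤ τ ∧ J (j + 1) s'')
    (hend : ∀ T s', T ≤ N * (τ + 16) + 12 → Frame (i :: c.nats) c.reals s s' → J N s' → Q T s') :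
    Run (forLoop i b c) s Q := by
  refine run_forLoop N (fun j T s' => T ≤ j * (τ + 16) ∧ J j s') hb hbi hbc hic
    (fun j T s' v h => ⟨h.1, hJ j s' v h.2⟩) ⟨by simp, h0⟩ ?_ ?_
  · rintro j T s' hj hF hij ⟨hT, hI⟩
    refine (hstep j s' hj hF hij hI).mono ?_
    rintro T' s'' ⟨hT', hI''⟩
    exact ⟨by nlinarith, hI''⟩
  · rintro T s' hF ⟨hT, hI⟩
    exact hend _ _ (by omega) hF hI

/-- `for i = 0, …, b - 1 do for j = 0, …, b - 1 do c`. -/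
def forLoop2 (i j b : ℕ) (c : Cmd) : Cmd := forLoop i b (forLoop j b c)

/-- Rule for double loops which replace the entry `(x, y)` of an array by `F x y`, one after the
other.  At any time, each entry of the array is either the original one or the final one. -/
theorem run_forLoop2 {α : Type*} (arr : State → ℕ → ℕ → α) (N τ : ℕ) (F : ℕ → ℕ → α) {i j b : ℕ}
    {c : Cmd} {s : State} {Q : ℕ → State → Prop} (hb : s.nat b 0 0 = N)
    (hb' : b ∉ i :: j :: c.nats) (hic : i ∉ j :: c.nats) (hjc : j ∉ c.nats)
    (harr : ∀ a ∈ [i, j], ∀ s' v, arr (s'.setNat a 0 0 v) = arr s')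
    (hbody : ∀ x y s', x < N → y < N → Frame (i :: j :: c.nats) c.reals s s' → s'.nat i 0 0 = x →
      s'.nat j 0 0 = y → arr s' x y = arr s x y →
      (∀ x' y', arr s' x' y' = F x' y' ∨ arr s' x' y' = arr s x' y') →
      Run c s' fun T s'' => T ≤ τ ∧
        ∀ x' y', arr s'' x' y' = if x' = x ∧ y' = y then F x y else arr s' x' y')
    (hend : ∀ T s', T ≤ N * (N * (τ + 16) + 28) + 12 → Frame (i :: j :: c.nats) c.reals s s' →
      arr s' = (fun x y => if x < N ∧ y < N then F x y else arr s x y) → Q T s') :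
    Run (forLoop2 i j b c) s Q := by
  simp only [List.mem_cons, not_or] at hb' hic
  have hnats : (forLoop j b c).nats ⊆ j :: c.nats := by
    simp [forLoop, Cmd.nats]
  have hreals : (forLoop j b c).reals ⊆ c.reals := by
    simp [forLoop, Cmd.reals]
  have hsub : i :: (forLoop j b c).nats ⊆ i :: j :: c.nats := List.cons_subset_cons _ hnats
  refine run_forLoop_le N (N * (τ + 16) + 12) (fun x s' =>
    ∀ x' y', arr s' x' y' = if x' < N ∧ y' < N ∧ x' < x then F x' y' else arr s x' y')
    hb hb'.1 (fun h => by have := hnats h; simp_all) (fun h => by have := hnats h; simp_all)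
    (fun _ _ _ h => by rwa [harr i (by simp)]) (fun _ _ => by simp) ?_ ?_
  · intro x s' hx hF hxs harr'
    refine run_forLoop_le N τ (fun y s'' =>
      ∀ x' y', arr s'' x' y' = if x' < N ∧ y' < N ∧ (x' < x ∨ x' = x ∧ y' < y) then F x' y'
        else arr s x' y')
      ((congrFun (congrFun (hF.1 b ?_) 0) 0).trans hb) hb'.2.1 hb'.2.2 hjc
      (fun _ _ _ h => by rwa [harr j (by simp)]) ?_ ?_ ?_
    · intro h
      have := hsub h
      simp_all
    · intro x' y'
      rw [harr']
      simp
    · intro y s'' hy hF' hys harr''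
      refine (hbody x y s'' hx hy ((hF.mono hsub hreals).trans (hF'.mono (by simp) (by simp)))
        ?_ hys ?_ ?_).mono ?_
      · rw [hF'.1 i (by simp [hic]), hxs]
      · rw [harr'']
        simp
      · intro x' y'
        rw [harr'']
        split_ifs
        · exact Or.inl rfl
        · exact Or.inr rfl
      · rintro T s3 ⟨hT, h3⟩
        refine ⟨hT, ?_⟩
        intro x' y'
        rw [h3, harr'']
        by_cases h : x' = x ∧ y' = y
        · obtain ⟨rfl, rfl⟩ := h
          simp [hx, hy]
        · rw [if_neg h]
          refine if_congr ?_ rfl rfl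
          constructor <;> rintro ⟨h1, h2, h4⟩ <;> refine ⟨h1, h2, ?_⟩ <;> omega
    · intro T s'' hT hF' harr''
      refine ⟨hT, ?_⟩
      intro x' y'
      rw [harr'']
      refine if_congr ?_ rfl rfl
      constructor <;> rintro ⟨h1, h2, h4⟩ <;> refine ⟨h1, h2, ?_⟩ <;> omega
  · intro T s' hT hF harr'
    refine hend _ _ hT (hF.mono hsub hreals) ?_
    funext x y
    rw [harr']
    refine if_congr ?_ rfl rfl
    constructor
    · rintro ⟨h1, h2, -⟩
      exact ⟨h1, h2⟩
    · rintro ⟨h1, h2⟩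
      exact ⟨h1, h2, h1⟩

/-- The matrix `W` after adding the possibility to go from `a` to `b` for free. -/
noncomputable def relaxed (n : ℕ) (W : ℕ → ℕ → ℝ) (a b : ℕ) (x y : ℕ) : ℝ :=
  if x < n ∧ y < n then min (W x y) (W x a + W b y) else W x y

/-- Program for `RealRAM.relaxed`; the matrix is the real array `A`, and `a` and `b` are the cells
`(0, 0)` of the integer arrays `u` and `v`. -/
def relax (A u v : ℕ) : Cmd :=
  forLoop2 20 21 0 (.cond
    (.realLt (.add (.get A (nv 20) (nv u)) (.get A (nv v) (nv 21))) (.get A (nv 20) (nv 21)))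
    (.setReal A (nv 20) (nv 21) (.add (.get A (nv 20) (nv u)) (.get A (nv v) (nv 21))))
    .skip)

theorem run_relax {A u v : ℕ} (s : State) {n a b : ℕ} (hn : s.nat 0 0 0 = n)
    (hu : u ≠ 20 ∧ u ≠ 21) (hv : v ≠ 20 ∧ v ≠ 21) (ha : s.nat u 0 0 = a) (hb : s.nat v 0 0 = b)
    (hnonneg : 0 ≤ s.real A b a) :
    Run (relax A u v) s fun T s' => T ≤ n * (n * 100 + 28) + 12 ∧
      s'.real A = relaxed n (s.real A) a b := by
  refine run_forLoop2 (fun s => s.real A) n 84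
    (fun x y => min (s.real A x y) (s.real A x a + s.real A b y)) hn (by simp [Cmd.nats])
    (by simp [Cmd.nats]) (by simp [Cmd.nats]) (fun _ _ _ _ => rfl) ?_ (fun _ _ hT _ h => ⟨hT, h⟩)
  intro x y s' hx hy hF hi hj hxy hor
  have hua : s'.nat u 0 0 = a := by rw [hF.1 u (by simp [hu, Cmd.nats]), ha]
  have hvb : s'.nat v 0 0 = b := by rw [hF.1 v (by simp [hv, Cmd.nats]), hb]
  -- row `b` and column `a` do not change
  have h1 : s'.real A x a = s.real A x a := by
    rcases hor x a with h | h
    · rw [h, min_eq_left]; linarith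
    · exact h
  have h2 : s'.real A b y = s.real A b y := by
    rcases hor b y with h | h
    · rw [h, min_eq_left]; linarith
    · exact h
  refine run_cond (fun hc => run_setReal ?_) (fun hc => run_skip ?_)
  · simp only [BExpr.holds, RExpr.eval, nv, NExpr.eval, hi, hj, hua, hvb, h1, h2, hxy] at hc
    refine ⟨by simp, fun x' y' => ?_⟩
    simp [hi, hj, hua, hvb, h1, h2, min_eq_right hc.le]
  · simp only [BExpr.holds, RExpr.eval, nv, NExpr.eval, hi, hj, hua, hvb, h1, h2, hxy] at hc
    refine ⟨by simp, fun x' y' => ?_⟩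
    split_ifs with h
    · rw [h.1, h.2, hxy, min_eq_left (not_lt.mp hc)]
    · rfl

end RealRAM

/-! ### Graph distance and dilation -/

namespace MetricGraph

variable {M : Type*} [MetricSpace M] {n : ℕ} (p : Fin n ↪ M) {G G' : SimpleGraph (Fin n)}

theorem walkLength_nil (u : Fin n) : walkLength p (SimpleGraph.Walk.nil : G.Walk u u) = 0 := by
  simp [walkLength]

theorem walkLength_cons {u v w : Fin n} (h : G.Adj u v) (q : G.Walk v w) :
    walkLength p (SimpleGraph.Walk.cons h q) = edist (p u) (p v) + walkLength p q := by
  simp [walkLength]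

theorem graphDist_le_walkLength {u v : Fin n} (w : G.Walk u v) : graphDist p G u v ≤ walkLength p w :=
  iInf_le _ w

theorem graphDist_self (u : Fin n) : graphDist p G u u = 0 :=
  le_antisymm ((graphDist_le_walkLength p SimpleGraph.Walk.nil).trans (walkLength_nil p u).le)
    (zero_le)

theorem graphDist_le_edist {u v : Fin n} (h : G.Adj u v) :
    graphDist p G u v ≤ edist (p u) (p v) := by
  refine (graphDist_le_walkLength p (SimpleGraph.Walk.cons h SimpleGraph.Walk.nil)).trans ?_
  rw [walkLength_cons, walkLength_nil, add_zero]

theorem graphDist_triangle (u v w : Fin n) :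
    graphDist p G u w ≤ graphDist p G u v + graphDist p G v w := by
  refine ENNReal.le_of_forall_pos_le_add fun ε hε hlt => ?_
  by_cases h1 : graphDist p G u v = ⊤
  · simp [h1]
  by_cases h2 : graphDist p G v w = ⊤
  · simp [h2]
  have hε2 : (ε / 2 : ℝ≥0∞) ≠ 0 := by
    simp [ENNReal.div_eq_zero_iff, hε.ne']
  obtain ⟨q1, hq1⟩ := iInf_lt_iff.mp (ENNReal.lt_add_right h1 hε2)
  obtain ⟨q2, hq2⟩ := iInf_lt_iff.mp (ENNReal.lt_add_right h2 hε2)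
  have happ : walkLength p (q1.append q2) = walkLength p q1 + walkLength p q2 := by
    simp [walkLength, SimpleGraph.Walk.darts_append]
  refine (graphDist_le_walkLength p (q1.append q2)).trans ?_
  rw [happ]
  refine (add_le_add hq1.le hq2.le).trans (le_of_eq ?_)
  rw [add_add_add_comm, ENNReal.add_halves]
  rfl

theorem graphDist_anti (h : G ≤ G') (u v : Fin n) : graphDist p G' u v ≤ graphDist p G u v := by
  refine le_iInf fun w => (graphDist_le_walkLength p (w.mapLe h)).trans (le_of_eq ?_)
  induction w with
  | nil => simp [walkLength]
  | cons ha q ih =>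
    rw [walkLength_cons, ← ih]
    exact walkLength_cons p (h ha) (q.mapLe h)

theorem graphDist_comm (u v : Fin n) : graphDist p G u v = graphDist p G v u := by
  have key : ∀ u v : Fin n, graphDist p G u v ≤ graphDist p G v u := by
    intro u v
    refine le_iInf fun w => (graphDist_le_walkLength p w.reverse).trans (le_of_eq ?_)
    simp only [walkLength, SimpleGraph.Walk.darts_reverse, List.map_reverse, List.map_map,
      List.sum_reverse]
    congr 1
    refine List.map_congr_left fun e _ => ?_
    simp [edist_comm]
  exact le_antisymm (key u v) (key v u)

theorem edist_pos_of_ne {u v : Fin n} (h : u ≠ v) : edist (p u) (p v) ≠ 0 := by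
  simpa [edist_eq_zero] using h

theorem graphDist_le_dilation_mul (u v : Fin n) :
    graphDist p G u v ≤ dilation p G * edist (p u) (p v) := by
  by_cases huv : u = v
  · subst huv; simp [graphDist_self]
  · have h0 := edist_pos_of_ne p huv
    have hd : graphDist p G u v / edist (p u) (p v) ≤ dilation p G := by
      refine le_sInf fun t ht => ?_
      exact ENNReal.div_le_of_le_mul (ht u v)
    exact (ENNReal.div_le_iff h0 (edist_ne_top _ _)).mp hd

theorem dilation_le {t : ℝ≥0∞} (h : ∀ u v, graphDist p G u v ≤ t * edist (p u) (p v)) :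
    dilation p G ≤ t := sInf_le h

theorem edist_le_walkLength {u v : Fin n} (w : G.Walk u v) :
    edist (p u) (p v) ≤ walkLength p w := by
  induction w with
  | nil => simp
  | cons h q ih =>
    rw [walkLength_cons]
    exact (edist_triangle _ _ _).trans (by gcongr)

theorem edist_le_graphDist (u v : Fin n) : edist (p u) (p v) ≤ graphDist p G u v :=
  le_iInf fun w => edist_le_walkLength p w

theorem one_le_dilation (hn : 2 ≤ n) : 1 ≤ dilation p G := by
  have h01 : (⟨0, by omega⟩ : Fin n) ≠ ⟨1, by omega⟩ := by simp
  have h := (edist_le_graphDist p (G := G) ⟨0, by omega⟩ ⟨1, by omega⟩).trans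
    (graphDist_le_dilation_mul p _ _)
  have h0 := edist_pos_of_ne p h01
  rw [← ENNReal.div_le_iff h0 (edist_ne_top _ _), ENNReal.div_self h0 (edist_ne_top _ _)] at h
  exact h

theorem walkLength_bypass_le {u v : Fin n} (w : G.Walk u v) :
    walkLength p w.bypass ≤ walkLength p w := by
  obtain ⟨l, hl, hs⟩ := List.subperm_of_subset
    (List.Nodup.of_map _ w.bypass_isPath.isTrail.edges_nodup) w.darts_bypass_subset_darts
  rw [walkLength, walkLength, ← (hl.map _).sum_eq]
  exact (hs.map _).sum_le_sum fun _ _ => zero_le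

/-- Shortest paths exist. -/
theorem exists_isPath_walkLength_le {u v : Fin n} {ℓ : ℝ≥0∞} (hℓ : ℓ ≠ ⊤)
    (h : graphDist p G u v ≤ ℓ) : ∃ w : G.Walk u v, w.IsPath ∧ walkLength p w ≤ ℓ := by
  classical
  have hne : Nonempty (G.Path u v) := by
    by_contra hemp
    rw [not_nonempty_iff] at hemp
    have : IsEmpty (G.Walk u v) := ⟨fun w => hemp.elim w.toPath⟩
    rw [graphDist, iInf_of_empty, top_le_iff] at h
    exact hℓ h
  obtain ⟨q, hq⟩ := Finite.exists_min fun q : G.Path u v => walkLength p q.1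
  refine ⟨q.1, q.2, le_trans (le_iInf fun w => ?_) h⟩
  exact (hq w.toPath).trans (walkLength_bypass_le p w)

/-- The graph of the edges of `G` of length at most `ℓ`. -/
def short (p : Fin n ↪ M) (G : SimpleGraph (Fin n)) (ℓ : ℝ) : SimpleGraph (Fin n) where
  Adj u v := G.Adj u v ∧ dist (p u) (p v) ≤ ℓ
  symm := ⟨fun _ _ h => ⟨h.1.symm, by rw [dist_comm]; exact h.2⟩⟩
  loopless := ⟨fun _ h => h.1.ne rfl⟩

theorem short_mono {ℓ ℓ' : ℝ} (h : ℓ ≤ ℓ') : short p G ℓ ≤ short p G ℓ' :=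
  fun _ _ ha => ⟨ha.1, ha.2.trans h⟩

theorem short_le (ℓ : ℝ) : short p G ℓ ≤ G := fun _ _ ha => ha.1

theorem reachable_short_of_walk {u v : Fin n} {ℓ : ℝ} (w : G.Walk u v) (hℓ : 0 ≤ ℓ)
    (h : walkLength p w ≤ ENNReal.ofReal ℓ) : (short p G ℓ).Reachable u v := by
  induction w with
  | nil => exact SimpleGraph.Reachable.refl _
  | cons ha q ih =>
    rw [walkLength_cons] at h
    have h1 : edist (p _) (p _) ≤ ENNReal.ofReal ℓ := le_self_add.trans h
    rw [edist_dist, ENNReal.ofReal_le_ofReal_iff hℓ] at h1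
    refine SimpleGraph.Reachable.trans (SimpleGraph.Adj.reachable ?_) (ih (le_add_self.trans h))
    exact ⟨ha, h1⟩

theorem reachable_short_of_graphDist_le {u v : Fin n} {ℓ : ℝ} (hℓ : 0 ≤ ℓ)
    (h : graphDist p G u v ≤ ENNReal.ofReal ℓ) : (short p G ℓ).Reachable u v := by
  obtain ⟨w, -, hw⟩ := exists_isPath_walkLength_le p ENNReal.ofReal_ne_top h
  exact reachable_short_of_walk p w hℓ hw

theorem graphDist_le_of_reachable_short {u v : Fin n} {ℓ : ℝ}
    (h : (short p G ℓ).Reachable u v) : graphDist p G u v ≤ ENNReal.ofReal (n * ℓ) := by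
  classical
  obtain ⟨w⟩ := h
  have hlen : w.bypass.length ≤ n := by
    have := w.bypass_isPath.length_lt
    rw [Fintype.card_fin] at this
    exact this.le
  have key : ∀ {a b : Fin n} (q : (short p G ℓ).Walk a b),
      walkLength p q ≤ q.length * ENNReal.ofReal ℓ := by
    intro a b q
    induction q with
    | nil => simp [walkLength]
    | cons ha q ih =>
      rw [walkLength_cons, SimpleGraph.Walk.length_cons, Nat.cast_add, Nat.cast_one, add_mul,
        one_mul, add_comm]
      refine add_le_add ih ?_
      rw [edist_dist]
      exact ENNReal.ofReal_le_ofReal ha.2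
  refine (graphDist_anti p (short_le p ℓ) u v).trans ((graphDist_le_walkLength p w.bypass).trans
    ((key _).trans ?_))
  rw [ENNReal.ofReal_mul (by positivity), ENNReal.ofReal_natCast]
  gcongr

/-- An optimal set of additional edges exists. -/
theorem exists_dilation_le_of_optDilation_le {k : ℕ} {t : ℝ≥0∞} (h : optDilation p G k ≤ t) :
    ∃ S : SimpleGraph (Fin n), S.edgeSet.ncard ≤ k ∧ dilation p (G ⊔ S) ≤ t := by
  have hne : Nonempty {S : SimpleGraph (Fin n) // S.edgeSet.ncard ≤ k} := ⟨⟨⊥, by simp⟩⟩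
  obtain ⟨S, hS⟩ := Finite.exists_min fun S : {S : SimpleGraph (Fin n) // S.edgeSet.ncard ≤ k} =>
    dilation p (G ⊔ S.1)
  refine ⟨S.1, S.2, le_trans ?_ h⟩
  rw [optDilation]
  exact le_iInf₂ fun S' hS' => hS ⟨S', hS'⟩

theorem optDilation_le {k : ℕ} {S : SimpleGraph (Fin n)} (hS : S.edgeSet.ncard ≤ k) :
    optDilation p G k ≤ dilation p (G ⊔ S) := iInf₂_le S hS

theorem one_le_optDilation (hn : 2 ≤ n) (k : ℕ) : 1 ≤ optDilation p G k :=
  le_iInf₂ fun _ _ => one_le_dilation p hn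

end MetricGraph

/-! ### All shortest paths -/

namespace MetricGraph

variable {M : Type*} [MetricSpace M] {n : ℕ} (p : Fin n ↪ M) (G : SimpleGraph (Fin n))

/-- The distance matrix, extended by zeros. -/
noncomputable def distMatrix (i j : ℕ) : ℝ :=
  if h : i < n ∧ j < n then dist (p ⟨i, h.1⟩) (p ⟨j, h.2⟩) else 0

theorem distMatrix_coe (u v : Fin n) : distMatrix p u v = dist (p u) (p v) := by
  simp [distMatrix]

theorem distMatrix_nonneg (i j : ℕ) : 0 ≤ distMatrix p i j := by
  rw [distMatrix]; split_ifs <;> simp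

theorem distMatrix_pos {i j : ℕ} (hi : i < n) (hj : j < n) (h : i ≠ j) : 0 < distMatrix p i j := by
  rw [distMatrix, dif_pos ⟨hi, hj⟩]
  simpa using h

theorem distMatrix_comm (i j : ℕ) : distMatrix p i j = distMatrix p j i := by
  rw [distMatrix, distMatrix]
  by_cases h : i < n ∧ j < n
  · rw [dif_pos h, dif_pos h.symm, dist_comm]
  · rw [dif_neg h, dif_neg (fun h' => h h'.symm)]

theorem distMatrix_self (i : ℕ) : distMatrix p i i = 0 := by
  rw [distMatrix]; split_ifs <;> simp

theorem edist_eq_ofReal_distMatrix (u v : Fin n) :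
    edist (p u) (p v) = ENNReal.ofReal (distMatrix p u v) := by
  rw [distMatrix_coe, edist_dist]

/-- The real matrix `D` describes the graph distance of `G`; values from `B` on stand for a graph
distance of at least that size, in particular for missing paths. -/
structure IsGraphDist (D : ℕ → ℕ → ℝ) (B : ℝ) : Prop where
  nonneg : ∀ {x y}, x < n → y < n → 0 ≤ D x y
  self : ∀ {x}, x < n → D x x = 0
  symm : ∀ {x y}, x < n → y < n → D x y = D y x
  triangle : ∀ {x y z}, x < n → y < n → z < n → D x z ≤ D x y + D y z
  le_of_adj : ∀ {u v : Fin n}, G.Adj u v → D u v ≤ distMatrix p u v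
  distMatrix_le : ∀ {x y}, x < n → y < n → distMatrix p x y ≤ D x y
  graphDist_le : ∀ {u v : Fin n} {ℓ : ℝ}, ℓ < B → D u v ≤ ℓ → graphDist p G u v ≤ ENNReal.ofReal ℓ

open Classical in
/-- The lengths of the edges; pairs of distinct nonadjacent vertices get the value `B`. -/
noncomputable def edgeMatrix (B : ℝ) (i j : ℕ) : ℝ :=
  if i < n ∧ j < n then
    if i = j then 0
    else if ∃ (hi : i < n) (hj : j < n), G.Adj ⟨i, hi⟩ ⟨j, hj⟩ then distMatrix p i j else B
  else 0

/-- The matrix computed by the first `m` rounds of the Floyd–Warshall algorithm. -/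
noncomputable def floyd (n : ℕ) (D : ℕ → ℕ → ℝ) : ℕ → ℕ → ℕ → ℝ
  | 0 => D
  | m + 1 => RealRAM.relaxed n (floyd n D m) m m

/-- The invariant of the Floyd–Warshall algorithm; in the round `m`, the triangle inequality is
valid for all intermediate vertices below `m`. -/
structure FloydInv (B : ℝ) (m : ℕ) (D : ℕ → ℕ → ℝ) : Prop where
  self : ∀ {x}, x < n → D x x = 0
  symm : ∀ {x y}, x < n → y < n → D x y = D y x
  triangle : ∀ {x y z}, x < n → y < n → z < n → y < m → D x z ≤ D x y + D y z
  le_of_adj : ∀ {u v : Fin n}, G.Adj u v → D u v ≤ distMatrix p u v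
  distMatrix_le : ∀ {x y}, x < n → y < n → distMatrix p x y ≤ D x y
  graphDist_le : ∀ {u v : Fin n}, D u v < B → graphDist p G u v ≤ ENNReal.ofReal (D u v)

variable {p G}

theorem FloydInv.nonneg {B : ℝ} {m : ℕ} {D : ℕ → ℕ → ℝ} (h : FloydInv p G B m D) {x y : ℕ}
    (hx : x < n) (hy : y < n) : 0 ≤ D x y := (distMatrix_nonneg p x y).trans (h.distMatrix_le hx hy)

theorem distMatrix_triangle (p : Fin n ↪ M) {x y z : ℕ} (hx : x < n) (hy : y < n) (hz : z < n) :
    distMatrix p x z ≤ distMatrix p x y + distMatrix p y z := by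
  simp only [distMatrix, hx, hy, hz, and_self, dif_pos]
  exact dist_triangle _ _ _

theorem floydInv_edgeMatrix {B : ℝ} (hB : ∀ x y, distMatrix p x y ≤ B) :
    FloydInv p G B 0 (edgeMatrix p G B) where
  self := fun hx => by simp [edgeMatrix, hx]
  symm := fun {x y} hx hy => by
    have hadj : (∃ (hi : x < n) (hj : y < n), G.Adj ⟨x, hi⟩ ⟨y, hj⟩) ↔
        ∃ (hi : y < n) (hj : x < n), G.Adj ⟨y, hi⟩ ⟨x, hj⟩ :=
      ⟨fun ⟨a, b, c⟩ => ⟨b, a, c.symm⟩, fun ⟨a, b, c⟩ => ⟨b, a, c.symm⟩⟩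
    rw [edgeMatrix, edgeMatrix, if_pos (And.intro hx hy), if_pos (And.intro hy hx),
      distMatrix_comm p x y]
    classical
    refine if_congr eq_comm rfl ?_
    by_cases hc : ∃ (hi : x < n) (hj : y < n), G.Adj ⟨x, hi⟩ ⟨y, hj⟩
    · rw [if_pos hc, if_pos (hadj.mp hc)]
    · rw [if_neg hc, if_neg (fun h => hc (hadj.mpr h))]
  triangle := fun _ _ _ h => by omega
  le_of_adj := fun {u v} h => by
    have : (u : ℕ) ≠ v := fun h' => h.ne (Fin.ext h')
    simp [edgeMatrix, h, this]
  distMatrix_le := fun {x y} hx hy => by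
    simp only [edgeMatrix, hx, hy, and_self, if_true]
    split_ifs with h1 h2
    · rw [h1, distMatrix_self]
    · exact le_rfl
    · exact hB _ _
  graphDist_le := fun {u v} h => by
    simp only [edgeMatrix, u.2, v.2, and_self, if_true] at h ⊢
    split_ifs at h ⊢ with h1 h2
    · rw [Fin.ext h1, graphDist_self]; simp
    · obtain ⟨_, _, h2⟩ := h2
      rw [← edist_eq_ofReal_distMatrix]
      exact graphDist_le_edist p h2
    · exact absurd h (lt_irrefl _)

theorem FloydInv.step {B : ℝ} {m : ℕ} {D : ℕ → ℕ → ℝ} (hm : m < n) (h : FloydInv p G B m D) :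
    FloydInv p G B (m + 1) (RealRAM.relaxed n D m m) := by
  have e : ∀ {x y}, x < n → y < n → RealRAM.relaxed n D m m x y = min (D x y) (D x m + D m y) :=
    fun hx hy => by simp [RealRAM.relaxed, hx, hy]
  have hmm := h.self hm
  refine ⟨fun {x} hx => ?_, fun {x y} hx hy => ?_, fun {x y z} hx hy hz hym => ?_,
    fun {u v} huv => ?_, fun {x y} hx hy => ?_, fun {u v} huv => ?_⟩
  · rw [e hx hx, h.self hx, min_eq_left]
    exact add_nonneg (h.nonneg hx hm) (h.nonneg hm hx)
  · rw [e hx hy, e hy hx, h.symm hx hy, h.symm hx hm, h.symm hm hy, add_comm]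
  · rw [e hx hz, e hx hy, e hy hz]
    have n1 := h.nonneg hm hy
    have n2 := h.nonneg hy hm
    rcases Nat.lt_succ_iff_lt_or_eq.mp hym with hlt | rfl
    · have t1 := h.triangle hx hy hz hlt
      have t2 := h.triangle hm hy hz hlt
      have t3 := h.triangle hx hy hm hlt
      rcases min_cases (D x y) (D x m + D m y) with ⟨h1, -⟩ | ⟨h1, -⟩ <;>
      rcases min_cases (D y z) (D y m + D m z) with ⟨h2, -⟩ | ⟨h2, -⟩ <;> rw [h1, h2]
      · exact (min_le_left _ _).trans t1
      · exact (min_le_right _ _).trans (by linarith)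
      · exact (min_le_right _ _).trans (by linarith)
      · exact (min_le_right _ _).trans (by linarith)
    · rw [hmm, add_zero, min_self, zero_add, min_self]
      exact min_le_right _ _
  · rw [e u.2 v.2]
    exact (min_le_left _ _).trans (h.le_of_adj huv)
  · rw [e hx hy]
    refine le_min (h.distMatrix_le hx hy) ?_
    exact (distMatrix_triangle p hx hm hy).trans
      (add_le_add (h.distMatrix_le hx hm) (h.distMatrix_le hm hy))
  · rw [e u.2 v.2] at huv ⊢
    rcases min_cases (D u v) (D u m + D m v) with ⟨h1, -⟩ | ⟨h1, -⟩ <;> rw [h1] at huv ⊢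
    · exact h.graphDist_le huv
    · have n1 := h.nonneg u.2 hm
      have n2 := h.nonneg hm v.2
      rw [ENNReal.ofReal_add n1 n2]
      refine (graphDist_triangle p u ⟨m, hm⟩ v).trans (add_le_add ?_ ?_)
      · exact h.graphDist_le (v := ⟨m, hm⟩) (by dsimp only; linarith)
      · exact h.graphDist_le (u := ⟨m, hm⟩) (by dsimp only; linarith)

theorem floydInv_floyd {B : ℝ} (hB : ∀ x y, distMatrix p x y ≤ B) {m : ℕ} (hm : m ≤ n) :
    FloydInv p G B m (floyd n (edgeMatrix p G B) m) := by
  induction m with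
  | zero => exact floydInv_edgeMatrix hB
  | succ m ih => exact (ih (by omega)).step (by omega)

theorem isGraphDist_floyd {B : ℝ} (hB : ∀ x y, distMatrix p x y ≤ B) :
    IsGraphDist p G (floyd n (edgeMatrix p G B) n) B := by
  have h := floydInv_floyd (G := G) hB le_rfl
  exact ⟨h.nonneg, h.self, h.symm, fun hx hy hz => h.triangle hx hy hz hy, h.le_of_adj,
    h.distMatrix_le, fun hℓ hD => (h.graphDist_le (hD.trans_lt hℓ)).trans
      (ENNReal.ofReal_le_ofReal hD)⟩

end MetricGraph

/-! ### The greedy algorithm for a given dilation -/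

namespace MetricGraph

/-- The hop distances after inserting a link from `b` to `c`. -/
def hopInsert (n : ℕ) (H : ℕ → ℕ → ℕ) (b c : ℕ) (x y : ℕ) : ℕ :=
  if x < n ∧ y < n then min (H x y) (H x b + 1 + H c y) else H x y

/-- `H` behaves like a matrix of hop distances which are cut off at `m`. -/
structure IsHopDist (n m : ℕ) (H : ℕ → ℕ → ℕ) : Prop where
  self : ∀ {x}, x < n → H x x = 0
  le : ∀ {x y}, x < n → y < n → H x y ≤ m
  triangle : ∀ {x y z}, x < n → y < n → z < n → H x z ≤ H x y + H y z

theorem hopInsert_of_lt {n : ℕ} {H : ℕ → ℕ → ℕ} {b c x y : ℕ} (hx : x < n) (hy : y < n) :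
    hopInsert n H b c x y = min (H x y) (H x b + 1 + H c y) := if_pos ⟨hx, hy⟩

theorem hopInsert_le (n : ℕ) (H : ℕ → ℕ → ℕ) (b c x y : ℕ) : hopInsert n H b c x y ≤ H x y := by
  rw [hopInsert]
  split_ifs
  · exact min_le_left _ _
  · exact le_rfl

theorem IsHopDist.hopInsert {n m : ℕ} {H : ℕ → ℕ → ℕ} (h : IsHopDist n m H) {b c : ℕ}
    (hb : b < n) (hc : c < n) : IsHopDist n m (hopInsert n H b c) where
  self := fun hx => by rw [hopInsert_of_lt hx hx, h.self hx, Nat.zero_min]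
  le := fun hx hy => (hopInsert_le _ _ _ _ _ _).trans (h.le hx hy)
  triangle := fun {x y z} hx hy hz => by
    rw [hopInsert_of_lt hx hz, hopInsert_of_lt hx hy, hopInsert_of_lt hy hz]
    have := h.triangle hx hy hz
    have := h.triangle hx hy hb
    have := h.triangle hc hy hz
    omega

theorem hopInsert_self_le_one {n m : ℕ} {H : ℕ → ℕ → ℕ} (h : IsHopDist n m H) {b c : ℕ}
    (hb : b < n) (hc : c < n) : MetricGraph.hopInsert n H b c b c ≤ 1 := by
  rw [hopInsert_of_lt hb hc, h.self hb, h.self hc]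
  exact min_le_right _ _

/-- `M x y` is the smallest `D`-distance from `x` to a vertex from which `y` is reached by fewer
than `m` hops. -/
structure IsNearest (n m : ℕ) (D : ℕ → ℕ → ℝ) (H : ℕ → ℕ → ℕ) (M : ℕ → ℕ → ℝ) : Prop where
  le : ∀ {x a y}, x < n → a < n → y < n → H a y < m → M x y ≤ D x a
  attained : ∀ {x y}, x < n → y < n → ∃ a < n, H a y < m ∧ M x y = D x a

/-- `H'` arises from `H` by inserting links between the pairs in `box`, in both directions. -/
inductive LinkClosure (n : ℕ) (box : ℕ → ℕ → Prop) (H : ℕ → ℕ → ℕ) : (ℕ → ℕ → ℕ) → Prop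
  | refl : LinkClosure n box H H
  | insert {H' : ℕ → ℕ → ℕ} {b c : ℕ} : LinkClosure n box H H' → b < n → c < n →
      box b c ∨ box c b → LinkClosure n box H (hopInsert n H' b c)

theorem LinkClosure.isHopDist {n m : ℕ} {box : ℕ → ℕ → Prop} {H H' : ℕ → ℕ → ℕ}
    (h : LinkClosure n box H H') (hH : IsHopDist n m H) : IsHopDist n m H' := by
  induction h with
  | refl => exact hH
  | insert _ hb hc _ ih => exact ih.hopInsert hb hc

theorem LinkClosure.le {n : ℕ} {box : ℕ → ℕ → Prop} {H H' : ℕ → ℕ → ℕ}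
    (h : LinkClosure n box H H') (x y : ℕ) : H' x y ≤ H x y := by
  induction h with
  | refl => exact le_rfl
  | insert _ _ _ _ ih => exact (hopInsert_le _ _ _ _ _ _).trans ih

/-- The pairs `(eu i, ev i)` with `i < N` are all pairs of vertices, in the order of nondecreasing
distance. -/
structure IsSortedPairs (n N : ℕ) (d : ℕ → ℕ → ℝ) (eu ev : ℕ → ℕ) : Prop where
  fst_lt : ∀ {i}, i < N → eu i < n
  snd_lt : ∀ {i}, i < N → ev i < n
  exists_eq : ∀ {x y}, x < n → y < n → ∃ i < N, eu i = x ∧ ev i = y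
  mono : ∀ {i j}, i ≤ j → j < N → d (eu i) (ev i) ≤ d (eu j) (ev j)

/-- The graph whose edges are the nonzero entries of a matrix. -/
def edgesOf (n : ℕ) (S : ℕ → ℕ → ℕ) : SimpleGraph (Fin n) :=
  SimpleGraph.fromRel fun i j => S i j ≠ 0

theorem edgesOf_mono {n : ℕ} {S S' : ℕ → ℕ → ℕ} (h : ∀ x y, S x y ≠ 0 → S' x y ≠ 0) :
    edgesOf n S ≤ edgesOf n S' := by
  intro u v huv
  rw [edgesOf, SimpleGraph.fromRel_adj] at huv ⊢
  exact ⟨huv.1, huv.2.imp (h _ _) (h _ _)⟩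

/-- The matrix `S` after writing `1` into the cell `(u, v)`. -/
def mark (S : ℕ → ℕ → ℕ) (u v : ℕ) (x y : ℕ) : ℕ := if x = u ∧ y = v then 1 else S x y

theorem edgesOf_le_mark (n : ℕ) (S : ℕ → ℕ → ℕ) (u v : ℕ) :
    edgesOf n S ≤ edgesOf n (mark S u v) := by
  refine edgesOf_mono fun x y h => ?_
  rw [mark]
  split_ifs
  · exact one_ne_zero
  · exact h

theorem ncard_edgesOf_mark_le {n : ℕ} (S : ℕ → ℕ → ℕ) (u v : Fin n) :
    (edgesOf n (mark S u v)).edgeSet.ncard ≤ (edgesOf n S).edgeSet.ncard + 1 := by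
  refine le_trans (Set.ncard_le_ncard (t := insert s(u, v) (edgesOf n S).edgeSet) ?_
    (Set.toFinite _)) (Set.ncard_insert_le _ _)
  intro e he
  induction e with | _ x y =>
  rw [SimpleGraph.mem_edgeSet, edgesOf, SimpleGraph.fromRel_adj] at he
  rw [Set.mem_insert_iff, SimpleGraph.mem_edgeSet, edgesOf, SimpleGraph.fromRel_adj, Sym2.eq_iff]
  simp only [mark, ← Fin.ext_iff] at he
  by_cases h1 : x = u ∧ y = v
  · exact Or.inl (Or.inl h1)
  by_cases h2 : y = u ∧ x = v
  · exact Or.inl (Or.inr h2.symm)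
  rw [if_neg h1, if_neg h2] at he
  exact Or.inr he

theorem adj_edgesOf_mark {n : ℕ} (S : ℕ → ℕ → ℕ) {u v : Fin n} (h : u ≠ v) :
    (edgesOf n (mark S u v)).Adj u v := by
  rw [edgesOf, SimpleGraph.fromRel_adj]
  exact ⟨h, Or.inl (by simp [mark])⟩

/-- The radius, relative to the length of an inserted edge, within which the edge is linked to other
vertices when aiming at the dilation `t`. -/
noncomputable def linkRadius (r : ℕ) (t : ℝ) : ℝ := t - 1 + 1 / (2 * r)

variable {M : Type*} [MetricSpace M] {n : ℕ} {p : Fin n ↪ M} {G : SimpleGraph (Fin n)}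
  {D : ℕ → ℕ → ℝ} {B : ℝ}

/-- `x` and `y` can be linked because of the edge from `u` to `v`. -/
def IsLinked (p : Fin n ↪ M) (D : ℕ → ℕ → ℝ) (X : ℝ) (u v x y : ℕ) : Prop :=
  D u x + D v y ≤ X * distMatrix p u v

/-- `Q` bounds the graph distance by a detour: first in `G`, then along a pair of vertices whose
distance is stretched by the factor `g`. -/
structure IsDetour (p : Fin n ↪ M) (D : ℕ → ℕ → ℝ) (g : ℝ) (Q : ℕ → ℕ → ℝ) : Prop where
  le : ∀ {x a y}, x < n → a < n → y < n → Q x y ≤ D x a + g * distMatrix p a y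
  attained : ∀ {x y}, x < n → y < n → ∃ a < n, Q x y = D x a + g * distMatrix p a y

/-- The pair `(u, v)` needs no edge. -/
def IsRejected (p : Fin n ↪ M) (D : ℕ → ℕ → ℝ) (X g : ℝ) (Nr Q : ℕ → ℕ → ℝ) (u v : ℕ) : Prop :=
  ∃ c < n, Nr u c + D v c ≤ X * distMatrix p u v ∨ Q u c + D v c < g * distMatrix p u v

/-- The endpoints of the edges of a graph. -/
def endpoints (S : SimpleGraph (Fin n)) : Set (Fin n) := {a | ∃ b, S.Adj a b}

theorem card_endpoints_le (S : SimpleGraph (Fin n)) [Fintype (endpoints S)] :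
    Fintype.card (endpoints S) ≤ 2 * S.edgeSet.ncard := by
  classical
  have h := S.sum_degrees_eq_twice_card_edges
  rw [← SimpleGraph.coe_edgeFinset, Set.ncard_coe_finset, ← h, ← Set.toFinset_card,
    Finset.card_eq_sum_ones, ← Finset.sum_filter_add_sum_filter_not Finset.univ
      (fun v => v ∈ endpoints S) (fun v => S.degree v)]
  refine le_trans ?_ (Nat.le_add_right _ _)
  have hset : (endpoints S).toFinset = Finset.univ.filter fun v => v ∈ endpoints S := by
    ext v; simp
  rw [hset]
  refine Finset.sum_le_sum fun v hv => ?_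
  obtain ⟨b, hb⟩ := (Finset.mem_filter.mp hv).2
  exact (S.degree_pos_iff_exists_adj v).mpr ⟨b, hb⟩

/-- A walk in `G ⊔ S` either is at least as long as the distance in `G`, or it first uses edges of
`G`, then passes from one endpoint of `S` to another, and ends with edges of `G`. -/
theorem IsGraphDist.walk_cases (hD : IsGraphDist p G D B) (S : SimpleGraph (Fin n)) {u v : Fin n}
    (w : (G ⊔ S).Walk u v) : ENNReal.ofReal (D u v) ≤ walkLength p w ∨
      ∃ a ∈ endpoints S, ∃ b ∈ endpoints S,
        ENNReal.ofReal (D u a + distMatrix p a b + D b v) ≤ walkLength p w := by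
  induction w with
  | nil => left; rw [hD.self (Fin.is_lt _)]; simp
  | @cons u x v h q ih =>
    rw [walkLength_cons, edist_eq_ofReal_distMatrix]
    have hd := distMatrix_nonneg p u x
    have hadd : ∀ {c c' : ℝ}, 0 ≤ c → ENNReal.ofReal c ≤ walkLength p q →
        c' ≤ distMatrix p u x + c →
        ENNReal.ofReal c' ≤ ENNReal.ofReal (distMatrix p u x) + walkLength p q := by
      intro c c' hc h1 h2
      refine (ENNReal.ofReal_le_ofReal h2).trans ?_
      rw [ENNReal.ofReal_add hd hc]
      exact add_le_add le_rfl h1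
    have hxv := hD.nonneg x.2 v.2
    rcases h with h | h
    · have hux := hD.le_of_adj h
      rcases ih with ih | ⟨a, ha, b, hb, ih⟩
      · left
        have := hD.triangle u.2 x.2 v.2
        exact hadd hxv ih (by linarith)
      · right
        have := hD.triangle u.2 x.2 a.2
        have := hD.nonneg x.2 a.2
        have := hD.nonneg b.2 v.2
        have := distMatrix_nonneg p a b
        exact ⟨a, ha, b, hb, hadd (by linarith) ih (by linarith)⟩
    · right
      have huu := hD.self u.2
      have hu : u ∈ endpoints S := ⟨x, h⟩
      have hx : x ∈ endpoints S := ⟨u, h.symm⟩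
      rcases ih with ih | ⟨a, ha, b, hb, ih⟩
      · exact ⟨u, hu, x, hx, hadd hxv ih (by linarith)⟩
      · have := hD.distMatrix_le x.2 a.2
        have := hD.nonneg x.2 a.2
        have := hD.nonneg b.2 v.2
        have := distMatrix_nonneg p a b
        have := distMatrix_triangle p u.2 x.2 b.2
        have := distMatrix_triangle p x.2 a.2 b.2
        exact ⟨u, hu, b, hb, hadd (by linarith) ih (by linarith)⟩

/-- If `k` edges suffice for dilation `t`, then each pair which gets an edge is linked to a pair
of endpoints of these edges which is not yet connected by few hops. -/
theorem IsGraphDist.exists_endpoints (hD : IsGraphDist p G D B) {S : SimpleGraph (Fin n)}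
    {r : ℕ} (hr : 1 ≤ r) {t : ℝ} (ht : 1 ≤ t) (hS : dilation p (G ⊔ S) ≤ ENNReal.ofReal t)
    {H : ℕ → ℕ → ℕ} (hH : IsHopDist n (2 * r) H) {Nr Q : ℕ → ℕ → ℝ}
    (hNr : IsNearest n (2 * r) D H Nr) (hQ : IsDetour p D (2 * r * t) Q) {u v : Fin n}
    (hrej : ¬ IsRejected p D (linkRadius r t) (2 * r * t) Nr Q u v) :
    ∃ a ∈ endpoints S, ∃ b ∈ endpoints S,
      IsLinked p D (linkRadius r t) u v a b ∧ 2 * r ≤ H a b := by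
  have hR : (2 : ℝ) ≤ 2 * r := by
    have : (1 : ℝ) ≤ r := by exact_mod_cast hr
    linarith
  have hrej1 : ∀ c : Fin n, linkRadius r t * distMatrix p u v < Nr u c + D v c := fun c => by
    by_contra h
    exact hrej ⟨c, c.2, Or.inl (not_lt.mp h)⟩
  have hrej2 : ∀ c : Fin n, 2 * r * t * distMatrix p u v ≤ Q u c + D v c := fun c => by
    by_contra h
    exact hrej ⟨c, c.2, Or.inr (not_le.mp h)⟩
  have huv : u ≠ v := by
    rintro rfl
    have h1 := hrej1 u
    have h2 := hNr.le u.2 u.2 u.2 (by rw [hH.self u.2]; omega)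
    rw [distMatrix_self, hD.self u.2] at h1
    rw [hD.self u.2] at h2
    linarith
  have hd : 0 < distMatrix p u v := distMatrix_pos p u.2 v.2 fun h => huv (Fin.ext h)
  set d := distMatrix p u v with hdd
  have hlen : graphDist p (G ⊔ S) u v ≤ ENNReal.ofReal (t * d) := by
    refine (graphDist_le_dilation_mul p u v).trans ?_
    rw [edist_eq_ofReal_distMatrix, ENNReal.ofReal_mul (by linarith)]
    gcongr
  obtain ⟨w, -, hw⟩ := exists_isPath_walkLength_le p ENNReal.ofReal_ne_top hlen
  have htd : 0 ≤ t * d := by positivity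
  rcases hD.walk_cases S w with h | ⟨a, ha, b, hb, h⟩
  · have h1 := (ENNReal.ofReal_le_ofReal_iff htd).mp (h.trans hw)
    have h2 := hrej2 v
    have h3 := hQ.le u.2 v.2 v.2
    rw [hD.self v.2] at h2
    rw [distMatrix_self] at h3
    have htd' : 0 < t * d := by positivity
    nlinarith
  · have h1 := (ENNReal.ofReal_le_ofReal_iff htd).mp (h.trans hw)
    rw [hD.symm b.2 v.2] at h1
    have h2 := hrej2 b
    have h3 := hQ.le u.2 a.2 b.2
    have hlink : D u a + D v b ≤ linkRadius r t * d := by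
      set x := D u a + D v b with hx
      set y := distMatrix p a b
      set R : ℝ := 2 * r
      have e1 : x + y ≤ t * d := by linarith
      have e2 : R * t * d ≤ x + R * t * y := by linarith
      have hRt : 0 < R * t - 1 := by nlinarith
      have e3 : x * (R * t - 1) ≤ (t - 1) * d * (R * t) := by nlinarith
      have e4 : R * x * (R * t - 1) ≤ (R * (t - 1) + 1) * d * (R * t - 1) := by nlinarith
      have e5 : R * x ≤ (R * (t - 1) + 1) * d := le_of_mul_le_mul_right e4 hRt
      have e6 : linkRadius r t * d = (R * (t - 1) + 1) * d / R := by
        rw [linkRadius]; field_simp; simp only [R]; ring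
      rw [e6, le_div_iff₀ (by linarith)]
      linarith
    refine ⟨a, ha, b, hb, hlink, ?_⟩
    by_contra hlt
    have h4 := hNr.le u.2 a.2 b.2 (not_le.mp hlt)
    have h5 := hrej1 b
    linarith

/-- The invariant of the greedy algorithm for dilation `t`, after the pairs `(eu i, ev i)` with
`i < q` have been treated: `H` are the hop distances, `S` is the matrix of the inserted edges, and
`cnt` their number.  The last part compares with a set of at most `k` edges that achieves dilation
`t`; the inserted edges then correspond to the edges of a graph on the endpoints of this set which
has no short cycles. -/
structure GreedyInv (p : Fin n ↪ M) (G : SimpleGraph (Fin n)) (k r : ℕ) (t B : ℝ) (N : ℕ)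
    (eu ev : ℕ → ℕ) (q : ℕ) (H S : ℕ → ℕ → ℕ) (cnt : ℕ) : Prop where
  hop : IsHopDist n (2 * r) H
  ncard_le : (edgesOf n S).edgeSet.ncard ≤ cnt
  hop_sound : (∀ x y, 2 * r * t * distMatrix p x y < B) → ∀ i, q ≤ i → i < N → ∀ a b : Fin n,
    H a b < 2 * r → graphDist p (G ⊔ edgesOf n S) a b ≤
      ENNReal.ofReal (H a b * (linkRadius r t + 1) * distMatrix p (eu i) (ev i))
  done : (∀ x y, 2 * r * t * distMatrix p x y < B) → ∀ i < q, ∀ u v : Fin n, eu i = u → ev i = v →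
    graphDist p (G ⊔ edgesOf n S) u v ≤ ENNReal.ofReal (2 * r * t * distMatrix p u v)
  compare : ∀ S' : SimpleGraph (Fin n), S'.edgeSet.ncard ≤ k →
    dilation p (G ⊔ S') ≤ ENNReal.ofReal t →
    ∃ F : SimpleGraph (endpoints S'), F.LocallyAcyclic (2 * r) ∧ F.edgeSet.ncard = cnt ∧
      ∀ a b, F.Adj a b → H (a : Fin n) (b : Fin n) ≤ 1

theorem greedyInv_zero {k r : ℕ} (hr : 1 ≤ r) {t : ℝ} (N : ℕ) (eu ev : ℕ → ℕ)
    {H S : ℕ → ℕ → ℕ} (hH : ∀ x y, x < n → y < n → H x y = if x = y then 0 else 2 * r)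
    (hS : ∀ x y, x < n → y < n → S x y = 0) :
    GreedyInv p G k r t B N eu ev 0 H S 0 where
  hop := by
    refine ⟨fun hx => by simp [hH _ _ hx hx], fun {x y} hx hy => ?_, fun {x y z} hx hy hz => ?_⟩
    · rw [hH _ _ hx hy]; split_ifs <;> simp
    · rw [hH _ _ hx hy, hH _ _ hy hz, hH _ _ hx hz]
      by_cases h1 : x = y
      · subst h1; simp
      · rw [if_neg h1]
        split_ifs <;> omega
  ncard_le := by
    have : edgesOf n S = ⊥ := by
      rw [eq_bot_iff]
      intro u v huv
      rw [edgesOf, SimpleGraph.fromRel_adj, hS _ _ u.2 v.2, hS _ _ v.2 u.2] at huv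
      simp at huv
    simp [this]
  hop_sound := fun _ i _ _ a b hab => by
    rw [hH _ _ a.2 b.2] at hab ⊢
    by_cases h : (a : ℕ) = b
    · rw [Fin.ext h, graphDist_self]; simp
    · rw [if_neg h] at hab; omega
  done := fun _ i hi => by omega
  compare := fun S' _ _ => ⟨⊥, SimpleGraph.locallyAcyclic_bot _, by simp, by simp⟩

section Step

variable {k r : ℕ} {t : ℝ} {N q : ℕ} {eu ev : ℕ → ℕ} {H S : ℕ → ℕ → ℕ} {cnt : ℕ}

theorem linkRadius_nonneg (ht : 1 ≤ t) : 0 ≤ linkRadius r t := by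
  have : (0 : ℝ) ≤ 1 / (2 * r) := by positivity
  rw [linkRadius]; linarith

theorem linkRadius_le (hr : 1 ≤ r) (ht : 1 ≤ t) : linkRadius r t ≤ 2 * r * t := by
  have h1 : (1 : ℝ) ≤ r := by exact_mod_cast hr
  have h2 : (1 : ℝ) / (2 * r) ≤ 1 := by
    rw [div_le_one (by linarith)]; linarith
  rw [linkRadius]
  nlinarith

theorem two_mul_linkRadius (hr : 1 ≤ r) :
    (2 * r : ℝ) * (linkRadius r t + 1) = 2 * r * t + 1 := by
  have h1 : (1 : ℝ) ≤ r := by exact_mod_cast hr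
  rw [linkRadius]
  field_simp
  ring

/-- A rejected pair is sufficiently well connected. -/
theorem GreedyInv.reject (hI : GreedyInv p G k r t B N eu ev q H S cnt)
    (hD : IsGraphDist p G D B) (hr : 1 ≤ r) (ht : 1 ≤ t)
    (he : IsSortedPairs n N (distMatrix p) eu ev) (hq : q < N)
    {Nr Q : ℕ → ℕ → ℝ} (hNr : IsNearest n (2 * r) D H Nr) (hQ : IsDetour p D (2 * r * t) Q)
    (hrej : IsRejected p D (linkRadius r t) (2 * r * t) Nr Q (eu q) (ev q)) :
    GreedyInv p G k r t B N eu ev (q + 1) H S cnt where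
  hop := hI.hop
  ncard_le := hI.ncard_le
  hop_sound := fun hB i hi => hI.hop_sound hB i (by omega)
  compare := hI.compare
  done := fun hB i hi u v hu hv => by
    rcases Nat.lt_succ_iff_lt_or_eq.mp hi with hlt | rfl
    · exact hI.done hB i hlt u v hu hv
    · rw [hu, hv] at hrej
      have hR : (2 : ℝ) ≤ 2 * r := by
        have : (1 : ℝ) ≤ r := by exact_mod_cast hr
        linarith
      have hXg := linkRadius_le hr ht
      have hX0 := linkRadius_nonneg (r := r) ht
      set d := distMatrix p u v with hd
      have hd0 : 0 ≤ d := distMatrix_nonneg p u v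
      have hBd : 2 * r * t * d < B := hB u v
      have hGle : ∀ {a b : Fin n}, D a b ≤ 2 * r * t * d →
          graphDist p (G ⊔ edgesOf n S) a b ≤ ENNReal.ofReal (D a b) := fun h =>
        (graphDist_anti p le_sup_left _ _).trans (hD.graphDist_le (h.trans_lt hBd) le_rfl)
      obtain ⟨c, hc, h | h⟩ := hrej
      · obtain ⟨a, ha, hac, hMa⟩ := hNr.attained u.2 hc
        have hua := hD.nonneg u.2 ha
        have hvc := hD.nonneg v.2 hc
        have hXd : linkRadius r t * d ≤ 2 * r * t * d := mul_le_mul_of_nonneg_right hXg hd0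
        have hh := hI.hop_sound hB i le_rfl hq ⟨a, ha⟩ ⟨c, hc⟩ hac
        rw [hu, hv] at hh
        have g1 : graphDist p (G ⊔ edgesOf n S) u ⟨a, ha⟩ ≤ ENNReal.ofReal (D u a) :=
          hGle (b := ⟨a, ha⟩) (by dsimp only; linarith)
        have g2 : graphDist p (G ⊔ edgesOf n S) v ⟨c, hc⟩ ≤ ENNReal.ofReal (D v c) :=
          hGle (b := ⟨c, hc⟩) (by dsimp only; linarith)
        rw [graphDist_comm] at g2
        have hH0 : (0 : ℝ) ≤ H a c * (linkRadius r t + 1) * d := by positivity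
        calc graphDist p (G ⊔ edgesOf n S) u v
            ≤ graphDist p (G ⊔ edgesOf n S) u ⟨a, ha⟩ +
              (graphDist p (G ⊔ edgesOf n S) ⟨a, ha⟩ ⟨c, hc⟩ +
                graphDist p (G ⊔ edgesOf n S) ⟨c, hc⟩ v) :=
              (graphDist_triangle p u ⟨a, ha⟩ v).trans
                (add_le_add le_rfl (graphDist_triangle p _ _ _))
          _ ≤ ENNReal.ofReal (D u a) + (ENNReal.ofReal (H a c * (linkRadius r t + 1) * d) +
                ENNReal.ofReal (D v c)) := by gcongr
          _ = ENNReal.ofReal (D u a + (H a c * (linkRadius r t + 1) * d + D v c)) := by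
              rw [ENNReal.ofReal_add hua (by linarith), ENNReal.ofReal_add hH0 hvc]
          _ ≤ ENNReal.ofReal (2 * r * t * d) := by
              refine ENNReal.ofReal_le_ofReal ?_
              have hac' : (H a c : ℝ) ≤ 2 * r - 1 := by
                have : H a c + 1 ≤ 2 * r := hac
                have : (H a c : ℝ) + 1 ≤ 2 * r := by exact_mod_cast this
                linarith
              have h2 : (H a c : ℝ) * ((linkRadius r t + 1) * d) ≤
                  (2 * r - 1) * ((linkRadius r t + 1) * d) :=
                mul_le_mul_of_nonneg_right hac' (by positivity)
              have h3 := two_mul_linkRadius (t := t) hr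
              have h4 : (2 * r - 1) * ((linkRadius r t + 1) * d) =
                  (2 * r * t + 1) * d - (linkRadius r t + 1) * d := by
                rw [← h3]; ring
              linarith
      · obtain ⟨a, ha, hQa⟩ := hQ.attained u.2 hc
        have hua := hD.nonneg u.2 ha
        have hvc := hD.nonneg v.2 hc
        have hac0 := distMatrix_nonneg p a c
        have hg : 0 < 2 * r * t := by positivity
        have hlt : distMatrix p a c < d := by
          by_contra hge
          have := mul_le_mul_of_nonneg_left (not_lt.mp hge) hg.le
          linarith
        -- the pair `(a, c)` is shorter, so it has been treated before
        obtain ⟨j, hjN, hja, hjc⟩ := he.exists_eq ha hc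
        have hji : j < i := by
          by_contra hge
          have := he.mono (not_lt.mp hge) hjN
          rw [hja, hjc, hu, hv] at this
          linarith
        have hh := hI.done hB j hji ⟨a, ha⟩ ⟨c, hc⟩ hja hjc
        have hgac : 0 ≤ 2 * r * t * distMatrix p a c := by positivity
        have g1 : graphDist p (G ⊔ edgesOf n S) u ⟨a, ha⟩ ≤ ENNReal.ofReal (D u a) :=
          hGle (b := ⟨a, ha⟩) (by dsimp only; linarith)
        have g2 : graphDist p (G ⊔ edgesOf n S) v ⟨c, hc⟩ ≤ ENNReal.ofReal (D v c) :=
          hGle (b := ⟨c, hc⟩) (by dsimp only; linarith)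
        rw [graphDist_comm] at g2
        calc graphDist p (G ⊔ edgesOf n S) u v
            ≤ graphDist p (G ⊔ edgesOf n S) u ⟨a, ha⟩ +
              (graphDist p (G ⊔ edgesOf n S) ⟨a, ha⟩ ⟨c, hc⟩ +
                graphDist p (G ⊔ edgesOf n S) ⟨c, hc⟩ v) :=
              (graphDist_triangle p u ⟨a, ha⟩ v).trans
                (add_le_add le_rfl (graphDist_triangle p _ _ _))
          _ ≤ ENNReal.ofReal (D u a) + (ENNReal.ofReal (2 * r * t * distMatrix p a c) +
                ENNReal.ofReal (D v c)) := by gcongr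
          _ = ENNReal.ofReal (D u a + (2 * r * t * distMatrix p a c + D v c)) := by
              rw [ENNReal.ofReal_add hua (by linarith), ENNReal.ofReal_add hgac hvc]
          _ ≤ ENNReal.ofReal (2 * r * t * d) := by
              refine ENNReal.ofReal_le_ofReal ?_
              linarith

/-- Hop distances stay realised by paths when the links of a new edge are inserted. -/
theorem LinkClosure.graphDist_le (hD : IsGraphDist p G D B) (hr : 1 ≤ r) (ht : 1 ≤ t)
    {G' : SimpleGraph (Fin n)} (hG : G ≤ G') {u v : Fin n} (huv : G'.Adj u v)
    (hB : 2 * r * t * distMatrix p u v < B) {ℓ : ℝ} (hℓ : distMatrix p u v ≤ ℓ)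
    {H' : ℕ → ℕ → ℕ} (h : LinkClosure n (IsLinked p D (linkRadius r t) u v) H H')
    (hH : ∀ a b : Fin n, H a b < 2 * r → graphDist p G' a b ≤
      ENNReal.ofReal (H a b * (linkRadius r t + 1) * ℓ)) (a b : Fin n) (hab : H' a b < 2 * r) :
    graphDist p G' a b ≤ ENNReal.ofReal (H' a b * (linkRadius r t + 1) * ℓ) := by
  have hX0 := linkRadius_nonneg (r := r) ht
  have hd0 := distMatrix_nonneg p u v
  have hℓ0 := hd0.trans hℓ
  have hlink : ∀ x y : Fin n, IsLinked p D (linkRadius r t) u v x y →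
      graphDist p G' x y ≤ ENNReal.ofReal ((linkRadius r t + 1) * ℓ) := by
    intro x y hxy
    rw [IsLinked] at hxy
    have hux := hD.nonneg u.2 x.2
    have hvy := hD.nonneg v.2 y.2
    have hXd : linkRadius r t * distMatrix p u v ≤ 2 * r * t * distMatrix p u v :=
      mul_le_mul_of_nonneg_right (linkRadius_le hr ht) hd0
    have g1 := (graphDist_anti p hG u x).trans
      (hD.graphDist_le (ℓ := D u x) (by linarith) le_rfl)
    have g2 := (graphDist_anti p hG v y).trans
      (hD.graphDist_le (ℓ := D v y) (by linarith) le_rfl)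
    rw [graphDist_comm] at g1
    have g3 := graphDist_le_edist p huv
    rw [edist_eq_ofReal_distMatrix] at g3
    calc graphDist p G' x y ≤ graphDist p G' x u + (graphDist p G' u v + graphDist p G' v y) :=
          (graphDist_triangle p x u y).trans (add_le_add le_rfl (graphDist_triangle p _ _ _))
      _ ≤ ENNReal.ofReal (D u x) + (ENNReal.ofReal (distMatrix p u v) + ENNReal.ofReal (D v y)) := by
          gcongr
      _ = ENNReal.ofReal (D u x + (distMatrix p u v + D v y)) := by
          rw [ENNReal.ofReal_add hux (by linarith), ENNReal.ofReal_add hd0 hvy]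
      _ ≤ _ := by
          refine ENNReal.ofReal_le_ofReal ?_
          have := mul_le_mul_of_nonneg_left hℓ hX0
          linarith
  induction h generalizing a b with
  | refl => exact hH a b hab
  | @insert H1 x y hcl hx hy hbox ih =>
    rw [hopInsert_of_lt a.2 b.2] at hab ⊢
    rcases min_cases (H1 a b) (H1 a x + 1 + H1 y b) with ⟨h1, -⟩ | ⟨h1, -⟩ <;> rw [h1] at hab ⊢
    · exact ih a b hab
    · have g1 := ih a ⟨x, hx⟩ (by dsimp only; omega)
      have g2 := ih ⟨y, hy⟩ b (by dsimp only; omega)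
      have g3 : graphDist p G' ⟨x, hx⟩ ⟨y, hy⟩ ≤ ENNReal.ofReal ((linkRadius r t + 1) * ℓ) := by
        rcases hbox with hbox | hbox
        · exact hlink ⟨x, hx⟩ ⟨y, hy⟩ hbox
        · rw [graphDist_comm]
          exact hlink ⟨y, hy⟩ ⟨x, hx⟩ hbox
      calc graphDist p G' a b ≤ graphDist p G' a ⟨x, hx⟩ +
            (graphDist p G' ⟨x, hx⟩ ⟨y, hy⟩ + graphDist p G' ⟨y, hy⟩ b) :=
            (graphDist_triangle p _ _ _).trans (add_le_add le_rfl (graphDist_triangle p _ _ _))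
        _ ≤ _ + (_ + _) := add_le_add g1 (add_le_add g3 g2)
        _ = _ := by
            dsimp only
            rw [← ENNReal.ofReal_add (by positivity) (by positivity),
              ← ENNReal.ofReal_add (by positivity) (by positivity)]
            congr 1
            push_cast
            ring

/-- Inserting an edge for a pair which is not rejected. -/
theorem GreedyInv.accept (hI : GreedyInv p G k r t B N eu ev q H S cnt)
    (hD : IsGraphDist p G D B) (hr : 1 ≤ r) (ht : 1 ≤ t)
    (he : IsSortedPairs n N (distMatrix p) eu ev) (hq : q < N)
    {Nr Q : ℕ → ℕ → ℝ} (hNr : IsNearest n (2 * r) D H Nr) (hQ : IsDetour p D (2 * r * t) Q)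
    (hrej : ¬ IsRejected p D (linkRadius r t) (2 * r * t) Nr Q (eu q) (ev q))
    {H' : ℕ → ℕ → ℕ}
    (hcl : LinkClosure n (IsLinked p D (linkRadius r t) (eu q) (ev q)) H H')
    (hbox : ∀ x y, x < n → y < n → IsLinked p D (linkRadius r t) (eu q) (ev q) x y →
      H' x y ≤ 1 ∧ H' y x ≤ 1) :
    GreedyInv p G k r t B N eu ev (q + 1) H' (mark S (eu q) (ev q)) (cnt + 1) := by
  have huN := he.fst_lt hq
  have hvN := he.snd_lt hq
  obtain ⟨u, hu⟩ : ∃ u : Fin n, eu q = u := ⟨⟨eu q, huN⟩, rfl⟩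
  obtain ⟨v, hv⟩ : ∃ v : Fin n, ev q = v := ⟨⟨ev q, hvN⟩, rfl⟩
  rw [hu, hv] at hrej hcl hbox ⊢
  have huv : u ≠ v := by
    rintro rfl
    refine hrej ⟨u, u.2, Or.inl ?_⟩
    rw [distMatrix_self, mul_zero, hD.self u.2, add_zero, ← hD.self u.2]
    exact hNr.le u.2 u.2 u.2 (by rw [hI.hop.self u.2]; omega)
  have hle : G ⊔ edgesOf n S ≤ G ⊔ edgesOf n (mark S u v) :=
    sup_le_sup_left (edgesOf_le_mark n S u v) G
  have hadj : (G ⊔ edgesOf n (mark S u v)).Adj u v := Or.inr (adj_edgesOf_mark S huv)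
  refine ⟨hcl.isHopDist hI.hop, ?_, ?_, ?_, ?_⟩
  · exact (ncard_edgesOf_mark_le S u v).trans (Nat.succ_le_succ hI.ncard_le)
  · intro hB i hi hiN a b hab
    have hmono := he.mono (show q ≤ i by omega) hiN
    rw [hu, hv] at hmono
    refine hcl.graphDist_le hD hr ht le_sup_left hadj (hB u v) hmono ?_ a b hab
    intro a b hab
    exact (graphDist_anti p hle a b).trans (hI.hop_sound hB i (by omega) hiN a b hab)
  · intro hB i hi x y hx hy
    rcases Nat.lt_succ_iff_lt_or_eq.mp hi with hlt | rfl
    · exact (graphDist_anti p hle x y).trans (hI.done hB i hlt x y hx hy)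
    · obtain rfl : x = u := Fin.ext (hx.symm.trans hu)
      obtain rfl : y = v := Fin.ext (hy.symm.trans hv)
      refine (graphDist_le_edist p hadj).trans ?_
      rw [edist_eq_ofReal_distMatrix]
      refine ENNReal.ofReal_le_ofReal ?_
      have h0 := distMatrix_nonneg p x y
      have h1 : (1 : ℝ) ≤ 2 * r * t := by
        have : (1 : ℝ) ≤ r := by exact_mod_cast hr
        nlinarith
      nlinarith
  · intro S' hS' hdil
    obtain ⟨F, hF, hcard, hadj1⟩ := hI.compare S' hS' hdil
    obtain ⟨a, ha, b, hb, hlink, hab⟩ := hD.exists_endpoints hr ht hdil hI.hop hNr hQ hrej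
    set a' : endpoints S' := ⟨a, ha⟩
    set b' : endpoints S' := ⟨b, hb⟩
    have hwalk : ∀ {x y : endpoints S'} (w : F.Walk x y), H (x : Fin n) (y : Fin n) ≤ w.length := by
      intro x y w
      induction w with
      | nil => rw [hI.hop.self (Fin.is_lt _)]; exact Nat.zero_le _
      | @cons x z y h w ih =>
        have h1 := hI.hop.triangle x.1.2 z.1.2 y.1.2
        have h2 := hadj1 _ _ h
        rw [SimpleGraph.Walk.length_cons]
        omega
    have hne : a' ≠ b' := by
      intro h
      have : a = b := congrArg Subtype.val h
      rw [this, hI.hop.self b.2] at hab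
      omega
    have hnadj : ¬ F.Adj a' b' := by
      intro h
      have : H a b ≤ 1 := hadj1 _ _ h
      omega
    refine ⟨F ⊔ SimpleGraph.edge a' b', hF.sup_edge fun w => hab.trans (hwalk w), ?_, ?_⟩
    · rw [SimpleGraph.edgeSet_sup, SimpleGraph.edgeSet_edge_of_ne hne, Set.union_singleton,
        Set.ncard_insert_of_notMem (by simpa using hnadj) (Set.toFinite _), hcard]
    · intro x y hxy
      rw [SimpleGraph.sup_adj, SimpleGraph.edge_adj] at hxy
      rcases hxy with h | ⟨⟨rfl, rfl⟩ | ⟨rfl, rfl⟩, -⟩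
      · exact (hcl.le _ _).trans (hadj1 _ _ h)
      · exact (hbox a b a.2 b.2 hlink).1
      · exact (hbox a b a.2 b.2 hlink).2

theorem GreedyInv.dilation_le (hI : GreedyInv p G k r t B N eu ev N H S cnt)
    (hr : 1 ≤ r) (ht : 1 ≤ t) (he : IsSortedPairs n N (distMatrix p) eu ev)
    (hB : ∀ x y, 2 * r * t * distMatrix p x y < B) :
    dilation p (G ⊔ edgesOf n S) ≤ ENNReal.ofReal (2 * r * t) := by
  refine MetricGraph.dilation_le p fun u v => ?_
  obtain ⟨i, hi, hu, hv⟩ := he.exists_eq u.2 v.2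
  refine (hI.done hB i hi u v hu hv).trans ?_
  rw [edist_eq_ofReal_distMatrix, ENNReal.ofReal_mul (by positivity)]

/-- By the Moore bound on the at most `2 * k` endpoints of an optimal set of edges, few edges are
inserted. -/
theorem GreedyInv.pow_le (hI : GreedyInv p G k r t B N eu ev N H S cnt) (hr : 1 ≤ r)
    (hopt : optDilation p G k ≤ ENNReal.ofReal t) : cnt ^ r ≤ (2 * k) ^ (r + 1) := by
  classical
  obtain ⟨S', hS', hdil⟩ := exists_dilation_le_of_optDilation_le p hopt
  obtain ⟨F, hF, hcard, -⟩ := hI.compare S' hS' hdil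
  have h := hF.ncard_edgeSet_pow_le hr
  rw [hcard] at h
  refine h.trans (Nat.pow_le_pow_left ?_ _)
  have := card_endpoints_le S'
  omega

end Step

end MetricGraph

/-! ### A polynomial approximation of the optimal dilation -/

namespace MetricGraph

variable {M : Type*} [MetricSpace M] {n : ℕ} {p : Fin n ↪ M} {G : SimpleGraph (Fin n)}
  {D : ℕ → ℕ → ℝ} {B : ℝ}

theorem reachable_of_forall_adj {V : Type*} {H H' : SimpleGraph V} (h : ∀ a b, H.Adj a b →
    H'.Reachable a b) {u v : V} (huv : H.Reachable u v) : H'.Reachable u v := by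
  obtain ⟨w⟩ := huv
  induction w with
  | nil => exact SimpleGraph.Reachable.refl _
  | cons ha _ ih => exact (h _ _ ha).trans ih

/-- The graph with the edges `z j` for `j < m`. -/
def firstEdges (z : ℕ → Fin n × Fin n) (m : ℕ) : SimpleGraph (Fin n) :=
  SimpleGraph.fromRel fun a b => ∃ j < m, z j = (a, b)

theorem firstEdges_mono (z : ℕ → Fin n × Fin n) {m m' : ℕ} (h : m ≤ m') :
    firstEdges z m ≤ firstEdges z m' := by
  intro a b hab
  rw [firstEdges, SimpleGraph.fromRel_adj] at hab ⊢
  exact ⟨hab.1, hab.2.imp (fun ⟨j, hj, e⟩ => ⟨j, by omega, e⟩) fun ⟨j, hj, e⟩ => ⟨j, by omega, e⟩⟩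

theorem firstEdges_congr {z z' : ℕ → Fin n × Fin n} {m : ℕ} (h : ∀ j < m, z j = z' j) :
    firstEdges z m = firstEdges z' m := by
  ext a b
  rw [firstEdges, firstEdges, SimpleGraph.fromRel_adj, SimpleGraph.fromRel_adj]
  have : ∀ a b, (∃ j < m, z j = (a, b)) ↔ ∃ j < m, z' j = (a, b) := fun a b =>
    exists_congr fun j => and_congr_right fun hj => by rw [h j hj]
  rw [this, this]

theorem reachable_firstEdges (z : ℕ → Fin n × Fin n) {j m : ℕ} (h : j < m) :
    (firstEdges z m).Reachable (z j).1 (z j).2 := by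
  by_cases hne : (z j).1 = (z j).2
  · rw [hne]
  · refine SimpleGraph.Adj.reachable ?_
    rw [firstEdges, SimpleGraph.fromRel_adj]
    exact ⟨hne, Or.inl ⟨j, h, rfl⟩⟩

/-- The matrix of distances in which the edges chosen so far are free, with an additional free edge
between `u` and `v`. -/
noncomputable def contracted (n : ℕ) (W : ℕ → ℕ → ℝ) (u v : ℕ) : ℕ → ℕ → ℝ :=
  RealRAM.relaxed n (RealRAM.relaxed n W u v) v u

open Classical in
/-- The vertices which have distance zero to no vertex with smaller number. -/
noncomputable def leaders (n : ℕ) (W : ℕ → ℕ → ℝ) : Finset ℕ :=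
  (Finset.range n).filter fun x => ∀ y < x, W x y ≠ 0

/-- A finite pseudometric on the vertices. -/
structure IsPseudo (n : ℕ) (W : ℕ → ℕ → ℝ) : Prop where
  nonneg : ∀ {x y}, x < n → y < n → 0 ≤ W x y
  self : ∀ {x}, x < n → W x x = 0
  symm : ∀ {x y}, x < n → y < n → W x y = W y x
  triangle : ∀ {x y z}, x < n → y < n → z < n → W x z ≤ W x y + W y z

theorem IsPseudo.contracted_eq {W : ℕ → ℕ → ℝ} (h : IsPseudo n W) {u v x y : ℕ} (hu : u < n)
    (hv : v < n) (hx : x < n) (hy : y < n) : contracted n W u v x y =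
      min (W x y) (min (W x u + W v y) (W x v + W u y)) := by
  have e : ∀ {W x y}, x < n → y < n → ∀ {a b}, RealRAM.relaxed n W a b x y =
      min (W x y) (W x a + W b y) := fun hx hy => by simp [RealRAM.relaxed, hx, hy]
  rw [contracted, e hx hy, e hx hy, e hx hv, e hu hy, h.self hu, h.self hv, zero_add, add_zero]
  have t1 := h.triangle hx hv hy
  have t2 := h.triangle hx hu hy
  have s1 := h.nonneg hx hu
  have s2 := h.nonneg hv hy
  apply le_antisymm
  · refine le_min ((min_le_left _ _).trans (min_le_left _ _))
      (le_min ((min_le_left _ _).trans (min_le_right _ _)) ((min_le_right _ _).trans ?_))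
    exact add_le_add (min_le_left _ _) (min_le_left _ _)
  · refine le_min (le_min (min_le_left _ _) ((min_le_right _ _).trans (min_le_left _ _))) ?_
    rcases min_cases (W x v) (W x u) with ⟨h1, -⟩ | ⟨h1, -⟩ <;>
    rcases min_cases (W u y) (W v y) with ⟨h2, -⟩ | ⟨h2, -⟩ <;> rw [h1, h2]
    · exact (min_le_right _ _).trans (min_le_right _ _)
    · exact (min_le_left _ _).trans t1
    · exact (min_le_left _ _).trans t2
    · exact (min_le_right _ _).trans (min_le_left _ _)

theorem IsPseudo.contracted {W : ℕ → ℕ → ℝ} (h : IsPseudo n W) {u v : ℕ} (hu : u < n)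
    (hv : v < n) : IsPseudo n (contracted n W u v) where
  nonneg := fun hx hy => by
    rw [h.contracted_eq hu hv hx hy]
    exact le_min (h.nonneg hx hy) (le_min (add_nonneg (h.nonneg hx hu) (h.nonneg hv hy))
      (add_nonneg (h.nonneg hx hv) (h.nonneg hu hy)))
  self := fun hx => by
    rw [h.contracted_eq hu hv hx hx, h.self hx]
    exact min_eq_left (le_min (add_nonneg (h.nonneg hx hu) (h.nonneg hv hx))
      (add_nonneg (h.nonneg hx hv) (h.nonneg hu hx)))
  symm := fun {x y} hx hy => by
    rw [h.contracted_eq hu hv hx hy, h.contracted_eq hu hv hy hx, h.symm hx hy, h.symm hx hu,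
      h.symm hv hy, h.symm hx hv, h.symm hu hy, min_comm (W u x + W y v), add_comm (W v x),
      add_comm (W u x)]
  triangle := fun {x y z} hx hy hz => by
    rw [h.contracted_eq hu hv hx hz, h.contracted_eq hu hv hx hy, h.contracted_eq hu hv hy hz]
    have := h.triangle hx hy hz
    have := h.triangle hx hy hu
    have := h.triangle hx hy hv
    have := h.triangle hu hy hz
    have := h.triangle hv hy hz
    have := h.nonneg hu hy
    have := h.nonneg hv hy
    have := h.nonneg hy hu
    have := h.nonneg hy hv
    have l1 := min_le_left (W x z) (min (W x u + W v z) (W x v + W u z))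
    have l2 := (min_le_right (W x z) (min (W x u + W v z) (W x v + W u z))).trans (min_le_left _ _)
    have l3 := (min_le_right (W x z) (min (W x u + W v z) (W x v + W u z))).trans (min_le_right _ _)
    rcases min_choice (W x y) (min (W x u + W v y) (W x v + W u y)) with h1 | h1 <;>
    rcases min_choice (W y z) (min (W y u + W v z) (W y v + W u z)) with h2 | h2 <;>
    rw [h1, h2]
    · linarith
    · rcases min_choice (W y u + W v z) (W y v + W u z) with h4 | h4 <;> rw [h4] <;> linarith
    · rcases min_choice (W x u + W v y) (W x v + W u y) with h3 | h3 <;> rw [h3] <;> linarith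
    · have := h.triangle hx hu hz
      have := h.triangle hx hv hz
      rcases min_choice (W x u + W v y) (W x v + W u y) with h3 | h3 <;>
      rcases min_choice (W y u + W v z) (W y v + W u z) with h4 | h4 <;> rw [h3, h4] <;> linarith

theorem IsPseudo.contracted_le {W : ℕ → ℕ → ℝ} (h : IsPseudo n W) {u v x y : ℕ} (hu : u < n)
    (hv : v < n) (hx : x < n) (hy : y < n) : MetricGraph.contracted n W u v x y ≤ W x y := by
  rw [h.contracted_eq hu hv hx hy]; exact min_le_left _ _

theorem IsPseudo.contracted_self {W : ℕ → ℕ → ℝ} (h : IsPseudo n W) {u v : ℕ} (hu : u < n)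
    (hv : v < n) : MetricGraph.contracted n W u v u v = 0 := by
  refine le_antisymm ?_ ((h.contracted hu hv).nonneg hu hv)
  rw [h.contracted_eq hu hv hu hv, h.self hu, h.self hv, add_zero]
  exact (min_le_right _ _).trans (min_le_left _ _)

/-- Joining two different classes of vertices at distance zero decreases the number of classes. -/
theorem IsPseudo.card_leaders_contracted {W : ℕ → ℕ → ℝ} (h : IsPseudo n W) {u v : ℕ} (hu : u < n)
    (hv : v < n) (huv : 0 < W u v) :
    (leaders n (MetricGraph.contracted n W u v)).card < (leaders n W).card := by
  classical
  have hzero : ∀ {x y}, x < n → y < n → W x y = 0 → MetricGraph.contracted n W u v x y = 0 :=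
    fun hx hy h0 => le_antisymm ((h.contracted_le hu hv hx hy).trans h0.le)
      ((h.contracted hu hv).nonneg hx hy)
  have hlead : ∀ a < n, ∃ x < n, W a x = 0 ∧ x ∈ leaders n W := by
    intro a ha
    have hex : ∃ x, x < n ∧ W a x = 0 := ⟨a, ha, h.self ha⟩
    obtain ⟨h1, h2⟩ := Nat.find_spec hex
    refine ⟨Nat.find hex, h1, h2, ?_⟩
    rw [leaders, Finset.mem_filter, Finset.mem_range]
    refine ⟨h1, fun y hy h0 => Nat.find_min hex hy ⟨hy.trans h1, ?_⟩⟩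
    refine le_antisymm ?_ (h.nonneg ha (hy.trans h1))
    have := h.triangle ha h1 (hy.trans h1)
    linarith
  obtain ⟨x, hx, hux, hxl⟩ := hlead u hu
  obtain ⟨y, hy, hvy, hyl⟩ := hlead v hv
  have hxy : x ≠ y := by
    rintro rfl
    have h1 := h.triangle hu hx hv
    have h2 := h.symm hv hx
    linarith
  have h0 : MetricGraph.contracted n W u v x y = 0 := by
    refine le_antisymm ?_ ((h.contracted hu hv).nonneg hx hy)
    rw [h.contracted_eq hu hv hx hy]
    refine (min_le_right _ _).trans ((min_le_left _ _).trans ?_)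
    rw [h.symm hx hu, hux, hvy, add_zero]
  have hsub : leaders n (MetricGraph.contracted n W u v) ⊆ leaders n W := by
    intro a ha
    rw [leaders, Finset.mem_filter, Finset.mem_range] at ha ⊢
    exact ⟨ha.1, fun b hb hb0 => ha.2 b hb (hzero ha.1 (hb.trans ha.1) hb0)⟩
  -- the larger one of the two class leaders is no longer a leader
  refine Finset.card_lt_card (Finset.ssubset_iff_subset_ne.mpr ⟨hsub, fun heq => ?_⟩)
  rcases lt_or_gt_of_ne hxy with hlt | hlt
  · rw [← heq, leaders, Finset.mem_filter] at hyl
    exact hyl.2 x hlt (by rw [(h.contracted hu hv).symm hy hx]; exact h0)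
  · rw [← heq, leaders, Finset.mem_filter] at hxl
    exact hxl.2 y hlt h0

/-- The invariant of the coarse phase after the pairs `(eu i, ev i)` with `i < q` have been treated:
`z 0, …, z (m - 1)` are the pairs chosen so far (the edges of a minimum spanning tree of all
points, in the order of nondecreasing length), `W` is the distance in the graph in which they are
free, and `T j` is the ratio of the distance of `z j` in this graph at the time when `z j` was
chosen to the length of `z j`. -/
structure CoarseInv (p : Fin n ↪ M) (G : SimpleGraph (Fin n)) (B : ℝ) (eu ev : ℕ → ℕ)
    (q : ℕ) (W : ℕ → ℕ → ℝ) (m : ℕ) (T : ℕ → ℝ) (z : ℕ → Fin n × Fin n) : Prop where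
  pseudo : IsPseudo n W
  le_of_adj : ∀ {u v : Fin n}, G.Adj u v → W u v ≤ distMatrix p u v
  free : ∀ j < m, W (z j).1 (z j).2 = 0
  reachable : ∀ {x y : Fin n} {ℓ : ℝ}, ℓ < B → W x y ≤ ℓ →
    (short p G ℓ ⊔ firstEdges z m).Reachable x y
  done : ∀ i < q, ∀ u v : Fin n, eu i = u → ev i = v → ∃ m' ≤ m,
    (∀ j < m', distMatrix p (z j).1 (z j).2 ≤ distMatrix p u v) ∧ (firstEdges z m').Reachable u v
  treated : ∀ j < m, ∃ i < q, eu i = (z j).1 ∧ ev i = (z j).2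
  mono : ∀ i j, i ≤ j → j < m →
    distMatrix p (z i).1 (z i).2 ≤ distMatrix p (z j).1 (z j).2
  pos : ∀ j < m, 0 < distMatrix p (z j).1 (z j).2
  lower : ∀ j < m, ∀ ℓ, 0 ≤ ℓ → (short p G ℓ ⊔ firstEdges z j).Reachable (z j).1 (z j).2 →
    T j * distMatrix p (z j).1 (z j).2 ≤ n * ℓ
  upper : ∀ j < m, ∀ ℓ < B, T j * distMatrix p (z j).1 (z j).2 ≤ ℓ →
    (short p G ℓ ⊔ firstEdges z j).Reachable (z j).1 (z j).2
  count : m + (leaders n W).card ≤ n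

theorem coarseInv_zero (hD : IsGraphDist p G D B) (eu ev : ℕ → ℕ) (T : ℕ → ℝ)
    (z : ℕ → Fin n × Fin n) : CoarseInv p G B eu ev 0 D 0 T z where
  pseudo := ⟨hD.nonneg, hD.self, hD.symm, hD.triangle⟩
  le_of_adj := hD.le_of_adj
  free := fun j hj => by omega
  reachable := fun {x y ℓ} hℓ hW => by
    have h0 : 0 ≤ ℓ := (hD.nonneg x.2 y.2).trans hW
    exact (reachable_short_of_graphDist_le p h0 (hD.graphDist_le hℓ hW)).mono le_sup_left
  done := fun i hi => by omega
  treated := fun j hj => by omega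
  mono := fun i j _ hj => by omega
  pos := fun j hj => by omega
  lower := fun j hj => by omega
  upper := fun j hj => by omega
  count := by
    rw [zero_add]
    exact (Finset.card_filter_le _ _).trans (by simp)

section

variable {eu ev : ℕ → ℕ} {q m N : ℕ} {W : ℕ → ℕ → ℝ} {T : ℕ → ℝ} {z : ℕ → Fin n × Fin n}

theorem CoarseInv.reachable_firstEdges_of_eq_zero (h : CoarseInv p G B eu ev q W m T z) (hB : 0 < B)
    {x y : Fin n} (hW : W x y = 0) : (firstEdges z m).Reachable x y := by
  refine reachable_of_forall_adj (fun a b hab => ?_) (h.reachable hB hW.le)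
  rcases hab with hab | hab
  · have h1 := hab.2
    have h2 := distMatrix_pos p a.2 b.2 fun e => hab.1.ne (Fin.ext e)
    rw [distMatrix_coe] at h2
    linarith
  · exact hab.reachable

theorem CoarseInv.skip (h : CoarseInv p G B eu ev q W m T z) (hB : 0 < B)
    (he : IsSortedPairs n N (distMatrix p) eu ev) (hq : q < N) (hW : ¬ 0 < W (eu q) (ev q)) :
    CoarseInv p G B eu ev (q + 1) W m T z where
  pseudo := h.pseudo
  le_of_adj := h.le_of_adj
  free := h.free
  reachable := h.reachable
  treated := fun j hj => (h.treated j hj).imp fun i hi => ⟨by omega, hi.2⟩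
  mono := h.mono
  pos := h.pos
  lower := h.lower
  upper := h.upper
  count := h.count
  done := fun i hi u v hu hv => by
    rcases Nat.lt_succ_iff_lt_or_eq.mp hi with hlt | rfl
    · exact h.done i hlt u v hu hv
    · rw [hu, hv] at hW
      have h0 : W u v = 0 := le_antisymm (not_lt.mp hW) (h.pseudo.nonneg u.2 v.2)
      refine ⟨m, le_rfl, fun j hj => ?_, h.reachable_firstEdges_of_eq_zero hB h0⟩
      obtain ⟨i', hi', e1, e2⟩ := h.treated j hj
      rw [← e1, ← e2, ← hu, ← hv]
      exact he.mono hi'.le hq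

/-- A short walk in `G` with free edges has small weight. -/
theorem CoarseInv.le_of_reachable (h : CoarseInv p G B eu ev q W m T z) {x y : Fin n} {ℓ : ℝ}
    (hℓ : 0 ≤ ℓ) (hr : (short p G ℓ ⊔ firstEdges z m).Reachable x y) : W x y ≤ n * ℓ := by
  classical
  obtain ⟨w⟩ := hr
  have key : ∀ {a b : Fin n} (w : (short p G ℓ ⊔ firstEdges z m).Walk a b),
      W a b ≤ w.length * ℓ := by
    intro a b w
    induction w with
    | nil => rw [h.pseudo.self (Fin.is_lt _)]; simp
    | @cons a c b hac w ih =>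
      have h1 : W a c ≤ ℓ := by
        rcases hac with hac | hac
        · refine (h.le_of_adj hac.1).trans ?_
          rw [distMatrix_coe]
          exact hac.2
        · rw [firstEdges, SimpleGraph.fromRel_adj] at hac
          rcases hac.2 with ⟨j, hj, e⟩ | ⟨j, hj, e⟩
          · have := h.free j hj
            rw [e] at this
            exact this.le.trans hℓ
          · have := h.free j hj
            rw [e] at this
            rw [h.pseudo.symm a.2 c.2]
            exact this.le.trans hℓ
      have := h.pseudo.triangle a.2 c.2 b.2
      rw [SimpleGraph.Walk.length_cons]
      push_cast
      linarith
  refine (key w.bypass).trans ?_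
  have hlen := w.bypass_isPath.length_lt
  rw [Fintype.card_fin] at hlen
  gcongr

theorem CoarseInv.choose (h : CoarseInv p G B eu ev q W m T z)
    (he : IsSortedPairs n N (distMatrix p) eu ev) (hq : q < N) {u v : Fin n}
    (hu : eu q = u) (hv : ev q = v) (hW : 0 < W u v) {T' : ℕ → ℝ}
    (hT : ∀ j < m, T' j = T j) (hTm : T' m = W u v / distMatrix p u v) :
    CoarseInv p G B eu ev (q + 1) (contracted n W u v) (m + 1) T'
      (fun j => if j = m then (u, v) else z j) := by
  set z' : ℕ → Fin n × Fin n := fun j => if j = m then (u, v) else z j with hz'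
  have hzm : z' m = (u, v) := by simp [hz']
  have hz : ∀ j < m, z' j = z j := fun j hj => by simp [hz', hj.ne]
  have hfe : ∀ j ≤ m, firstEdges z' j = firstEdges z j := fun j hj =>
    firstEdges_congr fun i hi => hz i (by omega)
  have huv : u ≠ v := by
    rintro rfl
    rw [h.pseudo.self u.2] at hW
    exact lt_irrefl _ hW
  have hd : 0 < distMatrix p u v := distMatrix_pos p u.2 v.2 fun e => huv (Fin.ext e)
  have hTd : T' m * distMatrix p u v = W u v := by rw [hTm]; field_simp
  have hps := h.pseudo.contracted u.2 v.2
  have hle : ∀ {x y : Fin n}, contracted n W u v x y ≤ W x y := fun {x y} =>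
    h.pseudo.contracted_le u.2 v.2 x.2 y.2
  have hlast : (firstEdges z' (m + 1)).Reachable u v := by
    have := reachable_firstEdges z' (Nat.lt_succ_self m)
    rwa [hzm] at this
  refine ⟨hps, fun huv => hle.trans (h.le_of_adj huv), ?_, ?_, ?_, ?_, ?_, ?_, ?_, ?_, ?_⟩
  · intro j hj
    rcases Nat.lt_succ_iff_lt_or_eq.mp hj with hlt | rfl
    · rw [hz j hlt]
      exact le_antisymm (hle.trans (h.free j hlt).le) (hps.nonneg (Fin.is_lt _) (Fin.is_lt _))
    · rw [hzm]
      exact h.pseudo.contracted_self u.2 v.2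
  · intro x y ℓ hℓ hxy
    have hmono : short p G ℓ ⊔ firstEdges z m ≤ short p G ℓ ⊔ firstEdges z' (m + 1) := by
      rw [← hfe m le_rfl]
      exact sup_le_sup_left (firstEdges_mono z' (Nat.le_succ m)) _
    have hR : ∀ {a b : Fin n}, W a b ≤ ℓ →
        (short p G ℓ ⊔ firstEdges z' (m + 1)).Reachable a b := fun hab =>
      (h.reachable hℓ hab).mono hmono
    have huv' : (short p G ℓ ⊔ firstEdges z' (m + 1)).Reachable u v := hlast.mono le_sup_right
    rw [h.pseudo.contracted_eq u.2 v.2 x.2 y.2] at hxy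
    have n1 := h.pseudo.nonneg x.2 u.2
    have n2 := h.pseudo.nonneg v.2 y.2
    have n3 := h.pseudo.nonneg x.2 v.2
    have n4 := h.pseudo.nonneg u.2 y.2
    rcases min_le_iff.mp hxy with h1 | h1
    · exact hR h1
    · rcases min_le_iff.mp h1 with h1 | h1
      · exact (hR (by linarith)).trans (huv'.trans (hR (by linarith)))
      · exact (hR (by linarith)).trans (huv'.symm.trans (hR (by linarith)))
  · intro i hi x y hx hy
    rcases Nat.lt_succ_iff_lt_or_eq.mp hi with hlt | rfl
    · obtain ⟨m', hm', h1, h2⟩ := h.done i hlt x y hx hy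
      refine ⟨m', by omega, fun j hj => ?_, ?_⟩
      · rw [hz j (by omega)]
        exact h1 j hj
      · rw [hfe m' hm']
        exact h2
    · obtain rfl : u = x := Fin.ext (hu.symm.trans hx)
      obtain rfl : v = y := Fin.ext (hv.symm.trans hy)
      refine ⟨m + 1, le_rfl, fun j hj => ?_, hlast⟩
      rcases Nat.lt_succ_iff_lt_or_eq.mp hj with hlt | rfl
      · obtain ⟨i', hi', e1, e2⟩ := h.treated j hlt
        rw [hz j hlt, ← e1, ← e2, ← hu, ← hv]
        exact he.mono hi'.le hq
      · rw [hzm]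
  · intro j hj
    rcases Nat.lt_succ_iff_lt_or_eq.mp hj with hlt | rfl
    · obtain ⟨i, hi, e⟩ := h.treated j hlt
      rw [hz j hlt]
      exact ⟨i, by omega, e⟩
    · rw [hzm]
      exact ⟨q, Nat.lt_succ_self q, hu, hv⟩
  · intro i j hij hj
    rcases Nat.lt_succ_iff_lt_or_eq.mp hj with hlt | rfl
    · rw [hz j hlt, hz i (by omega)]
      exact h.mono i j hij hlt
    · rcases hij.lt_or_eq with hlt | rfl
      · obtain ⟨i', hi', e1, e2⟩ := h.treated i hlt
        rw [hz i hlt, hzm, ← e1, ← e2, ← hu, ← hv]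
        exact he.mono hi'.le hq
      · exact le_rfl
  · intro j hj
    rcases Nat.lt_succ_iff_lt_or_eq.mp hj with hlt | rfl
    · rw [hz j hlt]
      exact h.pos j hlt
    · rw [hzm]
      exact hd
  · intro j hj ℓ hℓ hr
    rcases Nat.lt_succ_iff_lt_or_eq.mp hj with hlt | rfl
    · rw [hz j hlt, hfe j hlt.le] at hr
      rw [hz j hlt, hT j hlt]
      exact h.lower j hlt ℓ hℓ hr
    · rw [hzm, hfe j le_rfl] at hr
      rw [hzm, hTd]
      exact h.le_of_reachable hℓ hr
  · intro j hj ℓ hℓ hle'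
    rcases Nat.lt_succ_iff_lt_or_eq.mp hj with hlt | rfl
    · rw [hz j hlt, hT j hlt] at hle'
      rw [hz j hlt, hfe j hlt.le]
      exact h.upper j hlt ℓ hℓ hle'
    · rw [hzm, hTd] at hle'
      rw [hzm, hfe j le_rfl]
      exact h.reachable hℓ hle'
  · have := h.pseudo.card_leaders_contracted u.2 v.2 hW
    have := h.count
    omega

open Classical in
/-- If more than `k` of the ratios `T j` are at least `τ`, then adding `k` edges cannot bring the
dilation below `τ / n`.  Indeed, consider for each such `j` the indicator function `χ j` of the
vertices reachable from one end of `z j` by short edges of `G` and by `z i` with `i < j`; it separates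
the ends of `z j`.  A nontrivial linear combination of these functions is constant on all the
added edges, and then also on the ends of the first `z j` it involves: a contradiction. -/
theorem CoarseInv.le_of_card (h : CoarseInv p G B eu ev q W m T z) {k : ℕ} {τ t : ℝ} (ht : 0 ≤ t)
    (hk : k < ((Finset.range m).filter fun j => τ ≤ T j).card) {S : SimpleGraph (Fin n)}
    (hS : S.edgeSet.ncard ≤ k) (hdil : dilation p (G ⊔ S) ≤ ENNReal.ofReal t) : τ ≤ n * t := by
  by_contra hlt
  push Not at hlt
  set J := (Finset.range m).filter fun j => τ ≤ T j with hJ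
  set d : ℕ → ℝ := fun j => distMatrix p (z j).1 (z j).2 with hd
  set R : ℕ → SimpleGraph (Fin n) := fun j => short p G (t * d j) ⊔ firstEdges z j with hR
  have hJm : ∀ j ∈ J, j < m := fun j hj => Finset.mem_range.mp (Finset.mem_filter.mp hj).1
  have hnr : ∀ j ∈ J, ¬ (R j).Reachable (z j).1 (z j).2 := by
    intro j hj hr
    have hdj := h.pos j (hJm j hj)
    have h1 := h.lower j (hJm j hj) (t * d j) (mul_nonneg ht hdj.le) hr
    have h2 : τ ≤ T j := (Finset.mem_filter.mp hj).2
    have h3 : n * t * d j < T j * d j := mul_lt_mul_of_pos_right (hlt.trans_le h2) hdj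
    simp only [hd] at h3 h1
    linarith
  set χ : ℕ → Fin n → ℝ := fun j x => if (R j).Reachable (z j).1 x then 1 else 0 with hχ
  let L : (J → ℝ) →ₗ[ℝ] (S.edgeSet → ℝ) :=
    { toFun := fun c e => ∑ j : J, c j * (χ j (Quot.out e.1).1 - χ j (Quot.out e.1).2)
      map_add' := fun c c' => by
        funext e
        simp only [Pi.add_apply, add_mul, Finset.sum_add_distrib]
      map_smul' := fun a c => by
        funext e
        simp only [Pi.smul_apply, smul_eq_mul, RingHom.id_apply, Finset.mul_sum, mul_assoc] }
  have hker : LinearMap.ker L ≠ ⊥ := by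
    refine LinearMap.ker_ne_bot_of_finrank_lt ?_
    rw [Module.finrank_fintype_fun_eq_card, Module.finrank_fintype_fun_eq_card, Fintype.card_coe,
      ← Set.toFinset_card, ← Set.ncard_eq_toFinset_card']
    omega
  obtain ⟨c, hc, hc0⟩ := (Submodule.ne_bot_iff _).mp hker
  set F : Fin n → ℝ := fun x => ∑ j : J, c j * χ j x with hF
  have hFS : ∀ a b, S.Adj a b → F a = F b := by
    intro a b hab
    have h1 := congrFun (LinearMap.mem_ker.mp hc) ⟨s(a, b), hab⟩
    have h2 : F (Quot.out s(a, b)).1 = F (Quot.out s(a, b)).2 := by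
      rw [← sub_eq_zero, hF]
      simp only [← Finset.sum_sub_distrib, ← mul_sub]
      exact h1
    have h3 : s((Quot.out s(a, b)).1, (Quot.out s(a, b)).2) = s(a, b) := Quot.out_eq s(a, b)
    rcases Sym2.eq_iff.mp h3 with ⟨e1, e2⟩ | ⟨e1, e2⟩
    · rw [e1, e2] at h2
      exact h2
    · rw [e1, e2] at h2
      exact h2.symm
  obtain ⟨j1, hj1⟩ : ∃ j, c j ≠ 0 := by
    by_contra hall
    push Not at hall
    exact hc0 (funext hall)
  obtain ⟨j0, hj0, hmin⟩ := Finset.exists_min_image (Finset.univ.filter fun j : J => c j ≠ 0)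
    (fun j => (j : ℕ)) ⟨j1, by simp [hj1]⟩
  have hcj0 : c j0 ≠ 0 := (Finset.mem_filter.mp hj0).2
  have hmin' : ∀ j : J, c j ≠ 0 → (j0 : ℕ) ≤ j := fun j hj => hmin j (by simp [hj])
  have hdj0 := h.pos j0 (hJm j0 j0.2)
  -- `F` is constant along short paths in `G ⊔ S`
  have hconst : F (z j0).1 = F (z j0).2 := by
    have hg := graphDist_le_dilation_mul p (G := G ⊔ S) (z j0).1 (z j0).2
    have hg' : graphDist p (G ⊔ S) (z j0).1 (z j0).2 ≤ ENNReal.ofReal (t * d j0) := by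
      refine hg.trans ?_
      rw [edist_eq_ofReal_distMatrix, ENNReal.ofReal_mul ht]
      gcongr
    obtain ⟨w⟩ := reachable_short_of_graphDist_le p (mul_nonneg ht hdj0.le) hg'
    have hw : ∀ {a b : Fin n} (w : (short p (G ⊔ S) (t * d j0)).Walk a b), F a = F b := by
      intro a b w
      induction w with
      | nil => rfl
      | @cons a x b hax w ih =>
        refine Eq.trans ?_ ih
        rcases hax.1 with hG | hS'
        · refine Finset.sum_congr rfl fun j _ => ?_
          by_cases hj : c j = 0
          · rw [hj, zero_mul, zero_mul]
          · have hle : t * d j0 ≤ t * d j :=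
              mul_le_mul_of_nonneg_left (h.mono j0 j (hmin' j hj) (hJm j j.2)) ht
            have hadj : (R j).Adj a x := Or.inl ⟨hG, hax.2.trans hle⟩
            have hiff : (R j).Reachable (z j).1 a ↔ (R j).Reachable (z j).1 x :=
              ⟨fun hr => hr.trans hadj.reachable, fun hr => hr.trans hadj.symm.reachable⟩
            simp only [hχ, hiff]
        · exact hFS a x hS'
    exact hw w
  refine hcj0 ?_
  have hval : F (z j0).1 - F (z j0).2 = c j0 := by
    simp only [hF, ← Finset.sum_sub_distrib, ← mul_sub]
    rw [Finset.sum_eq_single j0]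
    · simp only [hχ]
      rw [if_pos (SimpleGraph.Reachable.refl _), if_neg (hnr j0 j0.2)]
      ring
    · intro j _ hne
      by_cases hj : c j = 0
      · rw [hj, zero_mul]
      · have hlt' : (j0 : ℕ) < j := lt_of_le_of_ne (hmin' j hj) fun e => hne (Subtype.ext e.symm)
        have hr : (R j).Reachable (z j0).1 (z j0).2 :=
          (reachable_firstEdges z hlt').mono le_sup_right
        have hiff : (R j).Reachable (z j).1 (z j0).1 ↔ (R j).Reachable (z j).1 (z j0).2 :=
          ⟨fun h => h.trans hr, fun h => h.trans hr.symm⟩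
        simp only [hχ, hiff, sub_self, mul_zero]
    · intro hn
      exact absurd (Finset.mem_univ _) hn
  rw [← hval, hconst, sub_self]

open Classical in
/-- If at most `k` of the ratios `T j` exceed `τ`, then the dilation can be brought down to
`n * max 1 τ` by adding the corresponding pairs. -/
theorem CoarseInv.optDilation_le (h : CoarseInv p G B eu ev N W m T z)
    (he : IsSortedPairs n N (distMatrix p) eu ev) {k : ℕ} {τ : ℝ}
    (hk : ((Finset.range m).filter fun j => τ < T j).card ≤ k)
    (hτ : ∀ x y, τ * distMatrix p x y < B) :
    optDilation p G k ≤ ENNReal.ofReal (n * max 1 τ) := by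
  set c := max 1 τ with hc
  have hc1 : 1 ≤ c := le_max_left _ _
  set S : SimpleGraph (Fin n) := SimpleGraph.fromRel fun a b => ∃ j < m, τ < T j ∧ z j = (a, b)
    with hS
  have hcard : S.edgeSet.ncard ≤ k := by
    refine le_trans ?_ hk
    rw [← Set.ncard_coe_finset]
    refine le_trans (Set.ncard_le_ncard (t := (fun j => s((z j).1, (z j).2)) ''
      (((Finset.range m).filter fun j => τ < T j : Finset ℕ) : Set ℕ)) ?_
      ((Finset.finite_toSet _).image _)) (Set.ncard_image_le (Finset.finite_toSet _))
    intro e hem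
    induction e with | _ a b =>
    rw [SimpleGraph.mem_edgeSet, hS, SimpleGraph.fromRel_adj] at hem
    rcases hem.2 with ⟨j, hj, hT, e⟩ | ⟨j, hj, hT, e⟩
    · exact ⟨j, by simp [hj, hT], by simp [e]⟩
    · exact ⟨j, by simp [hj, hT], by simp [e, Sym2.eq_swap]⟩
  refine (MetricGraph.optDilation_le p hcard).trans (MetricGraph.dilation_le p fun x y => ?_)
  have hchain : ∀ j < m, (short p (G ⊔ S) (c * distMatrix p (z j).1 (z j).2)).Reachable
      (z j).1 (z j).2 := by
    intro j
    induction j using Nat.strong_induction_on with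
    | _ j ih =>
      intro hj
      have hd := h.pos j hj
      by_cases hT : τ < T j
      · refine SimpleGraph.Adj.reachable ⟨Or.inr ?_, ?_⟩
        · rw [hS, SimpleGraph.fromRel_adj]
          refine ⟨fun e => ?_, Or.inl ⟨j, hj, hT, rfl⟩⟩
          rw [e, distMatrix_self] at hd
          exact lt_irrefl _ hd
        · rw [← distMatrix_coe]
          nlinarith
      · have hle : T j * distMatrix p (z j).1 (z j).2 ≤ τ * distMatrix p (z j).1 (z j).2 :=
          mul_le_mul_of_nonneg_right (not_lt.mp hT) hd.le
        have hr := h.upper j hj _ (hτ _ _) hle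
        refine reachable_of_forall_adj (fun a b hab => ?_) hr
        rcases hab with hab | hab
        · refine SimpleGraph.Adj.reachable ⟨Or.inl hab.1, hab.2.trans ?_⟩
          exact mul_le_mul_of_nonneg_right (le_max_right _ _) hd.le
        · rw [firstEdges, SimpleGraph.fromRel_adj] at hab
          have step : ∀ i < j, (short p (G ⊔ S) (c * distMatrix p (z j).1 (z j).2)).Reachable
              (z i).1 (z i).2 := fun i hi => (ih i hi (by omega)).mono (short_mono p
                (mul_le_mul_of_nonneg_left (h.mono i j hi.le hj) (by linarith)))
          rcases hab.2 with ⟨i, hi, e⟩ | ⟨i, hi, e⟩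
          · have := step i hi
            rwa [e] at this
          · have := step i hi
            rw [e] at this
            exact this.symm
  obtain ⟨i, hi, hx, hy⟩ := he.exists_eq x.2 y.2
  obtain ⟨m', hm', hle, hr⟩ := h.done i hi x y hx hy
  have hr' : (short p (G ⊔ S) (c * distMatrix p x y)).Reachable x y := by
    refine reachable_of_forall_adj (fun a b hab => ?_) hr
    rw [firstEdges, SimpleGraph.fromRel_adj] at hab
    have step : ∀ j < m', (short p (G ⊔ S) (c * distMatrix p x y)).Reachable
        (z j).1 (z j).2 := fun j hj => (hchain j (by omega)).mono (short_mono p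
          (mul_le_mul_of_nonneg_left (hle j hj) (by linarith)))
    rcases hab.2 with ⟨j, hj, e⟩ | ⟨j, hj, e⟩
    · have := step j hj
      rwa [e] at this
    · have := step j hj
      rw [e] at this
      exact this.symm
  refine (graphDist_le_of_reachable_short p hr').trans ?_
  rw [edist_eq_ofReal_distMatrix, ← ENNReal.ofReal_mul (by positivity), mul_assoc]

end

/-- The optimal dilation is bounded by the number of vertices times the ratio of the largest and the
smallest distance, unless it is infinite. -/
theorem dilation_le_of_ne_top {S : SimpleGraph (Fin n)} (h : dilation p S ≠ ⊤) {a b : ℝ}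
    (ha : ∀ x y, distMatrix p x y ≤ a) (hb : ∀ x y, 0 < distMatrix p x y → 1 ≤ b * distMatrix p x y) :
    dilation p S ≤ ENNReal.ofReal (n * (a * b)) := by
  refine MetricGraph.dilation_le p fun x y => ?_
  by_cases hxy : x = y
  · subst hxy; simp [graphDist_self]
  have ha0 : 0 ≤ a := (distMatrix_nonneg p 0 0).trans (ha 0 0)
  have hd := distMatrix_pos p x.2 y.2 fun e => hxy (Fin.ext e)
  have hreach : (short p S a).Reachable x y := by
    have hfin : graphDist p S x y ≠ ⊤ := ne_top_of_le_ne_top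
      (ENNReal.mul_ne_top h (edist_ne_top _ _)) (graphDist_le_dilation_mul p x y)
    obtain ⟨w, -, -⟩ := exists_isPath_walkLength_le p hfin le_rfl
    refine reachable_of_forall_adj (H := S) (fun u v huv => ?_) w.reachable
    have h1 : (short p S a).Adj u v := ⟨huv, by rw [← distMatrix_coe]; exact ha u v⟩
    exact h1.reachable
  refine (graphDist_le_of_reachable_short p hreach).trans ?_
  have hb0 : 0 ≤ b := by
    by_contra hneg
    have := hb x y hd
    nlinarith
  rw [edist_eq_ofReal_distMatrix, ← ENNReal.ofReal_mul (by positivity)]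
  refine ENNReal.ofReal_le_ofReal ?_
  have := hb x y hd
  have hna : 0 ≤ n * a := by positivity
  nlinarith

end MetricGraph

/-! ### Inserting a link into the hop distances

The programs use the following arrays; all others hold counters and other single numbers. In the
integer arrays: `5` the edges inserted by the greedy algorithm, `6` the hop distances, `7` and `8`
for each vertex the list of all vertices sorted by graph distance and by distance, `9` the positions
reached in these lists by the merge, `10` and `11` the sorted list of all pairs. In the real arrays:
`2` the graph distances, `4` the matrix of `MetricGraph.IsNearest`, `5` the matrix of
`MetricGraph.IsDetour`, `6` the contracted distances and `7` the ratios of the coarse phase. -/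

namespace MetricGraph

/-- The sum of all entries of a matrix. -/
def entrySum (n : ℕ) (H : ℕ → ℕ → ℕ) : ℕ := ∑ x ∈ Finset.range n, ∑ y ∈ Finset.range n, H x y

theorem entrySum_le_entrySum {n : ℕ} {H H' : ℕ → ℕ → ℕ} (h : ∀ x < n, ∀ y < n, H' x y ≤ H x y) :
    entrySum n H' ≤ entrySum n H :=
  Finset.sum_le_sum fun x hx => Finset.sum_le_sum fun y hy =>
    h x (Finset.mem_range.mp hx) y (Finset.mem_range.mp hy)

theorem entrySum_lt_entrySum {n : ℕ} {H H' : ℕ → ℕ → ℕ} (h : ∀ x < n, ∀ y < n, H' x y ≤ H x y)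
    {x y : ℕ} (hx : x < n) (hy : y < n) (hlt : H' x y < H x y) : entrySum n H' < entrySum n H :=
  Finset.sum_lt_sum (fun x hx => Finset.sum_le_sum fun y hy =>
    h x (Finset.mem_range.mp hx) y (Finset.mem_range.mp hy))
    ⟨x, Finset.mem_range.mpr hx, Finset.sum_lt_sum
      (fun y hy => h x hx y (Finset.mem_range.mp hy)) ⟨y, Finset.mem_range.mpr hy, hlt⟩⟩

theorem entrySum_le {n m : ℕ} {H : ℕ → ℕ → ℕ} (h : ∀ x < n, ∀ y < n, H x y ≤ m) :
    entrySum n H ≤ n * (n * m) := by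
  refine (entrySum_le_entrySum (H := fun _ _ => m) h).trans ?_
  simp [entrySum]

theorem IsNearest.update {n m : ℕ} {D : ℕ → ℕ → ℝ} {H : ℕ → ℕ → ℕ} {M : ℕ → ℕ → ℝ}
    (h : IsNearest n m D H M) {z e j : ℕ} (hz : z < n) (hjm : j < m) :
    IsNearest n m D (fun x y => if x = z ∧ y = e then j else H x y)
      (fun x y => if x < n ∧ y = e then min (M x y) (D x z) else M x y) where
  le := fun {x a y} hx ha hy hlt => by
    have hMle : (if x < n ∧ y = e then min (M x y) (D x z) else M x y) ≤ M x y := by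
      split_ifs
      · exact min_le_left _ _
      · exact le_rfl
    by_cases hae : a = z ∧ y = e
    · rw [if_pos ⟨hx, hae.2⟩, hae.1]
      exact min_le_right _ _
    · rw [if_neg hae] at hlt
      exact hMle.trans (h.le hx ha hy hlt)
  attained := fun {x y} hx hy => by
    obtain ⟨a, ha, hlt, he⟩ := h.attained hx hy
    have hlt' : (if a = z ∧ y = e then j else H a y) < m := by
      split_ifs
      · exact hjm
      · exact hlt
    by_cases hye : x < n ∧ y = e
    · rw [if_pos hye]
      rcases min_choice (M x y) (D x z) with hc | hc
      · exact ⟨a, ha, hlt', by rw [hc, he]⟩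
      · exact ⟨z, hz, by simpa [hye.2] using hjm, hc⟩
    · rw [if_neg hye]
      exact ⟨a, ha, hlt', he⟩

/-- The matrix `H` after improving the first `e` entries of the row `z` by the entries of the row
`c`, increased by `j`. -/
def improveRow (H : ℕ → ℕ → ℕ) (z c j e : ℕ) (x y : ℕ) : ℕ :=
  if x = z ∧ y < e then min (H x y) (j + H c y) else H x y

theorem improveRow_le (H : ℕ → ℕ → ℕ) (z c j e x y : ℕ) : improveRow H z c j e x y ≤ H x y := by
  rw [improveRow]
  split_ifs
  · exact min_le_left _ _
  · exact le_rfl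

theorem improveRow_succ_of_le {H : ℕ → ℕ → ℕ} {z c j e : ℕ} (h : H z e ≤ j + H c e) :
    improveRow H z c j (e + 1) = improveRow H z c j e := by
  funext x y
  rw [improveRow, improveRow]
  by_cases h1 : x = z ∧ y = e
  · obtain ⟨rfl, rfl⟩ := h1
    simp [h]
  · refine if_congr ?_ rfl rfl
    omega

theorem improveRow_succ_of_lt {H : ℕ → ℕ → ℕ} {z c j e : ℕ} (h : j + H c e < H z e) :
    improveRow H z c j (e + 1) =
      fun x y => if x = z ∧ y = e then j + H c e else improveRow H z c j e x y := by
  funext x y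
  rw [improveRow, improveRow]
  by_cases h1 : x = z ∧ y = e
  · obtain ⟨rfl, rfl⟩ := h1
    simp [h.le]
  · rw [if_neg h1]
    refine if_congr ?_ rfl rfl
    omega

end MetricGraph

namespace RealRAM

open MetricGraph

/-- Program for `M x e := min (M x e) (D x z)` for all `x`, with `M`, `D` the real arrays `4`, `2`
and `e`, `z` the cells `(0, 0)` of the integer arrays `35`, `34`. -/
def nearestColumn : Cmd :=
  forLoop 37 0 (.cond (.realLt (.get 2 (nv 37) (nv 34)) (.get 4 (nv 37) (nv 35)))
    (.setReal 4 (nv 37) (nv 35) (.get 2 (nv 37) (nv 34))) .skip)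

theorem run_nearestColumn (s : State) {n : ℕ} (hn : s.nat 0 0 0 = n) :
    Run nearestColumn s fun T s' => T ≤ n * 46 + 12 ∧ s'.real 4 = fun x y =>
      if x < n ∧ y = s.nat 35 0 0 then min (s.real 4 x y) (s.real 2 x (s.nat 34 0 0))
      else s.real 4 x y := by
  refine run_forLoop_le n 30 (fun j s' => s'.real 4 = fun x y =>
      if x < j ∧ y = s.nat 35 0 0 then min (s.real 4 x y) (s.real 2 x (s.nat 34 0 0))
      else s.real 4 x y) hn (by decide) (by decide) (by decide) (fun _ _ _ h => h) (by simp) ?_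
      (fun T s' hT _ h => ⟨hT, h⟩)
  intro j s' hj hF hij hM
  have e1 : s'.nat 34 = s.nat 34 := hF.1 _ (by decide)
  have e2 : s'.nat 35 = s.nat 35 := hF.1 _ (by decide)
  have e3 : s'.real 2 = s.real 2 := hF.2 _ (by decide)
  have e4 : s'.real 4 j (s.nat 35 0 0) = s.real 4 j (s.nat 35 0 0) := by rw [hM]; simp
  refine run_cond (fun hc => run_setReal ?_) (fun hc => run_skip ?_)
  · refine ⟨by simp, ?_⟩
    simp only [BExpr.holds, RExpr.eval, nv, NExpr.eval, hij, e1, e2, e3, e4] at hc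
    funext x y
    simp only [nv, NExpr.eval, hij, e1, e2, RExpr.eval, e3, State.setReal_real_apply, true_and]
    by_cases h : x = j ∧ y = s.nat 35 0 0
    · rw [if_pos h, if_pos ⟨by omega, h.2⟩, h.1, h.2, min_eq_right hc.le]
    · rw [if_neg h, hM]
      refine if_congr ?_ rfl rfl
      omega
  · refine ⟨by simp, ?_⟩
    simp only [BExpr.holds, RExpr.eval, nv, NExpr.eval, hij, e1, e2, e3, e4, not_lt] at hc
    rw [hM]
    funext x y
    by_cases h : x = j ∧ y = s.nat 35 0 0
    · rw [if_neg (by omega), if_pos ⟨by omega, h.2⟩, h.1, h.2, min_eq_left hc]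
    · refine if_congr ?_ rfl rfl
      omega

/-- Program for `MetricGraph.improveRow`; the matrix is the integer array `6`, and the arguments `z`,
`c`, `j` are the cells `(0, 0)` of the integer arrays `34`, `c`, `36`.  The real array `4` is
updated accordingly. -/
def improve (c : ℕ) : Cmd :=
  forLoop 35 0 (.cond
    (.natLt (.add (nv 36) (.get 6 (nv c) (nv 35))) (.get 6 (nv 34) (nv 35)))
    (.seq (.setNat 6 (nv 34) (nv 35) (.add (nv 36) (.get 6 (nv c) (nv 35)))) nearestColumn)
    .skip)

theorem run_improve (s : State) {n m c a : ℕ} (hn : s.nat 0 0 0 = n) (hc : c ∉ [6, 35, 37])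
    (ha : s.nat c 0 0 = a) (hz : s.nat 34 0 0 < n) (haz : a ≠ s.nat 34 0 0)
    (hm : ∀ x < n, ∀ y < n, s.nat 6 x y ≤ m)
    (hM : IsNearest n m (s.real 2) (s.nat 6) (s.real 4)) :
    Run (improve c) s fun T s' => T + 46 * n * entrySum n (s'.nat 6) ≤
        66 * n + 12 + 46 * n * entrySum n (s.nat 6) ∧
      s'.nat 6 = improveRow (s.nat 6) (s.nat 34 0 0) a (s.nat 36 0 0) n ∧
      IsNearest n m (s.real 2) (s'.nat 6) (s'.real 4) := by
  set z := s.nat 34 0 0 with hz'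
  refine run_forLoop n (fun e T s' => T + 46 * n * entrySum n (s'.nat 6) ≤
        66 * e + 46 * n * entrySum n (s.nat 6) ∧
      s'.nat 6 = improveRow (s.nat 6) z a (s.nat 36 0 0) e ∧
      IsNearest n m (s.real 2) (s'.nat 6) (s'.real 4)) hn (by decide)
      (by simp [Cmd.nats, nearestColumn, forLoop]) (by simp [Cmd.nats, nearestColumn, forLoop])
      ?_ ⟨by simp, ?_, hM⟩ ?_ ?_
  · rintro j T s' v ⟨h1, h2, h3⟩
    exact ⟨h1, h2, h3⟩
  · funext x y
    simp [improveRow]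
  · rintro e T s' he hF hee ⟨hT, hH, hM'⟩
    have e0 : s'.nat 0 = s.nat 0 := hF.1 _ (by simp [Cmd.nats, nearestColumn, forLoop])
    have e1 : s'.nat 34 = s.nat 34 := hF.1 _ (by simp [Cmd.nats, nearestColumn, forLoop])
    have e2 : s'.nat 36 = s.nat 36 := hF.1 _ (by simp [Cmd.nats, nearestColumn, forLoop])
    have e3 : s'.real 2 = s.real 2 := hF.2 _ (by simp [Cmd.reals, nearestColumn, forLoop])
    have e4 : s'.nat c 0 0 = a := by
      simp only [List.mem_cons, List.not_mem_nil, or_false, not_or] at hc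
      rw [hF.1 _ (by simp [Cmd.nats, nearestColumn, forLoop, hc]), ha]
    have h1 : s'.nat 6 a e = s.nat 6 a e := by rw [hH, improveRow, if_neg (fun h => haz h.1)]
    have h2 : s'.nat 6 z e = s.nat 6 z e := by rw [hH, improveRow, if_neg (fun h => by omega)]
    refine run_cond (fun hc => run_seq (run_setNat ?_)) (fun hc => run_skip ?_)
    · simp only [BExpr.holds, nv, NExpr.eval, hee, e1, e2, e4, h1, ← hz', h2] at hc
      simp only [nv, NExpr.eval, NExpr.cost, BExpr.cost, hee, e1, e2, e4, h1, ← hz']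
      set s1 := s'.setNat 6 z e (s.nat 36 0 0 + s.nat 6 a e) with hs1
      have hn1 : s1.nat 0 0 0 = n := by
        rw [hs1, State.setNat_nat_of_ne _ (by decide), e0, hn]
      refine run_frame ((run_nearestColumn s1 hn1).mono ?_)
      rintro T' s'' ⟨hT', hM''⟩ hF''
      have h6 : s''.nat 6 = fun x y => if x = z ∧ y = e then s.nat 36 0 0 + s.nat 6 a e
          else s'.nat 6 x y := by
        rw [hF''.1 6 (by decide)]
        funext x y
        simp [hs1]
      have e5 : s1.nat 35 0 0 = e := by
        rw [hs1, State.setNat_nat_of_ne _ (by decide), hee]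
      have e6 : s1.nat 34 0 0 = z := by
        rw [hs1, State.setNat_nat_of_ne _ (by decide), e1]
      have hlt : entrySum n (s''.nat 6) < entrySum n (s'.nat 6) := by
        refine entrySum_lt_entrySum (x := z) (y := e) ?_ hz he ?_
        · intro x _ y _
          rw [h6]
          dsimp only
          split_ifs with h
          · rw [h.1, h.2, h2]; exact hc.le
          · exact le_rfl
        · rw [h6, h2]
          simpa using hc
      refine ⟨?_, ?_, ?_⟩
      · have : 46 * n * (entrySum n (s''.nat 6) + 1) ≤ 46 * n * entrySum n (s'.nat 6) := by
          gcongr; omega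
        rw [mul_add] at this
        omega
      · rw [h6, improveRow_succ_of_lt hc, hH]
      · rw [h6, hM'', e5, e6]
        simp only [hs1, State.setNat_real, e3]
        exact hM'.update hz (hc.trans_le (hm z hz e he))
    · simp only [BExpr.holds, nv, NExpr.eval, hee, e1, e2, e4, h1, ← hz', h2, not_lt] at hc
      refine ⟨?_, ?_, hM'⟩
      · simp only [nv, NExpr.cost, BExpr.cost]
        omega
      · rw [hH, improveRow_succ_of_le hc]
  · rintro T s' hF ⟨hT, hH, hM'⟩
    exact ⟨by omega, hH, hM'⟩

/-- Program for `MetricGraph.hopInsert`; the matrix is the integer array `6`, and the ends of the link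
are the cells `(0, 0)` of the integer arrays `b` and `c`.  The real array `4` is updated
accordingly.  Rows in which the entry of the column `c` cannot be improved are skipped. -/
def insertLink (b c : ℕ) : Cmd :=
  forLoop 34 0 (.cond (.natLt (.add (.get 6 (nv 34) (nv b)) (.lit 1)) (.get 6 (nv 34) (nv c)))
    (.seq (setN 36 (.add (.get 6 (nv 34) (nv b)) (.lit 1))) (improve c)) .skip)

/-- The amortised cost of the insertion of a link: apart from the scan of the column `c`, each
improved row decreases the sum of the hop distances and takes linear time, and so does each improved
entry, which entails the update of a column of the real array `4`. -/
theorem run_insertLink (s : State) {n m b c x₀ y₀ : ℕ} (hn : s.nat 0 0 0 = n)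
    (hb : b ∉ [6, 34, 35, 36, 37]) (hc : c ∉ [6, 34, 35, 36, 37])
    (hbx : s.nat b 0 0 = x₀) (hcy : s.nat c 0 0 = y₀) (hy₀ : y₀ < n)
    (hH : IsHopDist n m (s.nat 6)) (hM : IsNearest n m (s.real 2) (s.nat 6) (s.real 4)) :
    Run (insertLink b c) s fun T s' => T + 112 * n * entrySum n (s'.nat 6) ≤
        58 * n + 12 + 112 * n * entrySum n (s.nat 6) ∧
      s'.nat 6 = hopInsert n (s.nat 6) x₀ y₀ ∧
      IsNearest n m (s.real 2) (s'.nat 6) (s'.real 4) := by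
  refine run_forLoop n (fun z T s' => T + 112 * n * entrySum n (s'.nat 6) ≤
        58 * z + 112 * n * entrySum n (s.nat 6) ∧
      (s'.nat 6 = fun x y => if x < z then hopInsert n (s.nat 6) x₀ y₀ x y else s.nat 6 x y) ∧
      IsNearest n m (s.real 2) (s'.nat 6) (s'.real 4)) hn (by decide)
      (by simp [Cmd.nats, nearestColumn, forLoop, improve])
      (by simp [Cmd.nats, nearestColumn, forLoop, improve])
      ?_ ⟨by simp, by simp, hM⟩ ?_ ?_
  · rintro j T s' v ⟨h1, h2, h3⟩
    exact ⟨h1, h2, h3⟩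
  · rintro z T s' hz hF hzz ⟨hT, hH', hM'⟩
    simp only [List.mem_cons, List.not_mem_nil, or_false, not_or] at hb hc
    have e0 : s'.nat 0 = s.nat 0 :=
      hF.1 _ (by simp [Cmd.nats, nearestColumn, forLoop, improve])
    have e1 : s'.nat b 0 0 = x₀ := by
      rw [hF.1 _ (by simp [Cmd.nats, nearestColumn, forLoop, improve, hb]), hbx]
    have e2 : s'.nat c 0 0 = y₀ := by
      rw [hF.1 _ (by simp [Cmd.nats, nearestColumn, forLoop, improve, hc]), hcy]
    have e3 : s'.real 2 = s.real 2 :=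
      hF.2 _ (by simp [Cmd.reals, nearestColumn, forLoop, improve])
    -- neither the row `z` nor the row `y₀` has changed
    have hrow : ∀ y, s'.nat 6 z y = s.nat 6 z y := fun y => by rw [hH']; simp
    have hrow' : ∀ y < n, s'.nat 6 y₀ y = s.nat 6 y₀ y := fun y hy => by
      rw [hH']
      dsimp only
      split_ifs
      · rw [hopInsert_of_lt hy₀ hy, min_eq_left]
        omega
      · rfl
    have hle : ∀ x < n, ∀ y < n, s'.nat 6 x y ≤ m := fun x hx y hy => by
      rw [hH']
      dsimp only
      split_ifs
      · exact (hopInsert_le _ _ _ _ _ _).trans (hH.le hx hy)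
      · exact hH.le hx hy
    refine run_cond (fun hcd => run_seq (run_setNat ?_)) (fun hcd => run_skip ?_)
    · simp only [BExpr.holds, nv, NExpr.eval, hzz, e1, e2, hrow] at hcd
      simp only [nv, NExpr.eval, NExpr.cost, BExpr.cost, hzz, e1, hrow]
      set s1 := s'.setNat 36 0 0 (s.nat 6 z x₀ + 1) with hs1
      have f : ∀ a, a ≠ 36 → s1.nat a = s'.nat a := fun a ha => State.setNat_nat_of_ne _ ha
      have g36 : s1.nat 36 0 0 = s.nat 6 z x₀ + 1 := by simp [hs1]
      have g34 : s1.nat 34 0 0 = z := by rw [f _ (by decide), hzz]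
      have hne : y₀ ≠ z := by
        rintro rfl
        rw [hH.self hy₀] at hcd
        omega
      refine (run_improve s1 (n := n) (m := m) (c := c) (a := y₀) ?_ (by simp [hc]) ?_ ?_ ?_ ?_
        ?_).mono ?_
      · rw [f _ (by decide), e0, hn]
      · rw [f _ (by simp [hc]), e2]
      · rw [g34]; exact hz
      · rw [g34]; exact hne
      · rw [f _ (by decide)]; exact hle
      · rw [f _ (by decide), hs1, State.setNat_real, e3]
        exact hM'
      rintro T' s'' ⟨hT', hI, hM''⟩
      rw [f _ (by decide)] at hT'
      rw [g34, g36, f _ (by decide)] at hI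
      have h6 : s''.nat 6 = fun x y => if x < z + 1 then hopInsert n (s.nat 6) x₀ y₀ x y
          else s.nat 6 x y := by
        rw [hI]
        funext x y
        rw [improveRow]
        by_cases hxz : x = z
        · subst hxz
          rw [if_pos x.lt_succ_self, hrow]
          by_cases hy : y < n
          · rw [if_pos ⟨rfl, hy⟩, hopInsert_of_lt hz hy, hrow' y hy]
          · rw [if_neg fun h => hy h.2, hopInsert, if_neg fun h => hy h.2]
        · rw [if_neg (by omega), hH']
          refine if_congr ?_ rfl rfl
          omega
      have hlt : entrySum n (s''.nat 6) < entrySum n (s'.nat 6) := by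
        refine entrySum_lt_entrySum (x := z) (y := y₀) ?_ hz hy₀ ?_
        · intro x _ y _
          rw [hI]
          exact improveRow_le _ _ _ _ _ _ _
        · rw [hI, improveRow, if_pos ⟨rfl, hy₀⟩, hrow, hrow' _ hy₀, hH.self hy₀]
          omega
      refine ⟨?_, h6, ?_⟩
      · have h2 : n * (entrySum n (s''.nat 6) + 1) ≤ n * entrySum n (s'.nat 6) := by
          gcongr; omega
        rw [mul_add] at h2
        have : 112 * n * entrySum n (s'.nat 6) = 112 * (n * entrySum n (s'.nat 6)) := by ring
        have : 112 * n * entrySum n (s''.nat 6) = 112 * (n * entrySum n (s''.nat 6)) := by ring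
        have : 46 * n * entrySum n (s'.nat 6) = 46 * (n * entrySum n (s'.nat 6)) := by ring
        have : 46 * n * entrySum n (s''.nat 6) = 46 * (n * entrySum n (s''.nat 6)) := by ring
        omega
      · rw [hs1, State.setNat_real, e3] at hM''
        exact hM''
    · simp only [BExpr.holds, nv, NExpr.eval, hzz, e1, e2, hrow, not_lt] at hcd
      refine ⟨?_, ?_, hM'⟩
      · simp only [nv, NExpr.cost, BExpr.cost]
        omega
      · rw [hH']
        funext x y
        by_cases hxz : x = z
        · subst hxz
          rw [if_neg (by omega), if_pos (by omega)]
          by_cases hy : y < n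
          · rw [hopInsert_of_lt hz hy, min_eq_left]
            have := hH.triangle hz hy₀ hy
            omega
          · rw [hopInsert, if_neg (by omega)]
        · refine if_congr ?_ rfl rfl
          omega
  · rintro T s' hF ⟨hT, hH', hM'⟩
    refine ⟨by omega, ?_, hM'⟩
    rw [hH']
    funext x y
    split_ifs with h
    · rfl
    · rw [hopInsert, if_neg (by omega)]

end RealRAM

/-! ### Inserting all links of a new edge -/

namespace MetricGraph

/-- `o 0, …, o (n - 1)` are the numbers below `n`, sorted by the values of `f`. -/
structure IsRowSorted (n : ℕ) (f : ℕ → ℝ) (o : ℕ → ℕ) : Prop where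
  lt : ∀ {i}, i < n → o i < n
  inj : ∀ {i j}, i < n → j < n → o i = o j → i = j
  exists_eq : ∀ {y}, y < n → ∃ i < n, o i = y
  mono : ∀ {i j}, i ≤ j → j < n → f (o i) ≤ f (o j)

/-- The number of pairs whose hop distance drops is at most the decrease of the sum. -/
theorem card_add_entrySum_le {n : ℕ} {H H' : ℕ → ℕ → ℕ} {P : Finset (ℕ × ℕ)}
    (h : ∀ x y, H' x y ≤ H x y) (hP : ∀ q ∈ P, q.1 < n ∧ q.2 < n ∧ H' q.1 q.2 < H q.1 q.2) :
    P.card + entrySum n H' ≤ entrySum n H := by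
  have hsub : P ⊆ Finset.range n ×ˢ Finset.range n := fun q hq => by
    simp [(hP q hq).1, (hP q hq).2.1]
  have e : ∀ H : ℕ → ℕ → ℕ, entrySum n H =
      ∑ q ∈ Finset.range n ×ˢ Finset.range n, H q.1 q.2 := fun H => by
    rw [Finset.sum_product]; rfl
  rw [e, e, Finset.card_eq_sum_ones, ← Finset.sum_sdiff hsub, ← Finset.sum_sdiff hsub]
  have h1 := Finset.sum_le_sum fun (q : ℕ × ℕ) (_ : q ∈ (Finset.range n ×ˢ Finset.range n) \ P) =>
    h q.1 q.2
  have h2 := Finset.sum_le_sum fun q (hq : q ∈ P) => (Nat.succ_le_of_lt (hP q hq).2.2)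
  simp only [Nat.succ_eq_add_one, Finset.sum_add_distrib] at h2
  omega

end MetricGraph

namespace RealRAM

open MetricGraph

/-- Program which links the vertex in the cell `(0, 0)` of the integer array `31` to all vertices in
its part of the box of the edge between the vertices `u` and `v` in the cells `(0, 0)` of the
integer arrays `24` and `25`.  The rows of the integer array `7` list the vertices in the order of
their graph distance. -/
def linkVertex : Cmd :=
  .seq (setN 32 (.lit 0))
    (.loop (.conj (.natLt (nv 32) (nv 0)) (.neg (.realLt (.mul (rv 17) (.get 0 (nv 24) (nv 25)))
        (.add (.get 2 (nv 24) (nv 31)) (.get 2 (nv 25) (.get 7 (nv 25) (nv 32)))))))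
      (.seq (setN 33 (.get 7 (nv 25) (nv 32))) (.seq (insertLink 31 33)
        (.seq (insertLink 33 31) (setN 32 (.add (nv 32) (.lit 1)))))))

/-- Program which inserts all links of a new edge. -/
def linkBox : Cmd := forLoop 31 0 linkVertex

/-- The state while the links of a new edge are inserted: `P` is the set of pairs which have been
linked. -/
structure BoxInv (n m : ℕ) (box : ℕ → ℕ → Prop) (D : ℕ → ℕ → ℝ) (H : ℕ → ℕ → ℕ)
    (P : Finset (ℕ × ℕ)) (H' : ℕ → ℕ → ℕ) (M : ℕ → ℕ → ℝ) : Prop where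
  closure : LinkClosure n box H H'
  nearest : IsNearest n m D H' M
  lt : ∀ q ∈ P, q.1 < n ∧ q.2 < n
  box : ∀ q ∈ P, box q.1 q.2
  le_one : ∀ q ∈ P, H' q.1 q.2 ≤ 1 ∧ H' q.2 q.1 ≤ 1

theorem run_linkVertex (s : State) {n m u v a : ℕ} {c : ℝ} (hn : s.nat 0 0 0 = n) {H : ℕ → ℕ → ℕ}
    (hH : IsHopDist n m H) (hu : s.nat 24 0 0 = u) (hv : s.nat 25 0 0 = v)
    (hc : s.real 17 0 0 * s.real 0 u v = c) (ho : IsRowSorted n (s.real 2 v) (s.nat 7 v))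
    {P : Finset (ℕ × ℕ)} (hi : BoxInv n m (fun x y => s.real 2 u x + s.real 2 v y ≤ c) (s.real 2) H P
      (s.nat 6) (s.real 4)) (ha : s.nat 31 0 0 = a) (han : a < n) (hPa : ∀ q ∈ P, q.1 ≠ a) :
    Run linkVertex s fun T s' => ∃ P', P ⊆ P' ∧
      T + 112 * n * entrySum n (s'.nat 6) + P.card * (199 * n) ≤
        45 + P'.card * (199 * n) + 112 * n * entrySum n (s.nat 6) ∧
      BoxInv n m (fun x y => s.real 2 u x + s.real 2 v y ≤ c) (s.real 2) H P'
        (s'.nat 6) (s'.real 4) ∧ (∀ q ∈ P', q.1 ≠ a → q ∈ P) ∧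
      ∀ y < n, s.real 2 u a + s.real 2 v y ≤ c → (a, y) ∈ P' := by
  set box : ℕ → ℕ → Prop := fun x y => s.real 2 u x + s.real 2 v y ≤ c with hbox
  refine run_seq (run_setNat ?_)
  simp only [NExpr.eval, NExpr.cost]
  set s0 := s.setNat 32 0 0 0 with hs0
  refine run_loop n (fun i T s' => s'.nat 32 0 0 = i ∧ ∃ P', P ⊆ P' ∧
      T + 112 * n * entrySum n (s'.nat 6) + P.card * (199 * n) ≤
        P'.card * (199 * n) + 112 * n * entrySum n (s.nat 6) ∧
      BoxInv n m box (s.real 2) H P' (s'.nat 6) (s'.real 4) ∧ (∀ q ∈ P', q.1 ≠ a → q ∈ P) ∧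
      (∀ y, (a, y) ∈ P' ↔ ∃ i' < i, s.nat 7 v i' = y) ∧ i ≤ n) ?_ ?_ ?_
  · refine ⟨by simp [hs0], P, Finset.Subset.refl _, ?_, ?_, fun q hq _ => hq, ?_, Nat.zero_le _⟩
    · rw [hs0, State.setNat_nat_of_ne _ (by decide)]
      omega
    · rw [hs0, State.setNat_nat_of_ne _ (by decide)]
      exact hi
    · intro y
      simp only [Nat.not_lt_zero, false_and, exists_false, iff_false]
      exact fun h => hPa _ h rfl
  · rintro i T s' hF ⟨hi', P', hPP', hT, hI, hnew, hPi, hin⟩ hb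
    have f : ∀ b, b ∉ linkVertex.nats → s'.nat b = s.nat b := fun b h => by
      have h1 : b ≠ 32 := fun h' => h (by subst h'; exact List.mem_cons_self)
      rw [hF.1 b fun h' => h (List.mem_cons_of_mem _ h'), hs0, State.setNat_nat_of_ne _ h1]
    have g := hF.2
    rw [hs0, State.setNat_real] at g
    simp only [BExpr.holds, nv, rv, NExpr.eval, RExpr.eval, hi', f 0 (by decide),
      f 24 (by decide), f 25 (by decide), f 31 (by decide),
      f 7 (by decide), g 17 (by decide), g 0 (by decide), g 2 (by decide), hn, hu, hv,
      hc, ha, not_lt] at hb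
    obtain ⟨hin', hle⟩ := hb
    refine ⟨hin', ?_⟩
    set y := s.nat 7 v i with hy
    have hyn : y < n := ho.lt hin'
    have hbxy : box a y := hle
    refine run_seq (run_setNat ?_)
    simp only [nv, NExpr.eval, NExpr.cost, hi', f 25 (by decide),
      f 7 (by decide), hv, ← hy]
    set s1 := s'.setNat 33 0 0 y with hs1
    have f1 : ∀ b, b ≠ 33 → s1.nat b = s'.nat b := fun b h => State.setNat_nat_of_ne _ h
    refine run_seq (run_frame ((run_insertLink s1 (n := n) (m := m) (x₀ := a) (y₀ := y) ?_
      (by decide) (by decide) ?_ ?_ hyn ?_ ?_).mono ?_))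
    · rw [f1 _ (by decide), f 0 (by decide), hn]
    · rw [f1 _ (by decide), f 31 (by decide), ha]
    · simp [hs1]
    · rw [f1 _ (by decide)]
      exact hI.closure.isHopDist hH
    · rw [f1 _ (by decide), hs1, State.setNat_real, g 2 (by decide)]
      exact hI.nearest
    rintro T1 s2 ⟨hT1, hH1, hM1⟩ hF1
    have f2 := hF1.1
    have g2 := hF1.2
    have g1 : s1.real 2 = s.real 2 := by rw [hs1, State.setNat_real, g 2 (by decide)]
    rw [f1 6 (by decide)] at hT1 hH1
    rw [g1] at hM1
    have hcl1 : LinkClosure n box H (s2.nat 6) := hH1 ▸ hI.closure.insert han hyn (Or.inl hbxy)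
    refine run_seq (run_frame ((run_insertLink s2 (n := n) (m := m) (x₀ := y) (y₀ := a) ?_
      (by decide) (by decide) ?_ ?_ han ?_ ?_).mono ?_))
    · rw [f2 _ (by decide), f1 _ (by decide), f 0 (by decide), hn]
    · rw [f2 _ (by decide)]; simp [hs1]
    · rw [f2 _ (by decide), f1 _ (by decide), f 31 (by decide), ha]
    · exact hcl1.isHopDist hH
    · rw [g2 2 (by decide), g1]
      exact hM1
    rintro T2 s3 ⟨hT2, hH2, hM2⟩ hF2
    have f3 := hF2.1
    rw [g2 2 (by decide), g1] at hM2
    have hcl2 : LinkClosure n box H (s3.nat 6) := hH2 ▸ hcl1.insert hyn han (Or.inr hbxy)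
    refine run_setNat ?_
    have h32 : s3.nat 32 0 0 = i := by
      rw [f3 _ (by decide), f2 _ (by decide), f1 _ (by decide), hi']
    simp only [NExpr.eval, NExpr.cost, BExpr.cost, RExpr.cost, rv, h32, State.setNat_real]
    rw [State.setNat_nat_of_ne _ (show 6 ≠ 32 by decide)]
    have hay : (a, y) ∉ P' := fun h => by
      obtain ⟨i', hii', he⟩ := (hPi y).mp h
      have := ho.inj (by omega) hin' he
      omega
    refine ⟨by simp, insert (a, y) P', hPP'.trans (Finset.subset_insert _ _), ?_, ?_, ?_, ?_, hin'⟩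
    · rw [Finset.card_insert_of_notMem hay, add_mul]
      have : 0 < n := by omega
      omega
    · have hle1 : ∀ x y, s2.nat 6 x y ≤ s'.nat 6 x y := fun x y => by
        rw [hH1]; exact hopInsert_le _ _ _ _ _ _
      have hle2 : ∀ x y, s3.nat 6 x y ≤ s2.nat 6 x y := fun x y => by
        rw [hH2]; exact hopInsert_le _ _ _ _ _ _
      refine ⟨hcl2, hM2, ?_, ?_, ?_⟩
      · intro q hq
        rcases Finset.mem_insert.mp hq with rfl | hq
        · exact ⟨han, hyn⟩
        · exact hI.lt q hq
      · intro q hq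
        rcases Finset.mem_insert.mp hq with rfl | hq
        · exact hbxy
        · exact hI.box q hq
      · intro q hq
        rcases Finset.mem_insert.mp hq with rfl | hq
        · refine ⟨(hle2 _ _).trans ?_, ?_⟩
          · rw [hH1]
            exact hopInsert_self_le_one (hI.closure.isHopDist hH) han hyn
          · rw [hH2]
            exact hopInsert_self_le_one (hcl1.isHopDist hH) hyn han
        · have := hI.le_one q hq
          exact ⟨(hle2 _ _).trans ((hle1 _ _).trans this.1),
            (hle2 _ _).trans ((hle1 _ _).trans this.2)⟩
    · intro q hq hqa
      rcases Finset.mem_insert.mp hq with rfl | hq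
      · exact absurd rfl hqa
      · exact hnew q hq hqa
    · intro y'
      rw [Finset.mem_insert, hPi]
      constructor
      · rintro (h | ⟨i', h1, h2⟩)
        · exact ⟨i, by omega, (Prod.ext_iff.mp h).2.symm⟩
        · exact ⟨i', by omega, h2⟩
      · rintro ⟨i', h1, h2⟩
        rcases Nat.lt_succ_iff_lt_or_eq.mp h1 with h | rfl
        · exact Or.inr ⟨i', h, h2⟩
        · exact Or.inl (by rw [← h2])
  · rintro i T s' hF ⟨hi', P', hPP', hT, hI, hnew, hPi, hin⟩ hb
    have f : ∀ b, b ∉ linkVertex.nats → s'.nat b = s.nat b := fun b h => by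
      have h1 : b ≠ 32 := fun h' => h (by subst h'; exact List.mem_cons_self)
      rw [hF.1 b fun h' => h (List.mem_cons_of_mem _ h'), hs0, State.setNat_nat_of_ne _ h1]
    have g := hF.2
    rw [hs0, State.setNat_real] at g
    simp only [BExpr.holds, nv, rv, NExpr.eval, RExpr.eval, hi', f 0 (by decide),
      f 24 (by decide), f 25 (by decide), f 31 (by decide),
      f 7 (by decide), g 17 (by decide), g 0 (by decide), g 2 (by decide), hn, hu, hv,
      hc, ha, not_lt, not_and] at hb
    refine ⟨P', hPP', ?_, hI, hnew, ?_⟩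
    · simp only [nv, NExpr.cost, BExpr.cost, RExpr.cost, rv]
      omega
    · intro y hy hle
      obtain ⟨i', hi'n, rfl⟩ := ho.exists_eq hy
      refine (hPi _).mpr ⟨i', ?_, rfl⟩
      -- the vertices after the first one outside the box are outside the box as well
      by_contra hlt
      have h1 := ho.mono (not_lt.mp hlt) hi'n
      exact hb (by omega) (by linarith)

/-- The amortised cost of linking the box of a new edge. All pairs in the box have hop distance at
least `2` before and at most `1` afterwards, so that the number of insertions is bounded by the
decrease of the sum of the hop distances. -/
theorem run_linkBox (s : State) {n m u v : ℕ} {c : ℝ} (hn : s.nat 0 0 0 = n)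
    (hH : IsHopDist n m (s.nat 6)) (hu : s.nat 24 0 0 = u) (hv : s.nat 25 0 0 = v)
    (hc : s.real 17 0 0 * s.real 0 u v = c) (ho : IsRowSorted n (s.real 2 v) (s.nat 7 v))
    (hM : IsNearest n m (s.real 2) (s.nat 6) (s.real 4))
    (hfar : ∀ x < n, ∀ y < n, s.real 2 u x + s.real 2 v y ≤ c → 2 ≤ s.nat 6 x y) :
    Run linkBox s fun T s' => T + 311 * n * entrySum n (s'.nat 6) ≤
        61 * n + 12 + 311 * n * entrySum n (s.nat 6) ∧
      LinkClosure n (fun x y => s.real 2 u x + s.real 2 v y ≤ c) (s.nat 6) (s'.nat 6) ∧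
      IsNearest n m (s.real 2) (s'.nat 6) (s'.real 4) ∧
      ∀ x < n, ∀ y < n, s.real 2 u x + s.real 2 v y ≤ c → s'.nat 6 x y ≤ 1 ∧ s'.nat 6 y x ≤ 1 := by
  set box : ℕ → ℕ → Prop := fun x y => s.real 2 u x + s.real 2 v y ≤ c with hbox
  refine run_forLoop n (fun a T s' => ∃ P : Finset (ℕ × ℕ),
      T + 112 * n * entrySum n (s'.nat 6) ≤
        61 * a + P.card * (199 * n) + 112 * n * entrySum n (s.nat 6) ∧
      BoxInv n m box (s.real 2) (s.nat 6) P (s'.nat 6) (s'.real 4) ∧ (∀ q ∈ P, q.1 < a) ∧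
      ∀ x < a, ∀ y < n, box x y → (x, y) ∈ P) hn (by decide) (by decide) (by decide)
      (fun _ _ _ _ h => h) ?_ ?_ ?_
  · exact ⟨∅, by simp, ⟨.refl, hM, by simp, by simp, by simp⟩, by simp, by simp⟩
  · rintro a T s' ha hF haa ⟨P, hT, hI, hPa, hPb⟩
    have f := hF.1
    have g := hF.2
    have g2 := g 2 (by decide)
    refine (run_linkVertex s' (n := n) (m := m) (u := u) (v := v) (a := a) (c := c) (P := P) ?_ hH
      ?_ ?_ ?_ ?_ ?_ haa ha fun q hq => (hPa q hq).ne).mono ?_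
    · rw [f 0 (by decide), hn]
    · rw [f 24 (by decide), hu]
    · rw [f 25 (by decide), hv]
    · rw [g 17 (by decide), g 0 (by decide), hc]
    · rw [g2, f 7 (by decide)]; exact ho
    · rw [g2]; exact hI
    · rintro T' s'' ⟨P', hPP', hT', hI', hnew, hall⟩
      rw [g2] at hI' hall
      refine ⟨P', by omega, hI', ?_, ?_⟩
      · intro q hq
        by_cases h : q.1 = a
        · omega
        · have := hPa q (hnew q hq h)
          omega
      · intro x hx y hy hxy
        rcases Nat.lt_succ_iff_lt_or_eq.mp hx with h | rfl
        · exact hPP' (hPb x h y hy hxy)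
        · exact hall y hy hxy
  · rintro T s' hF ⟨P, hT, hI, hPa, hPb⟩
    refine ⟨?_, hI.closure, hI.nearest, fun x hx y hy hxy => hI.le_one _ (hPb x hx y hy hxy)⟩
    have hcard : P.card + entrySum n (s'.nat 6) ≤ entrySum n (s.nat 6) := by
      refine card_add_entrySum_le (fun x y => hI.closure.le x y) fun q hq => ?_
      have h1 := hI.lt q hq
      have h2 := hfar _ h1.1 _ h1.2 (hI.box q hq)
      have h3 := (hI.le_one q hq).1
      exact ⟨h1.1, h1.2, by omega⟩
    have h4 := Nat.mul_le_mul_right (199 * n) hcard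
    have h5 : (P.card + entrySum n (s'.nat 6)) * (199 * n) =
      P.card * (199 * n) + 199 * (n * entrySum n (s'.nat 6)) := by ring
    have h6 : entrySum n (s.nat 6) * (199 * n) = 199 * (n * entrySum n (s.nat 6)) := by ring
    have h7 : ∀ (c e : ℕ), c * n * e = c * (n * e) := fun c e => mul_assoc _ _ _
    rw [h7, h7] at hT ⊢
    omega

end RealRAM

/-! ### The program for a given dilation -/

namespace MetricGraph

theorem edgesOf_congr {n : ℕ} {S S' : ℕ → ℕ → ℕ} (h : ∀ x < n, ∀ y < n, S x y = S' x y) :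
    edgesOf n S = edgesOf n S' := by
  ext u v
  rw [edgesOf, edgesOf, SimpleGraph.fromRel_adj, SimpleGraph.fromRel_adj, h u u.2 v v.2,
    h v v.2 u u.2]

end MetricGraph

namespace RealRAM

open MetricGraph

variable {M : Type*} [MetricSpace M] {n : ℕ} {p : Fin n ↪ M} {G : SimpleGraph (Fin n)}
  {k r : ℕ} {t B : ℝ} {D : ℕ → ℕ → ℝ} {eu ev : ℕ → ℕ}

/-- The memory contains the graph distances (in the real array `2`), the vertices sorted by their
graph distance from any given vertex (in the rows of the integer array `7`), and all pairs of
vertices sorted by their distance (in the first columns of the integer arrays `10` and `11`). -/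
structure Prepared (p : Fin n ↪ M) (G : SimpleGraph (Fin n)) (k r : ℕ) (B : ℝ) (D : ℕ → ℕ → ℝ)
    (eu ev : ℕ → ℕ) (s : State) : Prop where
  nat_n : s.nat 0 0 0 = n
  nat_k : s.nat 1 0 0 = k
  nat_r : s.nat 2 0 0 = r
  nat_sq : s.nat 28 0 0 = n * n
  dist : s.real 0 = distMatrix p
  graph : s.real 2 = D
  isGraphDist : IsGraphDist p G D B
  row : ∀ v < n, IsRowSorted n (D v) (s.nat 7 v)
  fst : ∀ i, s.nat 10 i 0 = eu i
  snd : ∀ i, s.nat 11 i 0 = ev i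
  sorted : IsSortedPairs n (n * n) (distMatrix p) eu ev

theorem Prepared.of_frame {s s' : State} {K L : List ℕ} (h : Prepared p G k r B D eu ev s)
    (hF : Frame K L s s') (hK : ∀ a ∈ [0, 1, 2, 28, 7, 10, 11], a ∉ K) (hL : ∀ a ∈ [0, 2], a ∉ L) :
    Prepared p G k r B D eu ev s' where
  nat_n := by rw [hF.1 _ (hK _ (by decide)), h.nat_n]
  nat_k := by rw [hF.1 _ (hK _ (by decide)), h.nat_k]
  nat_r := by rw [hF.1 _ (hK _ (by decide)), h.nat_r]
  nat_sq := by rw [hF.1 _ (hK _ (by decide)), h.nat_sq]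
  dist := by rw [hF.2 _ (hL _ (by decide)), h.dist]
  graph := by rw [hF.2 _ (hL _ (by decide)), h.graph]
  isGraphDist := h.isGraphDist
  row := by rw [hF.1 _ (hK _ (by decide))]; exact h.row
  fst := by rw [hF.1 _ (hK _ (by decide))]; exact h.fst
  snd := by rw [hF.1 _ (hK _ (by decide))]; exact h.snd
  sorted := h.sorted

/-- The state of the greedy algorithm after `q` pairs. -/
structure GreedyState (p : Fin n ↪ M) (G : SimpleGraph (Fin n)) (k r : ℕ) (t B : ℝ)
    (D : ℕ → ℕ → ℝ) (eu ev : ℕ → ℕ) (q : ℕ) (s : State) : Prop where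
  prepared : Prepared p G k r B D eu ev s
  stretch : s.real 16 0 0 = 2 * r * t
  radius : s.real 17 0 0 = linkRadius r t
  inv : GreedyInv p G k r t B (n * n) eu ev q (s.nat 6) (s.nat 5) (s.nat 29 0 0)
  nearest : IsNearest n (2 * r) D (s.nat 6) (s.real 4)
  detour : IsDetour p D (2 * r * t) (s.real 5)

/-- Disjunction of tests. -/
def orB (b c : BExpr) : BExpr := .neg (.conj (.neg b) (.neg c))

@[simp]
theorem holds_orB (s : State) (b c : BExpr) : (orB b c).holds s ↔ b.holds s ∨ c.holds s := by
  simp [orB, or_iff_not_imp_left]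

@[simp]
theorem cost_orB (b c : BExpr) : (orB b c).cost = b.cost + c.cost + 4 := by
  simp [orB]; ring

/-- Program for `MetricGraph.IsRejected`; the result is stored in the integer array `27`. -/
def testPair : Cmd :=
  .seq (setN 27 (.lit 0)) (forLoop 26 0 (.cond
    (orB (.neg (.realLt (.mul (rv 17) (.get 0 (nv 24) (nv 25)))
        (.add (.get 4 (nv 24) (nv 26)) (.get 2 (nv 25) (nv 26)))))
      (.realLt (.add (.get 5 (nv 24) (nv 26)) (.get 2 (nv 25) (nv 26)))
        (.mul (rv 16) (.get 0 (nv 24) (nv 25)))))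
    (setN 27 (.lit 1)) .skip))

theorem run_testPair (s : State) {q u v : ℕ} (h : GreedyState p G k r t B D eu ev q s)
    (hu : s.nat 24 0 0 = u) (hv : s.nat 25 0 0 = v) :
    Run testPair s fun T s' => T ≤ 80 * n + 16 ∧ (s'.nat 27 0 0 = 0 ↔
      ¬ IsRejected p D (linkRadius r t) (2 * r * t) (s.real 4) (s.real 5) u v) := by
  refine run_seq (run_setNat ?_)
  simp only [NExpr.eval, NExpr.cost]
  refine run_forLoop_le n 64 (fun j s' => s'.nat 27 0 0 = 0 ↔ ¬ ∃ c < j,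
    s.real 4 u c + D v c ≤ linkRadius r t * distMatrix p u v ∨
      s.real 5 u c + D v c < 2 * r * t * distMatrix p u v) ?_ (by decide) (by decide) (by decide)
    (fun _ _ _ h => h) (by simp) ?_ ?_
  · rw [State.setNat_nat_of_ne _ (by decide), h.prepared.nat_n]
  · intro j s' hj hF hij hI
    have f : ∀ b, b ∉ [26, 27] → s'.nat b = s.nat b := fun b hb => by
      simp only [List.mem_cons, List.not_mem_nil, or_false, not_or] at hb
      rw [hF.1 b (by simp [Cmd.nats, hb]), State.setNat_nat_of_ne _ hb.2]
    have g := hF.2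
    rw [State.setNat_real] at g
    have key : BExpr.holds s' (orB (.neg (.realLt (.mul (rv 17) (.get 0 (nv 24) (nv 25)))
        (.add (.get 4 (nv 24) (nv 26)) (.get 2 (nv 25) (nv 26)))))
      (.realLt (.add (.get 5 (nv 24) (nv 26)) (.get 2 (nv 25) (nv 26)))
        (.mul (rv 16) (.get 0 (nv 24) (nv 25))))) ↔
        s.real 4 u j + D v j ≤ linkRadius r t * distMatrix p u v ∨
          s.real 5 u j + D v j < 2 * r * t * distMatrix p u v := by
      rw [holds_orB]
      simp only [BExpr.holds, RExpr.eval, rv, nv, NExpr.eval, hij, f 24 (by decide),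
        f 25 (by decide), hu, hv, g 17 (by decide), g 16 (by decide), g 0 (by decide),
        g 4 (by decide), g 2 (by decide), g 5 (by decide), h.stretch, h.radius,
        h.prepared.dist, h.prepared.graph, not_lt]
    refine run_cond (fun hc => run_setNat ?_) (fun hc => run_skip ?_)
    · rw [key] at hc
      refine ⟨by simp, ?_⟩
      simp only [NExpr.eval, State.setNat_nat_apply, and_self, if_true, one_ne_zero, false_iff,
        not_not]
      exact ⟨j, by omega, hc⟩
    · rw [key] at hc
      refine ⟨by simp, hI.trans (not_congr (exists_congr fun c => ?_))⟩
      constructor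
      · rintro ⟨h1, h2⟩
        exact ⟨by omega, h2⟩
      · rintro ⟨h1, h2⟩
        rcases Nat.lt_succ_iff_lt_or_eq.mp h1 with h3 | rfl
        · exact ⟨h3, h2⟩
        · exact absurd h2 hc
  · intro T s' hT hF hI
    exact ⟨by omega, hI⟩

/-- Program for one step of the greedy algorithm. -/
def greedyStep : Cmd :=
  .seq (setN 24 (.get 10 (nv 23) (.lit 0))) (.seq (setN 25 (.get 11 (nv 23) (.lit 0)))
    (.seq testPair (.cond (.natLt (nv 27) (.lit 1))
      (.seq (.setNat 5 (nv 24) (nv 25) (.lit 1)) (.seq (setN 29 (.add (nv 29) (.lit 1))) linkBox))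
      .skip)))

theorem run_greedyStep (s : State) {q : ℕ} (h : GreedyState p G k r t B D eu ev q s)
    (hr : 1 ≤ r) (ht : 1 ≤ t) (hq : q < n * n) (hqs : s.nat 23 0 0 = q) :
    Run greedyStep s fun T s' => T + 311 * n * entrySum n (s'.nat 6) ≤
        141 * n + 66 + 311 * n * entrySum n (s.nat 6) ∧
      GreedyState p G k r t B D eu ev (q + 1) s' := by
  have hun := h.prepared.sorted.fst_lt hq
  have hvn := h.prepared.sorted.snd_lt hq
  refine run_seq (run_setNat (run_seq (run_setNat ?_)))
  simp only [nv, NExpr.eval, NExpr.cost, hqs, State.setNat_nat_apply]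
  norm_num only [hqs, and_self, false_and, if_false, h.prepared.fst, h.prepared.snd]
  set s1 := (s.setNat 24 0 0 (eu q)).setNat 25 0 0 (ev q) with hs1
  have f1 : ∀ a, a ∉ [24, 25] → s1.nat a = s.nat a := fun a ha => by
    simp only [List.mem_cons, List.not_mem_nil, or_false, not_or] at ha
    rw [hs1, State.setNat_nat_of_ne _ ha.2, State.setNat_nat_of_ne _ ha.1]
  have hF1 : Frame [24, 25] [] s s1 := ⟨f1, fun _ _ => rfl⟩
  have h1 : GreedyState p G k r t B D eu ev q s1 :=
    ⟨h.prepared.of_frame hF1 (by decide) (by decide), h.stretch, h.radius, h.inv, h.nearest,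
      h.detour⟩
  have hu1 : s1.nat 24 0 0 = eu q := by simp [hs1]
  have hv1 : s1.nat 25 0 0 = ev q := by simp [hs1]
  refine run_seq (run_frame ((run_testPair s1 h1 hu1 hv1).mono ?_))
  rintro T2 s2 ⟨hT2, hrej⟩ hF2
  have g5 : s2.real 5 = s.real 5 := hF2.2 5 (by decide)
  have g4 : s2.real 4 = s.real 4 := hF2.2 4 (by decide)
  have f6 : s2.nat 6 = s.nat 6 := (hF2.1 6 (by decide)).trans (f1 6 (by decide))
  have f5 : s2.nat 5 = s.nat 5 := (hF2.1 5 (by decide)).trans (f1 5 (by decide))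
  have f29 : s2.nat 29 = s.nat 29 := (hF2.1 29 (by decide)).trans (f1 29 (by decide))
  have hp2 : Prepared p G k r B D eu ev s2 := h1.prepared.of_frame hF2 (by decide) (by decide)
  have hst2 : s2.real 16 0 0 = 2 * r * t := by rw [hF2.2 16 (by decide), h1.stretch]
  have hra2 : s2.real 17 0 0 = linkRadius r t := by rw [hF2.2 17 (by decide), h1.radius]
  have hu2 : s2.nat 24 0 0 = eu q := by rw [hF2.1 24 (by decide), hu1]
  have hv2 : s2.nat 25 0 0 = ev q := by rw [hF2.1 25 (by decide), hv1]
  refine run_cond (fun hc => ?_) (fun hc => run_skip ?_)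
  · simp only [BExpr.holds, NExpr.eval, Nat.lt_one_iff] at hc
    have hnr := hrej.mp hc
    refine run_seq (run_setNat (run_seq (run_setNat ?_)))
    simp only [NExpr.eval, NExpr.cost, BExpr.cost, hu2, hv2]
    rw [State.setNat_nat_of_ne _ (show 29 ≠ 5 by decide), f29]
    set s3 := (s2.setNat 5 (eu q) (ev q) 1).setNat 29 0 0 (s.nat 29 0 0 + 1) with hs3
    have f3 : ∀ a, a ∉ [5, 29] → s3.nat a = s2.nat a := fun a ha => by
      simp only [List.mem_cons, List.not_mem_nil, or_false, not_or] at ha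
      rw [hs3, State.setNat_nat_of_ne _ ha.2, State.setNat_nat_of_ne _ ha.1]
    have hF3 : Frame [5, 29] [] s2 s3 := ⟨f3, fun _ _ => rfl⟩
    have hp3 := hp2.of_frame hF3 (by decide) (by decide)
    have f36 : s3.nat 6 = s.nat 6 := (f3 6 (by decide)).trans f6
    have g3 : s3.real = s2.real := rfl
    refine run_frame ((run_linkBox s3 (n := n) (m := 2 * r) (u := eu q) (v := ev q)
      (c := linkRadius r t * distMatrix p (eu q) (ev q)) hp3.nat_n ?_ ?_ ?_ ?_ ?_ ?_ ?_).mono ?_)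
    · rw [f36]; exact h.inv.hop
    · rw [f3 24 (by decide), hu2]
    · rw [f3 25 (by decide), hv2]
    · rw [hp3.dist, g3, hra2]
    · rw [hp3.graph]; exact hp3.row _ hvn
    · rw [hp3.graph, f36, g3, g4]; exact h.nearest
    · intro x hx y hy hxy
      rw [hp3.graph] at hxy
      rw [f36]
      by_contra hlt
      refine hnr ⟨y, hy, Or.inl ?_⟩
      have := h.nearest.le hun hx hy (by omega : s.nat 6 x y < 2 * r)
      change s.real 4 (eu q) y + _ ≤ _
      linarith
    rintro T4 s4 ⟨hT4, hcl, hM, hbox⟩ hF4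
    rw [hp3.graph, f36] at hcl
    rw [hp3.graph] at hM hbox
    rw [f36] at hT4
    have hp4 := hp3.of_frame hF4 (by decide) (by decide)
    refine ⟨by omega, hp4, ?_, ?_, ?_, hM, ?_⟩
    · rw [hF4.2 16 (by decide), g3, hst2]
    · rw [hF4.2 17 (by decide), g3, hra2]
    · have e5 : s4.nat 5 = mark (s.nat 5) (eu q) (ev q) := by
        rw [hF4.1 5 (by decide), hs3, State.setNat_nat_of_ne _ (by decide)]
        funext x y
        rw [State.setNat_nat_apply, mark, f5]
        simp
      have e29 : s4.nat 29 0 0 = s.nat 29 0 0 + 1 := by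
        rw [hF4.1 29 (by decide)]
        simp [hs3]
      rw [e5, e29]
      exact h.inv.accept hp3.isGraphDist hr ht hp3.sorted hq h.nearest h.detour hnr hcl
        fun x y hx hy => hbox x hx y hy
    · rw [hF4.2 5 (by decide), g3, g5]
      exact h.detour
  · simp only [BExpr.holds, NExpr.eval, Nat.lt_one_iff] at hc
    have hrej' := not_not.mp fun hn => hc (hrej.mpr hn)
    refine ⟨?_, hp2, hst2, hra2, ?_, ?_, ?_⟩
    · simp only [NExpr.cost, BExpr.cost, f6]
      omega
    · rw [f6, f5, f29]
      exact h.inv.reject hp2.isGraphDist hr ht hp2.sorted hq h.nearest h.detour hrej'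
    · rw [f6, g4]; exact h.nearest
    · rw [g5]; exact h.detour

/-- Program for the parameters of the greedy algorithm; the dilation aimed at is in the cell `(0, 0)`
of the real array `15`. -/
def initParameters : Cmd :=
  .seq (setR 16 (.mul (.mul (.ofNat (.lit 2)) (.ofNat (nv 2))) (rv 15)))
    (.seq (setR 17 (.add (.sub (rv 15) (.ofNat (.lit 1)))
      (.div (.ofNat (.lit 1)) (.mul (.ofNat (.lit 2)) (.ofNat (nv 2)))))) (setN 29 (.lit 0)))

/-- Program for the initial matrices of the greedy algorithm. -/
def initMatrices : Cmd :=
  forLoop2 20 21 0 (.seq (.setNat 5 (nv 20) (nv 21) (.lit 0))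
    (.seq (.cond (.conj (.neg (.natLt (nv 20) (nv 21))) (.neg (.natLt (nv 21) (nv 20))))
        (.setNat 6 (nv 20) (nv 21) (.lit 0)) (.setNat 6 (nv 20) (nv 21) (.add (nv 2) (nv 2))))
      (.seq (.setReal 4 (nv 20) (nv 21) (.get 2 (nv 20) (nv 21)))
        (.setReal 5 (nv 20) (nv 21) (.get 2 (nv 20) (nv 21))))))

theorem run_initMatrices (s : State) (h : Prepared p G k r B D eu ev s) :
    Run initMatrices s fun T s' => T ≤ n * (n * 88 + 28) + 12 ∧ ∀ x < n, ∀ y < n,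
      s'.nat 5 x y = 0 ∧ (s'.nat 6 x y = if x = y then 0 else 2 * r) ∧ s'.real 4 x y = D x y ∧
      s'.real 5 x y = D x y := by
  refine run_forLoop2 (fun s x y => (s.nat 5 x y, s.nat 6 x y, s.real 4 x y, s.real 5 x y)) n 72
    (fun x y => (0, if x = y then 0 else 2 * r, D x y, D x y)) h.nat_n (by decide) (by decide)
    (by decide) ?_ ?_ ?_
  · intro a ha s' v
    simp only [List.mem_cons, List.not_mem_nil, or_false] at ha
    rcases ha with rfl | rfl <;> rfl
  · intro x y s' hx hy hF hi hj _ _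
    have hp : Prepared p G k r B D eu ev s' := h.of_frame hF (by decide) (by decide)
    refine run_seq (run_setNat (run_seq (run_cond (fun hc => run_setNat (run_seq (run_setReal
      (run_setReal ?_)))) (fun hc => run_setNat (run_seq (run_setReal (run_setReal ?_)))))))
    · have hxy : x = y := by
        simp [hi, hj] at hc
        omega
      refine ⟨by simp, fun x' y' => ?_⟩
      simp only [nv, NExpr.eval, RExpr.eval, State.setReal_nat, State.setNat_real,
        State.setNat_nat_apply, State.setReal_real_apply, hi, hj, hp.graph]
      norm_num only [hi, hj, and_self, false_and, true_and, if_false]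
      by_cases hc' : x' = x ∧ y' = y
      · simp [hc'.1, hc'.2, hxy]
      · simp only [if_neg hc']
    · have hxy : x ≠ y := by
        simp [hi, hj] at hc
        omega
      refine ⟨by simp, fun x' y' => ?_⟩
      simp only [nv, NExpr.eval, RExpr.eval, State.setReal_nat, State.setNat_real,
        State.setNat_nat_apply, State.setReal_real_apply, hi, hj, hp.graph]
      norm_num only [hi, hj, and_self, false_and, true_and, if_false, hp.nat_r]
      by_cases hc' : x' = x ∧ y' = y
      · simp [hc'.1, hc'.2, hxy, two_mul]
      · simp only [if_neg hc']
  · intro T s' hT _ harr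
    refine ⟨hT, fun x hx y hy => ?_⟩
    have := congrFun (congrFun harr x) y
    rw [if_pos ⟨hx, hy⟩, Prod.mk.injEq, Prod.mk.injEq, Prod.mk.injEq] at this
    exact this

/-- Program for `MetricGraph.IsDetour`. -/
def detour : Cmd :=
  forLoop 22 0 (forLoop2 20 21 0 (.cond
    (.realLt (.add (.get 2 (nv 20) (nv 22)) (.mul (rv 16) (.get 0 (nv 22) (nv 21))))
      (.get 5 (nv 20) (nv 21)))
    (.setReal 5 (nv 20) (nv 21)
      (.add (.get 2 (nv 20) (nv 22)) (.mul (rv 16) (.get 0 (nv 22) (nv 21))))) .skip))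

theorem run_detour (s : State) (h : Prepared p G k r B D eu ev s) {g : ℝ}
    (hg : s.real 16 0 0 = g) (h5 : ∀ x < n, ∀ y < n, s.real 5 x y = D x y) :
    Run detour s fun T s' => T ≤ n * (n * (n * 100 + 28) + 28) + 12 ∧ IsDetour p D g (s'.real 5) := by
  refine run_forLoop_le n (n * (n * 100 + 28) + 12) (fun m s' => ∀ x < n, ∀ y < n,
      (∀ a < m, s'.real 5 x y ≤ D x a + g * distMatrix p a y) ∧
      ∃ a < n, s'.real 5 x y = D x a + g * distMatrix p a y) h.nat_n (by decide) (by decide)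
      (by decide) (fun _ _ _ h => h) ?_ ?_ ?_
  · intro x hx y hy
    refine ⟨by simp, y, hy, ?_⟩
    rw [h5 x hx y hy, distMatrix_self, mul_zero, add_zero]
  · intro m s' hm hF hms hI
    have hp : Prepared p G k r B D eu ev s' := h.of_frame hF (by decide) (by decide)
    have hg' : s'.real 16 0 0 = g := by rw [hF.2 16 (by decide), hg]
    refine run_forLoop2 (fun s => s.real 5) n 84
      (fun x y => min (s'.real 5 x y) (D x m + g * distMatrix p m y)) hp.nat_n (by decide)
      (by decide) (by decide) (fun _ _ _ _ => rfl) ?_ ?_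
    · intro x y s'' hx hy hF' hi hj hxy _
      have hp' : Prepared p G k r B D eu ev s'' := hp.of_frame hF' (by decide) (by decide)
      have e1 : s''.real 16 0 0 = g := by rw [hF'.2 16 (by decide), hg']
      have e2 : s''.nat 22 0 0 = m := by rw [hF'.1 22 (by decide), hms]
      refine run_cond (fun hc => run_setReal ?_) (fun hc => run_skip ?_)
      · simp only [BExpr.holds, RExpr.eval, nv, rv, NExpr.eval, hi, hj, hp'.graph, hp'.dist, e1, e2,
          hxy] at hc
        refine ⟨by simp, fun x' y' => ?_⟩
        simp only [RExpr.eval, nv, rv, NExpr.eval, hi, hj, hp'.graph, hp'.dist, e1, e2,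
          State.setReal_real_apply, true_and]
        rw [min_eq_right hc.le]
      · simp only [BExpr.holds, RExpr.eval, nv, rv, NExpr.eval, hi, hj, hp'.graph, hp'.dist, e1, e2,
          hxy, not_lt] at hc
        refine ⟨by simp, fun x' y' => ?_⟩
        split_ifs with h'
        · rw [h'.1, h'.2, hxy, min_eq_left hc]
        · rfl
    · intro T s'' hT _ h5'
      refine ⟨hT, fun x hx y hy => ?_⟩
      obtain ⟨h1, a, ha, h2⟩ := hI x hx y hy
      simp only [h5', hx, hy, and_self, if_true]
      constructor
      · intro a' ha'
        rcases Nat.lt_succ_iff_lt_or_eq.mp ha' with h3 | rfl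
        · exact (min_le_left _ _).trans (h1 a' h3)
        · exact min_le_right _ _
      · rcases min_choice (s'.real 5 x y) (D x m + g * distMatrix p m y) with hc | hc <;> rw [hc]
        · exact ⟨a, ha, h2⟩
        · exact ⟨m, hm, rfl⟩
  · intro T s' hT _ hI
    exact ⟨hT, fun hx ha hy => (hI _ hx _ hy).1 _ ha, fun hx hy => (hI _ hx _ hy).2⟩

/-- Program for the greedy algorithm. -/
def greedy : Cmd :=
  .seq initParameters (.seq initMatrices (.seq detour (forLoop 23 28 greedyStep)))

theorem run_greedy (s : State) (h : Prepared p G k r B D eu ev s) (hr : 1 ≤ r) (ht : 1 ≤ t)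
    (hn : 1 ≤ n) (hts : s.real 15 0 0 = t) :
    Run greedy s fun T s' => T ≤ (1000 * r) * n ^ 3 + 500 * n ^ 3 ∧
      GreedyState p G k r t B D eu ev (n * n) s' := by
  refine run_seq (run_seq (run_setReal (run_seq (run_setReal (run_setNat ?_)))))
  simp only [nv, rv, NExpr.eval, NExpr.cost, RExpr.eval, RExpr.cost, State.setReal_nat, h.nat_r, hts,
    State.setReal_real_apply]
  norm_num only [hts, and_self, false_and, if_false]
  set s1 := ((s.setReal 16 0 0 (2 * r * t)).setReal 17 0 0 (t - 1 + 1 / (2 * r))).setNat 29 0 0 0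
    with hs1
  have hF1 : Frame [29] [16, 17] s s1 := by
    refine ⟨fun a ha => State.setNat_nat_of_ne _ (by simpa using ha), fun a ha => ?_⟩
    simp only [List.mem_cons, List.not_mem_nil, or_false, not_or] at ha
    rw [hs1, State.setNat_real, State.setReal_real_of_ne _ ha.2, State.setReal_real_of_ne _ ha.1]
  have hp1 : Prepared p G k r B D eu ev s1 := h.of_frame hF1 (by decide) (by decide)
  have hg1 : s1.real 16 0 0 = 2 * r * t := by simp [hs1]
  have hx1 : s1.real 17 0 0 = linkRadius r t := by simp [hs1, linkRadius]
  have hc1 : s1.nat 29 0 0 = 0 := by simp [hs1]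
  refine run_seq (run_frame ((run_initMatrices s1 hp1).mono ?_))
  rintro T2 s2 ⟨hT2, hinit⟩ hF2
  have hp2 := hp1.of_frame hF2 (by decide) (by decide)
  have hg2 : s2.real 16 0 0 = 2 * r * t := by rw [hF2.2 16 (by decide), hg1]
  refine run_seq (run_frame ((run_detour s2 hp2 hg2 fun x hx y hy => (hinit x hx y hy).2.2.2).mono
    ?_))
  rintro T3 s3 ⟨hT3, hdet⟩ hF3
  have hp3 := hp2.of_frame hF3 (by decide) (by decide)
  have f5 : s3.nat 5 = s2.nat 5 := hF3.1 5 (by decide)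
  have f6 : s3.nat 6 = s2.nat 6 := hF3.1 6 (by decide)
  have g4 : s3.real 4 = s2.real 4 := hF3.2 4 (by decide)
  have hst : GreedyState p G k r t B D eu ev 0 s3 := by
    refine ⟨hp3, ?_, ?_, ?_, ?_, hdet⟩
    · rw [hF3.2 16 (by decide), hg2]
    · rw [hF3.2 17 (by decide), hF2.2 17 (by decide), hx1]
    · rw [hF3.1 29 (by decide), hF2.1 29 (by decide), hc1, f5, f6]
      exact greedyInv_zero hr _ _ _ (fun x y hx hy => (hinit x hx y hy).2.1)
        fun x y hx hy => (hinit x hx y hy).1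
    · rw [f6, g4]
      constructor
      · intro x a y hx ha hy hlt
        rw [(hinit a ha y hy).2.1] at hlt
        rw [(hinit x hx y hy).2.2.1]
        by_cases hay : a = y
        · rw [hay]
        · rw [if_neg hay] at hlt
          omega
      · intro x y hx hy
        refine ⟨y, hy, ?_, (hinit x hx y hy).2.2.1⟩
        rw [(hinit y hy y hy).2.1, if_pos rfl]
        omega
  refine run_forLoop (n * n) (fun q T s' => T + 311 * n * entrySum n (s'.nat 6) ≤
      q * (141 * n + 82) + 311 * n * entrySum n (s3.nat 6) ∧
      GreedyState p G k r t B D eu ev q s') hp3.nat_sq (by decide) (by decide) (by decide)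
      ?_ ⟨by simp, hst⟩ ?_ ?_
  · rintro q T s' v ⟨h1, h2⟩
    exact ⟨h1, h2.prepared.of_frame (K := [23]) (L := [])
      ⟨fun a ha => State.setNat_nat_of_ne _ (by simpa using ha), fun _ _ => rfl⟩ (by decide)
      (by decide), h2.stretch, h2.radius, h2.inv, h2.nearest, h2.detour⟩
  · rintro q T s' hq hF hqs ⟨hT, hst'⟩
    refine (run_greedyStep s' hst' hr ht hq hqs).mono ?_
    rintro T' s'' ⟨hT', hst''⟩
    refine ⟨?_, hst''⟩
    rw [add_mul]
    omega
  · rintro T s' hF ⟨hT, hst'⟩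
    refine ⟨?_, hst'⟩
    have hE : entrySum n (s3.nat 6) ≤ n * (n * (2 * r)) :=
      entrySum_le fun x hx y hy => hst.inv.hop.le hx hy
    have h1 : 311 * n * entrySum n (s3.nat 6) ≤ 311 * n * (n * (n * (2 * r))) := by gcongr
    have h2 : 311 * n * (n * (n * (2 * r))) = 622 * (r * n ^ 3) := by ring
    have h3 : n * n * (141 * n + 82) = 141 * n ^ 3 + 82 * n ^ 2 := by ring
    have h4 : n * (n * (n * 100 + 28) + 28) = 100 * n ^ 3 + 28 * n ^ 2 + 28 * n := by ring
    have h5 : n * (n * 88 + 28) = 88 * n ^ 2 + 28 * n := by ring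
    have h6 : n ^ 2 ≤ n ^ 3 := Nat.pow_le_pow_right hn (by norm_num)
    have h7 : n ≤ n ^ 3 := Nat.le_self_pow (by norm_num) n
    have h8 : 1 * n ^ 3 ≤ r * n ^ 3 := by gcongr
    have h9 : 1000 * r * n ^ 3 = 1000 * (r * n ^ 3) := by ring
    omega

/-- The edges in the array `A` are sufficiently few, and they yield a dilation of at most `2 * r * t`
unless this number is too large. -/
def IsGood (p : Fin n ↪ M) (G : SimpleGraph (Fin n)) (k r : ℕ) (B t : ℝ) (A : ℕ → ℕ → ℕ) : Prop :=
  (edgesOf n A).edgeSet.ncard ^ r ≤ (2 * k) ^ (r + 1) ∧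
    ((∀ x y, 2 * r * t * distMatrix p x y < B) →
      dilation p (G ⊔ edgesOf n A) ≤ ENNReal.ofReal (2 * r * t))

/-- Program for the comparison of the number of edges with its upper bound. -/
def powers : Cmd :=
  .seq (setR 19 (.ofNat (.lit 1))) (.seq (setR 20 (.ofNat (.add (nv 1) (nv 1))))
    (forLoop 20 2 (.seq (setR 19 (.mul (rv 19) (.ofNat (nv 29))))
      (setR 20 (.mul (rv 20) (.ofNat (.add (nv 1) (nv 1))))))))

theorem run_powers (s : State) (h : Prepared p G k r B D eu ev s) :
    Run powers s fun T s' => T ≤ r * 50 + 30 ∧ s'.real 19 0 0 = (s.nat 29 0 0 : ℝ) ^ r ∧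
      s'.real 20 0 0 = (2 * k : ℝ) ^ (r + 1) := by
  refine run_seq (run_setReal (run_seq (run_setReal ?_)))
  refine run_forLoop_le r 34 (fun j s' => s'.real 19 0 0 = (s.nat 29 0 0 : ℝ) ^ j ∧
      s'.real 20 0 0 = (2 * k : ℝ) ^ (j + 1)) h.nat_r (by decide) (by decide) (by decide)
      (fun _ _ _ h => h) ?_ ?_ ?_
  · simp [h.nat_k, two_mul]
  · rintro j s' hj hF _ ⟨h1, h2⟩
    have e1 : s'.nat 1 0 0 = k := by rw [hF.1 1 (by decide)]; exact h.nat_k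
    have e2 : s'.nat 29 = s.nat 29 := hF.1 29 (by decide)
    refine run_seq (run_setReal (run_setReal ⟨by simp, ?_⟩))
    simp [h1, h2, e1, e2, pow_succ, two_mul]
  · rintro T s' hT hF ⟨h1, h2⟩
    simp only [NExpr.cost, RExpr.cost, nv]
    exact ⟨by omega, h1, h2⟩

/-- Program which tries to find few edges with dilation at most `2 * r * t`, where `t` is in the cell
`(0, 0)` of the real array `15`.  On success, the edges are stored in the integer array `4`.
Whether it succeeds is stored in the integer array `30`. -/
def attempt : Cmd :=
  .seq greedy (.seq powers (.cond (.realLt (rv 20) (rv 19)) (setN 30 (.lit 0))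
    (.seq (setN 30 (.lit 1))
      (forLoop2 20 21 0 (.setNat 4 (nv 20) (nv 21) (.get 5 (nv 20) (nv 21)))))))

/-- The program succeeds, or `k` edges do not suffice for a dilation less than `t`. -/
theorem run_attempt (s : State) (h : Prepared p G k r B D eu ev s) (hr : 1 ≤ r) (ht : 1 ≤ t)
    (hn : 1 ≤ n) (hts : s.real 15 0 0 = t) :
    Run attempt s fun T s' => T ≤ 2000 * r * n ^ 3 ∧ Prepared p G k r B D eu ev s' ∧
      (s'.nat 30 0 0 = 0 ∧ s'.nat 4 = s.nat 4 ∧ ENNReal.ofReal t ≤ optDilation p G k ∨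
        s'.nat 30 0 0 = 1 ∧ IsGood p G k r B t (s'.nat 4)) := by
  have h8 : 1 * n ^ 3 ≤ r * n ^ 3 := by gcongr
  have h6 : n ^ 2 ≤ n ^ 3 := Nat.pow_le_pow_right hn (by norm_num)
  have h7 : n ≤ n ^ 3 := Nat.le_self_pow (by norm_num) n
  have h9 : r * 1 ≤ r * n ^ 3 := Nat.mul_le_mul_left _ (hn.trans h7)
  refine run_frame (Run.mono (Q := fun T s' => T ≤ 2000 * r * n ^ 3 ∧
      (s'.nat 30 0 0 = 0 ∧ s'.nat 4 = s.nat 4 ∧ ENNReal.ofReal t ≤ optDilation p G k ∨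
        s'.nat 30 0 0 = 1 ∧ IsGood p G k r B t (s'.nat 4))) ?_ fun T s' hQ hF =>
    ⟨hQ.1, h.of_frame hF (by decide) (by decide), hQ.2⟩)
  refine run_seq (run_frame ((run_greedy s h hr ht hn hts).mono ?_))
  rintro T1 s1 ⟨hT1, hst⟩ hF1
  refine run_seq (run_frame ((run_powers s1 hst.prepared).mono ?_))
  rintro T2 s2 ⟨hT2, h19, h20⟩ hF2
  refine run_cond (fun hc => run_setNat ?_) (fun hc => run_seq (run_setNat ?_))
  · simp only [BExpr.holds, RExpr.eval, rv, NExpr.eval, h19, h20] at hc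
    refine ⟨?_, Or.inl ⟨by simp, ?_, ?_⟩⟩
    · simp only [NExpr.cost, BExpr.cost, RExpr.cost, rv, mul_assoc] at *
      omega
    · rw [State.setNat_nat_of_ne _ (by decide), hF2.1 4 (by decide), hF1.1 4 (by decide)]
    · by_contra hlt
      have := hst.inv.pow_le hr (not_le.mp hlt).le
      have : (s1.nat 29 0 0 : ℝ) ^ r ≤ (2 * k : ℝ) ^ (r + 1) := by exact_mod_cast this
      linarith
  · simp only [BExpr.holds, RExpr.eval, rv, NExpr.eval, h19, h20, not_lt] at hc
    simp only [NExpr.eval]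
    have hn2 : s2.nat 0 0 0 = n := by rw [hF2.1 0 (by decide), hst.prepared.nat_n]
    refine run_forLoop2 (fun s => s.nat 4) n 14 (s1.nat 5) ?_ (by decide) (by decide) (by decide)
      ?_ ?_ ?_
    · rw [State.setNat_nat_of_ne _ (by decide), hn2]
    · intro a ha s' v
      simp only [List.mem_cons, List.not_mem_nil, or_false] at ha
      rcases ha with rfl | rfl <;> rfl
    · intro x y s' hx hy hF hi hj _ _
      refine run_setNat ⟨by simp, fun x' y' => ?_⟩
      have e5 : s'.nat 5 = s1.nat 5 := by
        rw [hF.1 5 (by decide), State.setNat_nat_of_ne _ (by decide), hF2.1 5 (by decide)]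
      simp [hi, hj, e5]
    · intro T s' hT hF h4
      have e4 : edgesOf n (s'.nat 4) = edgesOf n (s1.nat 5) := by
        refine edgesOf_congr fun x hx y hy => ?_
        rw [h4]
        simp [hx, hy]
      refine ⟨?_, Or.inr ⟨?_, ?_, ?_⟩⟩
      · have h5 : n * (n * (14 + 16) + 28) = 30 * n ^ 2 + 28 * n := by ring
        simp only [NExpr.cost, BExpr.cost, RExpr.cost, rv, mul_assoc] at *
        omega
      · rw [hF.1 30 (by decide)]
        simp
      · rw [e4]
        have : s1.nat 29 0 0 ^ r ≤ (2 * k) ^ (r + 1) := by exact_mod_cast hc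
        exact (Nat.pow_le_pow_left hst.inv.ncard_le _).trans this
      · intro hB
        rw [e4]
        exact hst.inv.dilation_le hr ht hst.prepared.sorted hB

end RealRAM

/-! ### Sorting -/

namespace MetricGraph

/-- The position of `b` when the numbers below `n` are sorted by the values of `f`. -/
noncomputable def rank (n : ℕ) (f : ℕ → ℝ) (b : ℕ) : ℕ :=
  open Classical in
  ((Finset.range n).filter fun x => f x < f b ∨ ¬ f b < f x ∧ x < b).card

theorem rank_lt_rank {n : ℕ} {f : ℕ → ℝ} {x b : ℕ} (hx : x < n)
    (h : f x < f b ∨ ¬ f b < f x ∧ x < b) : rank n f x < rank n f b := by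
  classical
  refine Finset.card_lt_card ((Finset.ssubset_iff_of_subset fun y hy => ?_).mpr ⟨x, ?_, ?_⟩)
  · rw [Finset.mem_filter] at hy ⊢
    refine ⟨hy.1, ?_⟩
    rcases hy.2 with h1 | ⟨h1, h2⟩ <;> rcases h with h3 | ⟨h3, h4⟩
    · exact Or.inl (h1.trans h3)
    · exact Or.inl (h1.trans_le (not_lt.mp h3))
    · exact Or.inl ((not_lt.mp h1).trans_lt h3)
    · exact Or.inr ⟨not_lt.mpr ((not_lt.mp h1).trans (not_lt.mp h3)), h2.trans h4⟩
  · exact Finset.mem_filter.mpr ⟨Finset.mem_range.mpr hx, h⟩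
  · simp

theorem rank_lt {n : ℕ} (f : ℕ → ℝ) {b : ℕ} (hb : b < n) : rank n f b < n := by
  classical
  refine lt_of_lt_of_eq (Finset.card_lt_card ((Finset.ssubset_iff_of_subset
    (Finset.filter_subset _ _)).mpr ⟨b, Finset.mem_range.mpr hb, by simp⟩)) (Finset.card_range n)

theorem rank_injOn (n : ℕ) (f : ℕ → ℝ) {x y : ℕ} (hx : x < n) (hy : y < n)
    (h : rank n f x = rank n f y) : x = y := by
  by_contra hne
  rcases lt_trichotomy (f x) (f y) with h1 | h1 | h1
  · exact (rank_lt_rank hx (Or.inl h1)).ne h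
  · rcases lt_or_gt_of_ne hne with h2 | h2
    · exact (rank_lt_rank hx (Or.inr ⟨by rw [h1]; exact lt_irrefl _, h2⟩)).ne h
    · exact (rank_lt_rank hy (Or.inr ⟨by rw [h1]; exact lt_irrefl _, h2⟩)).ne' h
  · exact (rank_lt_rank hy (Or.inl h1)).ne' h

theorem isRowSorted_of_rank {n : ℕ} {f : ℕ → ℝ} {o : ℕ → ℕ} (h : ∀ b < n, o (rank n f b) = b) :
    IsRowSorted n f o := by
  have hsurj : ∀ i < n, ∃ b < n, rank n f b = i := by
    have := Finset.surjOn_of_injOn_of_card_le (s := Finset.range n) (t := Finset.range n) (rank n f)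
      (fun b hb => by simpa using rank_lt f (by simpa using hb))
      (fun x hx y hy hxy => rank_injOn n f (by simpa using hx) (by simpa using hy) hxy) le_rfl
    intro i hi
    obtain ⟨b, hb, he⟩ := this (by simpa using hi)
    exact ⟨b, by simpa using hb, he⟩
  refine ⟨?_, ?_, fun {y} hy => ⟨_, rank_lt f hy, h y hy⟩, ?_⟩
  · intro i hi
    obtain ⟨b, hb, rfl⟩ := hsurj i hi
    rwa [h b hb]
  · intro i j hi hj hij
    obtain ⟨b, hb, rfl⟩ := hsurj i hi
    obtain ⟨c, hc, rfl⟩ := hsurj j hj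
    rw [h b hb, h c hc] at hij
    rw [hij]
  · intro i j hij hj
    obtain ⟨b, hb, rfl⟩ := hsurj i (by omega)
    obtain ⟨c, hc, rfl⟩ := hsurj j hj
    rw [h b hb, h c hc]
    by_contra hlt
    have := rank_lt_rank hc (Or.inl (not_le.mp hlt))
    omega

/-- The invariant of the merge of `n` sorted rows: the first `h w` elements of the row `w` have been
merged, and the result consists of the pairs `(eu i, ev i)` with `i < q`. -/
structure MergeInv (n : ℕ) (d : ℕ → ℕ → ℝ) (o : ℕ → ℕ → ℕ) (h eu ev : ℕ → ℕ) (q : ℕ) : Prop where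
  le : ∀ w < n, h w ≤ n
  sum : ∑ w ∈ Finset.range n, h w = q
  fst_lt : ∀ i < q, eu i < n
  snd_lt : ∀ i < q, ev i < n
  done : ∀ w < n, ∀ i < h w, ∃ j < q, eu j = w ∧ ev j = o w i
  mono : ∀ i j, i ≤ j → j < q → d (eu i) (ev i) ≤ d (eu j) (ev j)
  bound : ∀ j < q, ∀ w < n, h w < n → d (eu j) (ev j) ≤ d w (o w (h w))

theorem MergeInv.exists_lt {n : ℕ} {d : ℕ → ℕ → ℝ} {o : ℕ → ℕ → ℕ} {h eu ev : ℕ → ℕ} {q : ℕ}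
    (hI : MergeInv n d o h eu ev q) (hq : q < n * n) : ∃ w < n, h w < n := by
  by_contra hne
  push Not at hne
  have : ∑ w ∈ Finset.range n, n ≤ ∑ w ∈ Finset.range n, h w :=
    Finset.sum_le_sum fun w hw => hne w (Finset.mem_range.mp hw)
  rw [hI.sum] at this
  simp at this
  omega

theorem MergeInv.step {n : ℕ} {d : ℕ → ℕ → ℝ} {o : ℕ → ℕ → ℕ} {h eu ev : ℕ → ℕ} {q : ℕ}
    (hI : MergeInv n d o h eu ev q) (ho : ∀ w < n, IsRowSorted n (d w) (o w)) {b : ℕ} (hb : b < n)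
    (hbn : h b < n) (hmin : ∀ w < n, h w < n → d b (o b (h b)) ≤ d w (o w (h w)))
    {h' eu' ev' : ℕ → ℕ} (hh : ∀ w, h' w = if w = b then h b + 1 else h w)
    (hu : ∀ i, eu' i = if i = q then b else eu i)
    (hv : ∀ i, ev' i = if i = q then o b (h b) else ev i) :
    MergeInv n d o h' eu' ev' (q + 1) := by
  have hu' : ∀ i < q, eu' i = eu i := fun i hi => by rw [hu, if_neg hi.ne]
  have hv' : ∀ i < q, ev' i = ev i := fun i hi => by rw [hv, if_neg hi.ne]
  have huq : eu' q = b := by rw [hu, if_pos rfl]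
  have hvq : ev' q = o b (h b) := by rw [hv, if_pos rfl]
  have hnext : ∀ w < n, h' w < n → d b (o b (h b)) ≤ d w (o w (h' w)) := fun w hw hlt => by
    rw [hh] at hlt ⊢
    by_cases hwb : w = b
    · rw [if_pos hwb] at hlt ⊢
      rw [hwb]
      exact (ho b hb).mono (Nat.le_succ _) hlt
    · rw [if_neg hwb] at hlt ⊢
      exact hmin w hw hlt
  refine ⟨?_, ?_, ?_, ?_, ?_, ?_, ?_⟩
  · intro w hw
    rw [hh]
    split_ifs
    · exact hbn
    · exact hI.le w hw
  · have e : ∀ w, h' w = h w + if w = b then 1 else 0 := fun w => by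
      rw [hh]
      split_ifs with hwb
      · rw [hwb]
      · rfl
    simp_rw [e]
    rw [Finset.sum_add_distrib, hI.sum, Finset.sum_ite_eq', if_pos (Finset.mem_range.mpr hb)]
  · intro i hi
    rcases Nat.lt_succ_iff_lt_or_eq.mp hi with hlt | rfl
    · rw [hu' i hlt]; exact hI.fst_lt i hlt
    · rwa [huq]
  · intro i hi
    rcases Nat.lt_succ_iff_lt_or_eq.mp hi with hlt | rfl
    · rw [hv' i hlt]; exact hI.snd_lt i hlt
    · rw [hvq]; exact (ho b hb).lt hbn
  · intro w hw i hi
    rw [hh] at hi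
    by_cases hwb : w = b
    · rw [if_pos hwb] at hi
      rcases Nat.lt_succ_iff_lt_or_eq.mp hi with hlt | rfl
      · obtain ⟨j, hj, h1, h2⟩ := hI.done w hw i (by rwa [hwb])
        exact ⟨j, by omega, by rw [hu' j hj, h1], by rw [hv' j hj, h2]⟩
      · exact ⟨q, by omega, by rw [huq, hwb], by rw [hvq, hwb]⟩
    · rw [if_neg hwb] at hi
      obtain ⟨j, hj, h1, h2⟩ := hI.done w hw i hi
      exact ⟨j, by omega, by rw [hu' j hj, h1], by rw [hv' j hj, h2]⟩
  · intro i j hij hj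
    rcases Nat.lt_succ_iff_lt_or_eq.mp hj with hlt | rfl
    · rw [hu' j hlt, hv' j hlt, hu' i (by omega), hv' i (by omega)]
      exact hI.mono i j hij hlt
    · rcases hij.lt_or_eq with hlt | rfl
      · rw [hu' i hlt, hv' i hlt, huq, hvq]
        exact hI.bound i hlt b hb hbn
      · exact le_rfl
  · intro j hj w hw hlt
    have h1 := hnext w hw hlt
    rcases Nat.lt_succ_iff_lt_or_eq.mp hj with hlt' | rfl
    · rw [hu' j hlt', hv' j hlt']
      exact (hI.bound j hlt' b hb hbn).trans h1
    · rwa [huq, hvq]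

theorem MergeInv.isSortedPairs {n : ℕ} {d : ℕ → ℕ → ℝ} {o : ℕ → ℕ → ℕ} {h eu ev : ℕ → ℕ}
    (hI : MergeInv n d o h eu ev (n * n)) (ho : ∀ w < n, IsRowSorted n (d w) (o w)) :
    IsSortedPairs n (n * n) d eu ev := by
  refine ⟨fun {i} => hI.fst_lt i, fun {i} => hI.snd_lt i, ?_, fun {i j} => hI.mono i j⟩
  intro x y hx hy
  have hall : ∀ w ∈ Finset.range n, h w = n := by
    refine (Finset.sum_eq_sum_iff_of_le fun w hw => hI.le w (Finset.mem_range.mp hw)).mp ?_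
    rw [hI.sum]
    simp
  obtain ⟨i, hi, rfl⟩ := (ho x hx).exists_eq hy
  obtain ⟨j, hj, h1, h2⟩ := hI.done x hx i (by rwa [hall x (Finset.mem_range.mpr hx)])
  exact ⟨j, hj, h1, h2⟩

end MetricGraph

namespace RealRAM

open MetricGraph

/-- Program for `MetricGraph.rank`; the function `f` is the row of the real array `A` whose number is
in the cell `(0, 0)` of the integer array `20`, and `b` is in the cell `(0, 0)` of the integer array
`21`. -/
def findRank (A : ℕ) : Cmd :=
  .seq (setN 26 (.lit 0)) (forLoop 22 0 (.cond
    (orB (.realLt (.get A (nv 20) (nv 22)) (.get A (nv 20) (nv 21)))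
      (.conj (.neg (.realLt (.get A (nv 20) (nv 21)) (.get A (nv 20) (nv 22))))
        (.natLt (nv 22) (nv 21))))
    (setN 26 (.add (nv 26) (.lit 1))) .skip))

theorem run_findRank (A : ℕ) (s : State) {n : ℕ} (hn : s.nat 0 0 0 = n) :
    Run (findRank A) s fun T s' => T ≤ 80 * n + 16 ∧
      s'.nat 26 0 0 = rank n (s.real A (s.nat 20 0 0)) (s.nat 21 0 0) := by
  classical
  set v := s.nat 20 0 0 with hv
  set b := s.nat 21 0 0 with hb
  refine run_seq (run_setNat ?_)
  simp only [NExpr.eval, NExpr.cost]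
  refine run_forLoop_le n 64 (fun j s' => s'.nat 26 0 0 = ((Finset.range j).filter fun x =>
      s.real A v x < s.real A v b ∨ ¬ s.real A v b < s.real A v x ∧ x < b).card)
    ?_ (by simp) (by simp [Cmd.nats]) (by simp [Cmd.nats]) (fun _ _ _ h => h) (by simp) ?_ ?_
  · simp [hn]
  · intro j s' hj hF hij hI
    have e1 : s'.nat 20 0 0 = v := by rw [hF.1 20 (by simp [Cmd.nats])]; simp [hv]
    have e2 : s'.nat 21 0 0 = b := by rw [hF.1 21 (by simp [Cmd.nats])]; simp [hb]
    have e3 : s'.real = s.real := funext fun a => hF.2 a (by simp [Cmd.reals])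
    refine run_cond (fun hc => run_setNat ?_) (fun hc => run_skip ?_)
    · refine ⟨by simp, ?_⟩
      simp only [holds_orB, BExpr.holds, RExpr.eval, NExpr.eval, nv, e1, e2, e3, hij] at hc
      rw [Finset.range_add_one, Finset.filter_insert, if_pos hc,
        Finset.card_insert_of_notMem (by simp)]
      simp [hI]
    · refine ⟨by simp, ?_⟩
      simp only [holds_orB, BExpr.holds, RExpr.eval, NExpr.eval, nv, e1, e2, e3, hij] at hc
      rw [Finset.range_add_one, Finset.filter_insert, if_neg hc, hI]
  · intro T s' hT _ hI
    refine ⟨by omega, hI.trans ?_⟩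
    rw [rank]

/-- Program which stores in the row `v` of the integer array `O` the numbers below `n`, sorted by the
entries of the row `v` of the real array `A`. -/
def sortRows (A O : ℕ) : Cmd :=
  forLoop 20 0 (forLoop 21 0 (.seq (findRank A) (.setNat O (nv 20) (nv 26) (nv 21))))

theorem run_sortRows (A O : ℕ) (s : State) {n : ℕ} (hn : s.nat 0 0 0 = n)
    (hO : O ∉ [0, 20, 21, 22, 26]) :
    Run (sortRows A O) s fun T s' => T ≤ n * (n * (80 * n + 50) + 28) + 12 ∧
      ∀ v < n, IsRowSorted n (s.real A v) (s'.nat O v) := by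
  simp only [List.mem_cons, List.not_mem_nil, or_false, not_or] at hO
  refine run_forLoop_le n (n * (80 * n + 50) + 12)
    (fun v s' => ∀ v' < v, ∀ b < n, s'.nat O v' (rank n (s.real A v') b) = b) hn (by simp)
    (by simp [Cmd.nats, forLoop, findRank, Ne.symm hO.1])
    (by simp [Cmd.nats, forLoop, findRank, Ne.symm hO.2.1]) ?_ (by simp) ?_ ?_
  · intro v s' x h v' hv' b hb
    rw [State.setNat_nat_of_ne _ hO.2.1]
    exact h v' hv' b hb
  · intro v s' hv hF hvs hI
    have e0 : s'.nat 0 0 0 = n := by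
      rw [hF.1 0 (by simp [Cmd.nats, forLoop, findRank, Ne.symm hO.1]), hn]
    have er : s'.real = s.real := funext fun a => hF.2 a (by simp [Cmd.reals, forLoop, findRank])
    refine run_forLoop_le n (80 * n + 34) (fun y s'' => (∀ v' < v, ∀ b < n,
        s''.nat O v' (rank n (s.real A v') b) = b) ∧
        ∀ b < y, s''.nat O v (rank n (s.real A v) b) = b) e0 (by simp)
        (by simp [Cmd.nats, forLoop, findRank, Ne.symm hO.1])
        (by simp [Cmd.nats, forLoop, findRank, Ne.symm hO.2.2.1]) ?_ ⟨hI, by simp⟩ ?_ ?_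
    · rintro y s'' x ⟨h1, h2⟩
      rw [State.setNat_nat_of_ne _ hO.2.2.1]
      exact ⟨h1, h2⟩
    · rintro y s'' hy hF' hys ⟨h1, h2⟩
      have e0' : s''.nat 0 0 0 = n := by
        rw [hF'.1 0 (by simp [Cmd.nats, forLoop, findRank, Ne.symm hO.1]), e0]
      have e20 : s''.nat 20 0 0 = v := by
        rw [hF'.1 20 (by simp [Cmd.nats, forLoop, findRank, Ne.symm hO.2.1]), hvs]
      have er' : s''.real = s.real :=
        (funext fun a => hF'.2 a (by simp [Cmd.reals, forLoop, findRank])).trans er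
      refine run_seq (run_frame ((run_findRank A s'' e0').mono ?_))
      rintro T1 s1 ⟨hT1, hr1⟩ hF1
      have f1 : ∀ a, a ∉ [22, 26] → s1.nat a = s''.nat a := fun a ha => by
        simp only [List.mem_cons, List.not_mem_nil, or_false, not_or] at ha
        exact hF1.1 a (by simp [Cmd.nats, forLoop, findRank, ha])
      rw [e20, hys, er'] at hr1
      refine run_setNat ⟨?_, ?_⟩
      · simp only [NExpr.cost, nv]
        omega
      · simp only [NExpr.eval, nv, f1 20 (by simp), f1 21 (by simp), e20, hys, hr1,
          State.setNat_nat_apply, true_and, f1 O (by simp [hO])]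
        refine ⟨fun v' hv' b hb => ?_, fun b hb => ?_⟩
        · rw [if_neg (by omega)]
          exact h1 v' hv' b hb
        · rcases Nat.lt_succ_iff_lt_or_eq.mp hb with hlt | rfl
          · rw [if_neg, h2 b hlt]
            intro h
            have := rank_injOn n _ (by omega) hy h
            omega
          · rw [if_pos rfl]
    · rintro T s'' hT _ ⟨h1, h2⟩
      refine ⟨by convert hT using 2, fun v' hv' => ?_⟩
      rcases Nat.lt_succ_iff_lt_or_eq.mp hv' with hlt | rfl
      · exact h1 v' hlt
      · exact h2
  · intro T s' hT _ hI
    exact ⟨by convert hT using 3, fun v hv => isRowSorted_of_rank (hI v hv)⟩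

/-- Program which finds the row whose first element not yet merged is the smallest one.  The result,
in the integer array `42`, is `n` if all rows have been merged. -/
def findRow : Cmd :=
  .seq (setN 42 (nv 0)) (forLoop 22 0 (.cond
    (.conj (.natLt (.get 9 (nv 22) (.lit 0)) (nv 0)) (.neg (.conj (.natLt (nv 42) (nv 0))
      (.neg (.realLt (.get 0 (nv 22) (.get 8 (nv 22) (.get 9 (nv 22) (.lit 0))))
        (.get 0 (nv 42) (.get 8 (nv 42) (.get 9 (nv 42) (.lit 0)))))))))
    (setN 42 (nv 22)) .skip))

theorem run_findRow (s : State) {n : ℕ} (hn : s.nat 0 0 0 = n) (hex : ∃ w < n, s.nat 9 w 0 < n) :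
    Run findRow s fun T s' => T ≤ 100 * n + 18 ∧ ∃ b, s'.nat 42 0 0 = b ∧ b < n ∧ s.nat 9 b 0 < n ∧
      ∀ w < n, s.nat 9 w 0 < n → s.real 0 b (s.nat 8 b (s.nat 9 b 0)) ≤
        s.real 0 w (s.nat 8 w (s.nat 9 w 0)) := by
  set val : ℕ → ℝ := fun w => s.real 0 w (s.nat 8 w (s.nat 9 w 0)) with hval
  refine run_seq (run_setNat ?_)
  simp only [NExpr.eval, NExpr.cost, nv, hn]
  refine run_forLoop_le n 84 (fun j s' =>
    (s'.nat 42 0 0 = n ∧ ∀ w < j, ¬ s.nat 9 w 0 < n) ∨ (s'.nat 42 0 0 < n ∧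
      s.nat 9 (s'.nat 42 0 0) 0 < n ∧ ∀ w < j, s.nat 9 w 0 < n → val (s'.nat 42 0 0) ≤ val w))
    ?_ (by decide) (by decide) (by decide) (fun _ _ _ h => h) (by simp) ?_ ?_
  · simp [hn]
  · intro j s' hj hF hij hI
    have f : ∀ a, a ∉ [22, 42] → s'.nat a = s.nat a := fun a ha => by
      simp only [List.mem_cons, List.not_mem_nil, or_false, not_or] at ha
      rw [hF.1 a (by simp [Cmd.nats, ha]), State.setNat_nat_of_ne _ ha.2]
    have g : s'.real 0 = s.real 0 := hF.2 0 (by decide)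
    have hholds : BExpr.holds s' (.conj (.natLt (.get 9 (nv 22) (.lit 0)) (nv 0)) (.neg (.conj
        (.natLt (nv 42) (nv 0))
        (.neg (.realLt (.get 0 (nv 22) (.get 8 (nv 22) (.get 9 (nv 22) (.lit 0))))
        (.get 0 (nv 42) (.get 8 (nv 42) (.get 9 (nv 42) (.lit 0))))))))) ↔
        s.nat 9 j 0 < n ∧ ¬ (s'.nat 42 0 0 < n ∧ ¬ val j < val (s'.nat 42 0 0)) := by
      simp only [BExpr.holds, RExpr.eval, NExpr.eval, nv, hij, f 9 (by decide), f 0 (by decide),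
        f 8 (by decide), g, hn, hval]
    refine run_cond (fun hc => run_setNat ⟨by simp, ?_⟩) (fun hc => run_skip ⟨by simp, ?_⟩)
    · obtain ⟨h1, h2⟩ := hholds.mp hc
      simp only [NExpr.eval, hij, State.setNat_nat_apply, and_self, if_true]
      refine Or.inr ⟨hj, h1, fun w hw hwn => ?_⟩
      rcases Nat.lt_succ_iff_lt_or_eq.mp hw with hlt | rfl
      · rcases hI with ⟨-, h3⟩ | ⟨h3, h4, h5⟩
        · exact absurd hwn (h3 w hlt)
        · have : val j < val (s'.nat 42 0 0) := by
            by_contra h6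
            exact h2 ⟨h3, h6⟩
          exact this.le.trans (h5 w hlt hwn)
      · exact le_rfl
    · replace hc := mt hholds.mpr hc
      rcases hI with ⟨h3, h4⟩ | ⟨h3, h4, h5⟩
      · refine Or.inl ⟨h3, fun w hw hwn => ?_⟩
        rcases Nat.lt_succ_iff_lt_or_eq.mp hw with hlt | rfl
        · exact h4 w hlt hwn
        · exact hc ⟨hwn, fun h => by omega⟩
      · refine Or.inr ⟨h3, h4, fun w hw hwn => ?_⟩
        rcases Nat.lt_succ_iff_lt_or_eq.mp hw with hlt | rfl
        · exact h5 w hlt hwn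
        · by_contra h6
          exact hc ⟨hwn, fun h => h.2 (not_le.mp h6)⟩
  · rintro T s' hT _ (⟨-, h⟩ | ⟨h1, h2, h3⟩)
    · obtain ⟨w, hw, hwn⟩ := hex
      exact absurd hwn (h w hw)
    · exact ⟨by omega, _, rfl, h1, h2, h3⟩

/-- Program for the merge of the sorted rows. -/
def mergeRows : Cmd :=
  forLoop 23 28 (.seq findRow (.seq (.setNat 10 (nv 23) (.lit 0) (nv 42))
    (.seq (.setNat 11 (nv 23) (.lit 0) (.get 8 (nv 42) (.get 9 (nv 42) (.lit 0))))
      (.setNat 9 (nv 42) (.lit 0) (.add (.get 9 (nv 42) (.lit 0)) (.lit 1))))))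

theorem run_mergeRows (s : State) {n : ℕ} (hn : s.nat 0 0 0 = n) (hnn : s.nat 28 0 0 = n * n)
    (ho : ∀ w < n, IsRowSorted n (s.real 0 w) (s.nat 8 w)) (h9 : ∀ w, s.nat 9 w 0 = 0) :
    Run mergeRows s fun T s' => T ≤ n * n * (100 * n + 100) + 12 ∧
      IsSortedPairs n (n * n) (s.real 0) (fun i => s'.nat 10 i 0) fun i => s'.nat 11 i 0 := by
  refine run_forLoop_le (n * n) (100 * n + 84) (fun q s' => MergeInv n (s.real 0) (s.nat 8)
    (fun w => s'.nat 9 w 0) (fun i => s'.nat 10 i 0) (fun i => s'.nat 11 i 0) q) hnn (by decide)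
    (by decide) (by decide) (fun _ _ _ h => h) ?_ ?_ ?_
  · simp only [h9]
    exact ⟨by simp, by simp, by simp, by simp, by simp, by simp, by simp⟩
  · intro q s' hq hF hqs hI
    have e0 : s'.nat 0 0 0 = n := by rw [hF.1 0 (by decide), hn]
    have e8 : s'.nat 8 = s.nat 8 := hF.1 8 (by decide)
    have er : s'.real 0 = s.real 0 := hF.2 0 (by decide)
    refine run_seq (run_frame ((run_findRow s' e0 (hI.exists_lt hq)).mono ?_))
    rintro T1 s1 ⟨hT1, b, hb, hbn, h9b, hmin⟩ hF1
    rw [e8, er] at hmin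
    have f8 : s1.nat 8 = s.nat 8 := (hF1.1 8 (by decide)).trans e8
    have f9 : s1.nat 9 = s'.nat 9 := hF1.1 9 (by decide)
    have f10 : s1.nat 10 = s'.nat 10 := hF1.1 10 (by decide)
    have f11 : s1.nat 11 = s'.nat 11 := hF1.1 11 (by decide)
    have f23 : s1.nat 23 0 0 = q := by rw [hF1.1 23 (by decide), hqs]
    refine run_seq (run_setNat (run_seq (run_setNat (run_setNat ⟨?_, ?_⟩))))
    · simp only [NExpr.cost, nv]
      omega
    · simp only [NExpr.eval, nv, State.setNat_nat_apply, hb, f23]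
      norm_num only [hb, f23, f8, f9, f10, f11, false_and, if_false, true_and, and_true]
      exact hI.step ho hbn h9b hmin (fun _ => rfl) (fun _ => rfl) (fun _ => rfl)
  · intro T s' hT _ hI
    exact ⟨hT, hI.isSortedPairs ho⟩

end RealRAM

/-! ### Distances in the given graph -/

namespace RealRAM

open MetricGraph

variable {M : Type*} [MetricSpace M] {n : ℕ} {p : Fin n ↪ M} {G : SimpleGraph (Fin n)}

/-- Program for an upper bound `a` of all distances and an upper bound `b` of the inverses of all
positive distances, in the cells `(0, 0)` of the real arrays `11` and `12`. -/
def extremes : Cmd :=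
  forLoop 20 0 (forLoop 21 0 (.seq
    (.cond (.realLt (rv 11) (.get 0 (nv 20) (nv 21))) (setR 11 (.get 0 (nv 20) (nv 21))) .skip)
    (.cond (.conj (.realLt (.ofNat (.lit 0)) (.get 0 (nv 20) (nv 21)))
        (.realLt (.mul (rv 12) (.get 0 (nv 20) (nv 21))) (.ofNat (.lit 1))))
      (setR 12 (.div (.ofNat (.lit 1)) (.get 0 (nv 20) (nv 21)))) .skip)))

theorem run_extremes (s : State) (hn : s.nat 0 0 0 = n) {d : ℕ → ℕ → ℝ} (hd : s.real 0 = d)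
    (h11 : s.real 11 0 0 = 0) (h12 : s.real 12 0 0 = 0) :
    Run extremes s fun T s' => T ≤ n * (n * 100 + 28) + 12 ∧ 0 ≤ s'.real 11 0 0 ∧
      0 ≤ s'.real 12 0 0 ∧ ∀ x < n, ∀ y < n, d x y ≤ s'.real 11 0 0 ∧
        (0 < d x y → 1 ≤ s'.real 12 0 0 * d x y) := by
  set I : (ℕ → ℕ → Prop) → State → Prop := fun done s' => 0 ≤ s'.real 11 0 0 ∧
    0 ≤ s'.real 12 0 0 ∧ ∀ x < n, ∀ y < n, done x y → d x y ≤ s'.real 11 0 0 ∧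
      (0 < d x y → 1 ≤ s'.real 12 0 0 * d x y) with hI
  have hmono : ∀ {P P' : ℕ → ℕ → Prop} {s' : State}, (∀ x < n, ∀ y < n, P' x y → P x y) → I P s' →
      I P' s' := fun hP h => ⟨h.1, h.2.1, fun x hx y hy hxy => h.2.2 x hx y hy (hP x hx y hy hxy)⟩
  refine run_forLoop_le n (n * 100 + 12) (fun v => I fun x _ => x < v) hn (by decide) (by decide)
    (by decide) (fun _ _ _ h => h) ⟨h11.ge, h12.ge, by simp⟩ ?_ ?_
  · intro v s' hv hF hvs hs
    refine run_forLoop_le n 84 (fun w => I fun x y => x < v ∨ x = v ∧ y < w) ?_ (by decide)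
      (by decide) (by decide) (fun _ _ _ h => h) (hmono (by simp) hs) ?_ ?_
    · rw [hF.1 0 (by decide), hn]
    · intro w s'' hw hF' hws hs'
      have e20 : s''.nat 20 0 0 = v := by rw [hF'.1 20 (by decide), hvs]
      have er : s''.real 0 = d := by rw [hF'.2 0 (by decide), hF.2 0 (by decide), hd]
      obtain ⟨h1, h2, h3⟩ := hs'
      -- the first conditional only affects the bound of the distances
      have hfirst : Run (.cond (.realLt (rv 11) (.get 0 (nv 20) (nv 21)))
          (setR 11 (.get 0 (nv 20) (nv 21))) .skip) s'' fun T s1 => T ≤ 24 ∧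
          s''.real 11 0 0 ≤ s1.real 11 0 0 ∧ d v w ≤ s1.real 11 0 0 ∧ s1.nat = s''.nat ∧
          s1.real 0 = d ∧ s1.real 12 = s''.real 12 := by
        refine run_cond (fun hc => run_setReal ?_) (fun hc => run_skip ?_)
        · simp only [BExpr.holds, RExpr.eval, rv, nv, NExpr.eval, e20, hws, er] at hc
          refine ⟨by simp, ?_, ?_, rfl, ?_, ?_⟩
          · simp [e20, hws, er, hc.le]
          · simp [e20, hws, er]
          · rw [State.setReal_real_of_ne _ (by decide), er]
          · rw [State.setReal_real_of_ne _ (by decide)]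
        · simp only [BExpr.holds, RExpr.eval, rv, nv, NExpr.eval, e20, hws, er, not_lt] at hc
          exact ⟨by simp, le_rfl, hc, rfl, er, rfl⟩
      refine run_seq (hfirst.mono ?_)
      rintro T1 s1 ⟨hT1, g1, g2, g3, g4, g5⟩
      have hdone : ∀ x y, x < v ∨ x = v ∧ y < w + 1 → (x < v ∨ x = v ∧ y < w) ∨ x = v ∧ y = w := by
        intro x y
        omega
      refine run_cond (fun hc => run_setReal ?_) (fun hc => run_skip ?_)
      · simp only [BExpr.holds, RExpr.eval, rv, nv, NExpr.eval, g3, e20, hws, g4, g5,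
          Nat.cast_zero, Nat.cast_one] at hc
        simp only [RExpr.eval, nv, NExpr.eval, g3, e20, hws, g4, Nat.cast_one]
        have e11 : (s1.setReal 12 0 0 (1 / d v w)).real 11 0 0 = s1.real 11 0 0 := by simp
        have e12 : (s1.setReal 12 0 0 (1 / d v w)).real 12 0 0 = 1 / d v w := by simp
        refine ⟨by simp; omega, h1.trans (g1.trans e11.ge), ?_, ?_⟩
        · rw [e12]; exact (one_div_pos.mpr hc.1).le
        · intro x hx y hy hxy
          rw [e11, e12]
          have hinv : s''.real 12 0 0 ≤ 1 / d v w := (lt_div_iff₀ hc.1).mpr hc.2 |>.le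
          rcases hdone x y hxy with h | ⟨rfl, rfl⟩
          · obtain ⟨h4, h5⟩ := h3 x hx y hy h
            exact ⟨h4.trans g1, fun hpos => (h5 hpos).trans (by gcongr)⟩
          · exact ⟨g2, fun hpos => (one_div_mul_cancel hpos.ne').ge⟩
      · simp only [BExpr.holds, RExpr.eval, rv, nv, NExpr.eval, g3, e20, hws, g4, g5,
          Nat.cast_zero, Nat.cast_one, not_and, not_lt] at hc
        refine ⟨by simp; omega, h1.trans g1, by rw [g5]; exact h2, ?_⟩
        intro x hx y hy hxy
        rw [g5]
        rcases hdone x y hxy with h | ⟨rfl, rfl⟩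
        · obtain ⟨h4, h5⟩ := h3 x hx y hy h
          exact ⟨h4.trans g1, h5⟩
        · exact ⟨g2, hc⟩
    · intro T s'' hT hF' hs'
      refine ⟨by omega, hmono (fun x _ y hy hxy => ?_) hs'⟩
      omega
  · rintro T s' hT hF ⟨h1, h2, h3⟩
    exact ⟨by omega, h1, h2, fun x hx y hy => h3 x hx y hy hx⟩

/-- Program which stores the number of pairs in the integer array `28`, and a number that exceeds
all lengths which matter in the real array `10`. -/
def bounds : Cmd :=
  .seq (forLoop 20 0 (setN 28 (.add (nv 28) (nv 0)))) (.seq extremes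
    (setR 10 (.add (.add (.ofNat (.lit 1)) (rv 11)) (.mul (.mul (.mul (.mul (.ofNat (.lit 4))
      (.ofNat (nv 2))) (.mul (.ofNat (nv 0)) (.ofNat (nv 0)))) (.mul (rv 11) (rv 11))) (rv 12)))))

theorem run_bounds (s : State) {r : ℕ} (hn : s.nat 0 0 0 = n) (hr : s.nat 2 0 0 = r)
    (hd : s.real 0 = distMatrix p) (h28 : s.nat 28 0 0 = 0)
    (h11 : s.real 11 0 0 = 0) (h12 : s.real 12 0 0 = 0) :
    Run bounds s fun T s' => T ≤ n * (n * 100 + 68) + 100 ∧ s'.nat 28 0 0 = n * n ∧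
      ∃ a b, 0 ≤ a ∧ 0 ≤ b ∧ (∀ x y, distMatrix p x y ≤ a) ∧
        (∀ x y, 0 < distMatrix p x y → 1 ≤ b * distMatrix p x y) ∧
        s'.real 10 0 0 = 1 + a + 4 * r * (n * n) * (a * a) * b := by
  refine run_seq ?_
  refine run_forLoop_le n 20 (fun j s' => s'.nat 28 0 0 = j * n) hn (by decide) (by decide)
    (by decide) (fun _ _ _ h => h) (by simpa using h28) ?_ ?_
  · intro j s' hj hF _ h
    have e0 : s'.nat 0 0 0 = n := by rw [hF.1 0 (by decide), hn]
    refine run_setNat ⟨by simp, ?_⟩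
    simp [h, e0]
    ring
  · intro T1 s1 hT1 hF1 hs1
    have g1 : s1.real = s.real := funext fun a => hF1.2 a (by simp [Cmd.reals])
    refine run_seq (run_frame ((run_extremes (n := n) (d := distMatrix p) s1 ?_ ?_ ?_ ?_).mono ?_))
    · rw [hF1.1 0 (by decide), hn]
    · rw [g1, hd]
    · rw [g1, h11]
    · rw [g1, h12]
    rintro T2 s2 ⟨hT2, h1, h2, h3⟩ hF2
    have hlt : ∀ {x y}, 0 < distMatrix p x y → x < n ∧ y < n := by
      intro x y h
      by_contra hne
      rw [distMatrix, dif_neg hne] at h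
      exact lt_irrefl _ h
    refine run_setReal ⟨?_, ?_, s2.real 11 0 0, s2.real 12 0 0, h1, h2, ?_, ?_, ?_⟩
    · simp only [NExpr.cost, RExpr.cost, nv, rv]
      have : n * (n * 100 + 68) = n * (n * 100 + 28) + n * 40 := by ring
      omega
    · rw [State.setReal_nat, hF2.1 28 (by decide), hs1]
    · intro x y
      by_cases h : 0 < distMatrix p x y
      · exact (h3 x (hlt h).1 y (hlt h).2).1
      · exact (not_lt.mp h).trans h1
    · intro x y h
      exact (h3 x (hlt h).1 y (hlt h).2).2 h
    · have e0 : s2.nat 0 0 0 = n := by rw [hF2.1 0 (by decide), hF1.1 0 (by decide), hn]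
      have e2 : s2.nat 2 0 0 = r := by rw [hF2.1 2 (by decide), hF1.1 2 (by decide), hr]
      simp [e0, e2]

/-- Program for `MetricGraph.edgeMatrix`. -/
def initGraph : Cmd :=
  forLoop2 20 21 0 (.cond (.conj (.neg (.natLt (nv 20) (nv 21))) (.neg (.natLt (nv 21) (nv 20))))
    (.setReal 2 (nv 20) (nv 21) (.ofNat (.lit 0)))
    (.cond (.natLt (.lit 0) (.get 3 (nv 20) (nv 21)))
      (.setReal 2 (nv 20) (nv 21) (.get 0 (nv 20) (nv 21)))
      (.setReal 2 (nv 20) (nv 21) (rv 10))))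

theorem run_initGraph (s : State) {B : ℝ} (hn : s.nat 0 0 0 = n) (hd : s.real 0 = distMatrix p)
    (hadj : ∀ i j, s.nat 3 i j ≠ 0 ↔ ∃ (hi : i < n) (hj : j < n), G.Adj ⟨i, hi⟩ ⟨j, hj⟩)
    (hB : s.real 10 0 0 = B) (h2 : ∀ x y, s.real 2 x y = 0) :
    Run initGraph s fun T s' => T ≤ n * (n * 100 + 28) + 12 ∧ s'.real 2 = edgeMatrix p G B := by
  refine run_forLoop2 (fun s => s.real 2) n 84 (edgeMatrix p G B) hn (by decide) (by decide)
    (by decide) (fun _ _ _ _ => rfl) ?_ ?_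
  · intro x y s' hx hy hF hi hj _ _
    have e3 : s'.nat 3 = s.nat 3 := hF.1 3 (by decide)
    have e0 : s'.real 0 = distMatrix p := by rw [hF.2 0 (by decide), hd]
    have e10 : s'.real 10 0 0 = B := by rw [hF.2 10 (by decide), hB]
    have key : ∀ v, v = edgeMatrix p G B x y → ∀ x' y', (s'.setReal 2 x y v).real 2 x' y' =
        if x' = x ∧ y' = y then edgeMatrix p G B x y else s'.real 2 x' y' := by
      rintro v rfl x' y'
      simp
    refine run_cond (fun hc => run_setReal ?_) (fun hc => run_cond (fun hc' => run_setReal ?_)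
      (fun hc' => run_setReal ?_))
    · have hxy : x = y := by
        simp [hi, hj] at hc
        omega
      simp only [RExpr.eval, NExpr.eval, nv, hi, hj]
      exact ⟨by simp, key _ (by simp [edgeMatrix, hy, hxy])⟩
    all_goals
      have hxy : x ≠ y := by
        simp [hi, hj] at hc
        omega
      simp only [BExpr.holds, NExpr.eval, nv, hi, hj, e3, Nat.pos_iff_ne_zero, hadj] at hc'
    · simp only [RExpr.eval, NExpr.eval, nv, hi, hj, e0]
      exact ⟨by simp, key _ (by rw [edgeMatrix, if_pos ⟨hx, hy⟩, if_neg hxy, if_pos hc'])⟩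
    · simp only [RExpr.eval, NExpr.eval, nv, rv, hi, hj, e10]
      exact ⟨by simp, key _ (by rw [edgeMatrix, if_pos ⟨hx, hy⟩, if_neg hxy, if_neg hc'])⟩
  · intro T s' hT _ h
    refine ⟨hT, h.trans ?_⟩
    funext x y
    split_ifs with hxy
    · rfl
    · rw [h2, edgeMatrix, if_neg hxy]

/-- The Floyd–Warshall algorithm. -/
def floydWarshall : Cmd := forLoop 22 0 (relax 2 22 22)

theorem run_floydWarshall (s : State) {B : ℝ} (hn : s.nat 0 0 0 = n)
    (hB : ∀ x y, distMatrix p x y ≤ B) (h2 : s.real 2 = edgeMatrix p G B) :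
    Run floydWarshall s fun T s' => T ≤ n * (n * (n * 100 + 28) + 28) + 12 ∧
      IsGraphDist p G (s'.real 2) B := by
  refine run_forLoop_le n (n * (n * 100 + 28) + 12)
    (fun m s' => s'.real 2 = floyd n (edgeMatrix p G B) m) hn (by decide) (by decide) (by decide)
    (fun _ _ _ h => h) h2 ?_ ?_
  · intro m s' hm hF hms hI
    have e0 : s'.nat 0 0 0 = n := by rw [hF.1 0 (by decide), hn]
    refine (run_relax s' e0 (by decide) (by decide) hms hms ?_).mono ?_
    · rw [hI]
      exact (floydInv_floyd hB hm.le).nonneg hm hm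
    · rintro T s'' ⟨hT, h⟩
      exact ⟨hT, by rw [h, hI, floyd]⟩
  · intro T s' hT _ hI
    exact ⟨hT, by rw [hI]; exact isGraphDist_floyd hB⟩

end RealRAM

/-! ### The program for the approximation of the optimal dilation -/

namespace RealRAM

open MetricGraph

variable {M : Type*} [MetricSpace M] {n : ℕ} {p : Fin n ↪ M} {G : SimpleGraph (Fin n)}
  {k r : ℕ} {B : ℝ} {D : ℕ → ℕ → ℝ} {eu ev : ℕ → ℕ}

/-- Program for one step of the coarse phase: if the pair is not connected by free edges, then it
becomes free, and its ratio is recorded. -/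
def ratioStep : Cmd :=
  .seq (setN 24 (.get 10 (nv 23) (.lit 0))) (.seq (setN 25 (.get 11 (nv 23) (.lit 0)))
    (.cond (.realLt (.ofNat (.lit 0)) (.get 6 (nv 24) (nv 25)))
      (.seq (.setReal 7 (nv 41) (.lit 0) (.div (.get 6 (nv 24) (nv 25)) (.get 0 (nv 24) (nv 25))))
        (.seq (setN 41 (.add (nv 41) (.lit 1))) (.seq (relax 6 24 25) (relax 6 25 24)))) .skip))

/-- The state of the coarse phase after `q` pairs. -/
structure CoarseState (p : Fin n ↪ M) (G : SimpleGraph (Fin n)) (k r : ℕ) (B : ℝ) (D : ℕ → ℕ → ℝ)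
    (eu ev : ℕ → ℕ) (q : ℕ) (s : State) (z : ℕ → Fin n × Fin n) : Prop where
  prepared : Prepared p G k r B D eu ev s
  inv : CoarseInv p G B eu ev q (s.real 6) (s.nat 41 0 0) (fun j => s.real 7 j 0) z

theorem run_ratioStep (s : State) {q : ℕ} {z : ℕ → Fin n × Fin n} (hB : 0 < B)
    (h : CoarseState p G k r B D eu ev q s z) (hq : q < n * n) (hqs : s.nat 23 0 0 = q) :
    Run ratioStep s fun T s' => s.nat 41 0 0 ≤ s'.nat 41 0 0 ∧
      T + s.nat 41 0 0 * (n * (n * 200 + 56) + 60) ≤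
        s'.nat 41 0 0 * (n * (n * 200 + 56) + 60) + 60 ∧
      ∃ z', CoarseState p G k r B D eu ev (q + 1) s' z' := by
  have hun := h.prepared.sorted.fst_lt hq
  have hvn := h.prepared.sorted.snd_lt hq
  refine run_seq (run_setNat (run_seq (run_setNat ?_)))
  simp only [nv, NExpr.eval, NExpr.cost, hqs, State.setNat_nat_apply]
  norm_num only [hqs, and_self, false_and, if_false, h.prepared.fst, h.prepared.snd]
  set s1 := (s.setNat 24 0 0 (eu q)).setNat 25 0 0 (ev q) with hs1
  have f1 : ∀ a, a ∉ [24, 25] → s1.nat a = s.nat a := fun a ha => by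
    simp only [List.mem_cons, List.not_mem_nil, or_false, not_or] at ha
    rw [hs1, State.setNat_nat_of_ne _ ha.2, State.setNat_nat_of_ne _ ha.1]
  have hp1 : Prepared p G k r B D eu ev s1 :=
    h.prepared.of_frame (K := [24, 25]) (L := []) ⟨f1, fun _ _ => rfl⟩ (by decide) (by decide)
  have hu1 : s1.nat 24 0 0 = eu q := by simp [hs1]
  have hv1 : s1.nat 25 0 0 = ev q := by simp [hs1]
  have f41 : s1.nat 41 = s.nat 41 := f1 41 (by decide)
  have g1 : s1.real = s.real := rfl
  refine run_cond (fun hc => ?_) (fun hc => run_skip ?_)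
  · simp only [BExpr.holds, RExpr.eval, NExpr.eval, hu1, hv1, g1, Nat.cast_zero] at hc
    refine run_seq (run_setReal (run_seq (run_setNat ?_)))
    simp only [NExpr.eval, NExpr.cost, RExpr.eval, RExpr.cost, BExpr.cost, hu1, hv1, g1,
      State.setReal_nat, f41, h.prepared.dist]
    set m := s.nat 41 0 0 with hm
    set s2 := (s1.setReal 7 m 0 (s.real 6 (eu q) (ev q) / distMatrix p (eu q) (ev q))).setNat 41 0 0
      (m + 1) with hs2
    have hF2 : Frame [41] [7] s1 s2 :=
      ⟨fun a ha => State.setNat_nat_of_ne _ (by simpa using ha), fun a ha => by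
        rw [hs2, State.setNat_real, State.setReal_real_of_ne _ (by simpa using ha)]⟩
    have hp2 := hp1.of_frame hF2 (by decide) (by decide)
    have hu2 : s2.nat 24 0 0 = eu q := by rw [hF2.1 24 (by decide), hu1]
    have hv2 : s2.nat 25 0 0 = ev q := by rw [hF2.1 25 (by decide), hv1]
    have g2 : s2.real 6 = s.real 6 := hF2.2 6 (by decide)
    refine run_seq (run_frame ((run_relax s2 hp2.nat_n (by decide) (by decide) hu2 hv2 ?_).mono ?_))
    · rw [g2]; exact h.inv.pseudo.nonneg hvn hun
    rintro T3 s3 ⟨hT3, hW3⟩ hF3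
    have hp3 := hp2.of_frame hF3 (by decide) (by decide)
    have hu3 : s3.nat 24 0 0 = eu q := by rw [hF3.1 24 (by decide), hu2]
    have hv3 : s3.nat 25 0 0 = ev q := by rw [hF3.1 25 (by decide), hv2]
    refine run_frame ((run_relax s3 hp3.nat_n (by decide) (by decide) hv3 hu3 ?_).mono ?_)
    · rw [hW3, g2, relaxed, if_pos ⟨hun, hvn⟩, h.inv.pseudo.self hun, h.inv.pseudo.self hvn]
      exact le_min hc.le (by norm_num)
    rintro T4 s4 ⟨hT4, hW4⟩ hF4
    have hp4 := hp3.of_frame hF4 (by decide) (by decide)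
    have e41 : s4.nat 41 0 0 = m + 1 := by
      rw [hF4.1 41 (by decide), hF3.1 41 (by decide)]
      simp [hs2]
    have e7 : s4.real 7 = s2.real 7 := (hF4.2 7 (by decide)).trans (hF3.2 7 (by decide))
    refine ⟨by omega, ?_, fun j => if j = m then (⟨eu q, hun⟩, ⟨ev q, hvn⟩) else z j, hp4, ?_⟩
    · rw [e41, add_mul]
      have : n * (n * 200 + 56) = 2 * (n * (n * 100 + 28)) := by ring
      omega
    · have hchoose := h.inv.choose h.prepared.sorted hq (u := ⟨eu q, hun⟩) (v := ⟨ev q, hvn⟩) rfl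
        rfl hc (T' := fun j => s4.real 7 j 0) (fun j hj => ?_) ?_
      · rw [e41, hW4, hW3, g2]
        exact hchoose
      · simp only [e7, hs2, State.setNat_real, State.setReal_real_apply]
        rw [if_neg (by omega), g1]
      · simp [e7, hs2, hm]
  · simp only [BExpr.holds, RExpr.eval, NExpr.eval, hu1, hv1, g1, Nat.cast_zero] at hc
    refine ⟨by rw [f41], ?_, z, hp1, ?_⟩
    · simp only [f41, BExpr.cost, RExpr.cost, NExpr.cost]
      omega
    · rw [f41, g1]
      exact h.inv.skip hB h.prepared.sorted hq hc

/-- Program for the coarse phase. -/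
def ratios : Cmd :=
  .seq (forLoop2 20 21 0 (.setReal 6 (nv 20) (nv 21) (.get 2 (nv 20) (nv 21))))
    (.seq (setN 41 (.lit 0)) (forLoop 23 28 ratioStep))

theorem run_ratios (s : State) (hB : 0 < B) (hn : 1 ≤ n) (h : Prepared p G k r B D eu ev s) :
    Run ratios s fun T s' => T ≤ 1000 * n ^ 3 ∧ s'.nat 41 0 0 ≤ n ∧
      ∃ z, CoarseState p G k r B D eu ev (n * n) s' z := by
  refine run_seq ?_
  refine run_forLoop2 (fun s => s.real 6) n 14 D h.nat_n (by decide) (by decide) (by decide)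
    (fun _ _ _ _ => rfl) ?_ ?_
  · intro x y s' hx hy hF hi hj _ _
    refine run_setReal ⟨by simp, fun x' y' => ?_⟩
    have e2 : s'.real 2 = D := by rw [hF.2 2 (by decide), h.graph]
    simp [hi, hj, e2]
  intro T1 s1 hT1 hF1 hW1
  have hp1 := h.of_frame hF1 (by decide) (by decide)
  refine run_seq (run_setNat ?_)
  simp only [NExpr.eval, NExpr.cost]
  set s2 := s1.setNat 41 0 0 0 with hs2
  have hp2 : Prepared p G k r B D eu ev s2 := hp1.of_frame (K := [41]) (L := [])
    ⟨fun a ha => State.setNat_nat_of_ne _ (by simpa using ha), fun _ _ => rfl⟩ (by decide) (by decide)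
  have hWD : IsGraphDist p G (s2.real 6) B := by
    have e : ∀ {x y}, x < n → y < n → s2.real 6 x y = D x y := fun {x y} hx hy => by
      rw [hs2, State.setNat_real, hW1]
      simp [hx, hy]
    have hD := hp1.isGraphDist
    refine ⟨fun hx hy => ?_, fun hx => ?_, fun hx hy => ?_, fun hx hy hz => ?_, fun {u v} huv => ?_,
      fun hx hy => ?_, fun {u v ℓ} hℓ hle => ?_⟩
    · rw [e hx hy]; exact hD.nonneg hx hy
    · rw [e hx hx]; exact hD.self hx
    · rw [e hx hy, e hy hx]; exact hD.symm hx hy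
    · rw [e hx hy, e hy hz, e hx hz]; exact hD.triangle hx hy hz
    · rw [e u.2 v.2]; exact hD.le_of_adj huv
    · rw [e hx hy]; exact hD.distMatrix_le hx hy
    · rw [e u.2 v.2] at hle; exact hD.graphDist_le hℓ hle
  refine run_forLoop (n * n) (fun q T s' => T ≤ q * 76 + s'.nat 41 0 0 * (n * (n * 200 + 56) + 60) ∧
    ∃ z, CoarseState p G k r B D eu ev q s' z) hp2.nat_sq (by decide) (by decide) (by decide)
    ?_ ⟨by simp, fun _ => (⟨0, hn⟩, ⟨0, hn⟩), hp2, ?_⟩ ?_ ?_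
  · rintro q T s' v ⟨h1, z, h2⟩
    exact ⟨h1, z, h2.prepared.of_frame (K := [23]) (L := [])
      ⟨fun a ha => State.setNat_nat_of_ne _ (by simpa using ha), fun _ _ => rfl⟩ (by decide)
      (by decide), h2.inv⟩
  · have : s2.nat 41 0 0 = 0 := by simp [hs2]
    rw [this]
    exact coarseInv_zero hWD _ _ _ _
  · rintro q T s' hq hF hqs ⟨hT, z, hst⟩
    refine (run_ratioStep s' hB hst hq hqs).mono ?_
    rintro T' s'' ⟨-, hT', h'⟩
    exact ⟨by omega, h'⟩
  · rintro T s' hF ⟨hT, z, hst⟩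
    have hm : s'.nat 41 0 0 ≤ n := (Nat.le_add_right _ _).trans hst.inv.count
    refine ⟨?_, hm, z, hst⟩
    have h1 : s'.nat 41 0 0 * (n * (n * 200 + 56) + 60) ≤ n * (n * (n * 200 + 56) + 60) := by gcongr
    have h2 : n * (n * (n * 200 + 56) + 60) = 200 * n ^ 3 + 56 * n ^ 2 + 60 * n := by ring
    have h3 : n * n * 76 = 76 * n ^ 2 := by ring
    have h4 : n * (n * (14 + 16) + 28) = 30 * n ^ 2 + 28 * n := by ring
    have h6 : n ^ 2 ≤ n ^ 3 := Nat.pow_le_pow_right hn (by norm_num)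
    have h7 : n ≤ n ^ 3 := Nat.le_self_pow (by norm_num) n
    omega

/-- Program for the largest ratio which is exceeded or equalled by more than `k` of the ratios (`0` if
there is none). -/
def selectRatio : Cmd :=
  .seq (setR 18 (.ofNat (.lit 0))) (forLoop 20 41 (.seq (setN 40 (.lit 0)) (.seq
    (forLoop 21 41 (.cond (.neg (.realLt (.get 7 (nv 21) (.lit 0)) (.get 7 (nv 20) (.lit 0))))
      (setN 40 (.add (nv 40) (.lit 1))) .skip))
    (.cond (.conj (.natLt (nv 1) (nv 40)) (.realLt (rv 18) (.get 7 (nv 20) (.lit 0))))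
      (setR 18 (.get 7 (nv 20) (.lit 0))) .skip))))

open Classical in
theorem run_selectRatio (s : State) {m : ℕ} {t : ℕ → ℝ} (hm : s.nat 41 0 0 = m)
    (hk : s.nat 1 0 0 = k) (ht : ∀ j, s.real 7 j 0 = t j) :
    Run selectRatio s fun T s' => T ≤ m * (m * 60 + 100) + 100 ∧ 0 ≤ s'.real 18 0 0 ∧
      (s'.real 18 0 0 = 0 ∨ k < ((Finset.range m).filter fun j => s'.real 18 0 0 ≤ t j).card) ∧
      ((Finset.range m).filter fun j => s'.real 18 0 0 < t j).card ≤ k := by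
  refine run_seq (run_setReal ?_)
  simp only [NExpr.eval, NExpr.cost, RExpr.eval, RExpr.cost, Nat.cast_zero]
  refine run_forLoop_le m (m * 60 + 80) (fun j s' => 0 ≤ s'.real 18 0 0 ∧
      (s'.real 18 0 0 = 0 ∨ k < ((Finset.range m).filter fun j => s'.real 18 0 0 ≤ t j).card) ∧
      ∀ i < j, k < ((Finset.range m).filter fun l => t i ≤ t l).card → t i ≤ s'.real 18 0 0) hm
      (by decide) (by decide) (by decide) (fun _ _ _ h => h) (by simp) ?_ ?_
  · rintro j s' hj hF hjs ⟨h1, h2, h3⟩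
    refine run_seq (run_setNat ?_)
    have e41 : s'.nat 41 0 0 = m := by rw [hF.1 41 (by decide)]; exact hm
    have e1 : s'.nat 1 0 0 = k := by rw [hF.1 1 (by decide)]; exact hk
    have e7 : ∀ i, s'.real 7 i 0 = t i := fun i => by
      rw [hF.2 7 (by decide), State.setReal_real_of_ne _ (by decide), ht]
    simp only [NExpr.eval, NExpr.cost]
    refine run_seq ?_
    refine run_forLoop_le m 40 (fun l s'' => s''.nat 40 0 0 =
      ((Finset.range l).filter fun l => t j ≤ t l).card) ?_ (by decide) (by decide) (by decide)
      (fun _ _ _ h => h) (by simp) ?_ ?_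
    · rw [State.setNat_nat_of_ne _ (by decide), e41]
    · intro l s'' hl hF' hls hI
      have e20 : s''.nat 20 0 0 = j := by
        rw [hF'.1 20 (by decide), State.setNat_nat_of_ne _ (by decide), hjs]
      have e7' : ∀ i, s''.real 7 i 0 = t i := fun i => by
        rw [hF'.2 7 (by decide), State.setNat_real, e7]
      refine run_cond (fun hc => run_setNat ⟨by simp, ?_⟩) (fun hc => run_skip ⟨by simp, ?_⟩)
      · simp only [BExpr.holds, RExpr.eval, NExpr.eval, nv, e20, hls, e7', not_lt] at hc
        rw [Finset.range_add_one, Finset.filter_insert, if_pos hc,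
          Finset.card_insert_of_notMem (by simp)]
        simp [hI]
      · simp only [BExpr.holds, RExpr.eval, NExpr.eval, nv, e20, hls, e7', not_lt] at hc
        rw [Finset.range_add_one, Finset.filter_insert, if_neg hc, hI]
    · intro T1 s1 hT1 hF1 hs1
      have e20 : s1.nat 20 0 0 = j := by
        rw [hF1.1 20 (by decide), State.setNat_nat_of_ne _ (by decide), hjs]
      have e1' : s1.nat 1 0 0 = k := by
        rw [hF1.1 1 (by decide), State.setNat_nat_of_ne _ (by decide), e1]
      have e7' : ∀ i, s1.real 7 i 0 = t i := fun i => by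
        rw [hF1.2 7 (by decide), State.setNat_real, e7]
      have e18 : s1.real 18 = s'.real 18 := by rw [hF1.2 18 (by decide), State.setNat_real]
      refine run_cond (fun hc => run_setReal ⟨by simp; omega, ?_⟩)
        (fun hc => run_skip ⟨by simp; omega, ?_⟩)
      · simp only [BExpr.holds, RExpr.eval, NExpr.eval, nv, rv, e20, e1', e7', e18, hs1] at hc
        have e : (s1.setReal 18 0 0 (t j)).real 18 0 0 = t j := by simp
        simp only [RExpr.eval, NExpr.eval, nv, e20, e7', e]
        refine ⟨h1.trans hc.2.le, Or.inr hc.1, fun i hi hki => ?_⟩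
        rcases Nat.lt_succ_iff_lt_or_eq.mp hi with hlt | rfl
        · exact (h3 i hlt hki).trans hc.2.le
        · exact le_rfl
      · simp only [BExpr.holds, RExpr.eval, NExpr.eval, nv, rv, e20, e1', e7', e18, hs1, not_and,
          not_lt] at hc
        rw [e18]
        refine ⟨h1, h2, fun i hi hki => ?_⟩
        rcases Nat.lt_succ_iff_lt_or_eq.mp hi with hlt | rfl
        · exact h3 i hlt hki
        · exact hc hki
  · rintro T s' hT hF ⟨h1, h2, h3⟩
    refine ⟨?_, h1, h2, ?_⟩
    · have : m * (m * 60 + 80 + 16) ≤ m * (m * 60 + 100) := Nat.mul_le_mul_left _ (by omega)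
      omega
    · -- otherwise the smallest ratio above the selected one would have been selected
      by_contra hlt
      have hne : ((Finset.range m).filter fun j => s'.real 18 0 0 < t j).Nonempty :=
        Finset.card_pos.mp (by omega)
      obtain ⟨i, hi, hmin⟩ := Finset.exists_min_image _ t hne
      rw [Finset.mem_filter, Finset.mem_range] at hi
      have := h3 i hi.1 ((not_le.mp hlt).trans_le (Finset.card_le_card fun l hl =>
        Finset.mem_filter.mpr ⟨(Finset.mem_filter.mp hl).1, hmin l hl⟩))
      linarith [hi.2]

end RealRAM

/-! ### Preparation -/

namespace RealRAM

open MetricGraph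

variable {M : Type*} [MetricSpace M] {n : ℕ} {p : Fin n ↪ M} {G : SimpleGraph (Fin n)}
  {k r : ℕ} {B δ : ℝ} {D : ℕ → ℕ → ℝ} {eu ev : ℕ → ℕ}

/-- Program for everything that precedes the search for the dilation. -/
def prepare : Cmd :=
  .seq bounds (.seq initGraph (.seq floydWarshall (.seq (sortRows 2 7) (.seq (sortRows 0 8)
    (.seq mergeRows (.seq ratios selectRatio))))))

/-- The number `τ` is, up to factors of `n`, an estimate of the optimal dilation, and `B` is larger
than all lengths which matter if the optimal dilation is finite. -/
structure IsEstimate (p : Fin n ↪ M) (G : SimpleGraph (Fin n)) (k r : ℕ) (B τ : ℝ) : Prop where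
  le : ∀ t, 0 ≤ t → optDilation p G k ≤ ENNReal.ofReal t → τ ≤ n * t
  optDilation_le : (∀ x y, τ * distMatrix p x y < B) →
    optDilation p G k ≤ ENNReal.ofReal (n * max 1 τ)
  bound : optDilation p G k ≠ ⊤ → ∃ F, 0 ≤ F ∧ optDilation p G k ≤ ENNReal.ofReal F ∧
    ∀ x y, 4 * r * n * F * distMatrix p x y < B

theorem input_adj (p : Fin n ↪ M) (G : SimpleGraph (Fin n)) (k r : ℕ) (δ : ℝ) (i j : ℕ) :
    (input p G k r δ).nat 3 i j ≠ 0 ↔ ∃ (hi : i < n) (hj : j < n), G.Adj ⟨i, hi⟩ ⟨j, hj⟩ := by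
  simp [input]

theorem run_prepare (hn : 1 ≤ n) (hr : 1 ≤ r) :
    Run prepare (input p G k r δ) fun T s' => T ≤ 3000 * n ^ 3 ∧ ∃ B D eu ev,
      Prepared p G k r B D eu ev s' ∧ IsEstimate p G k r B (s'.real 18 0 0) ∧
      s'.real 1 0 0 = δ ∧ ∀ x y, s'.nat 4 x y = 0 := by
  classical
  set s := input p G k r δ with hs
  have i0 : s.nat 0 0 0 = n := by simp [hs, input]
  have i1 : s.nat 1 0 0 = k := by simp [hs, input]
  have i2 : s.nat 2 0 0 = r := by simp [hs, input]
  have id : s.real 0 = distMatrix p := by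
    funext i j
    simp [hs, input, distMatrix]
  have iδ : s.real 1 0 0 = δ := by simp [hs, input]
  refine run_seq (run_frame ((run_bounds (p := p) (r := r) s i0 i2 id (by simp [hs, input])
    (by simp [hs, input]) (by simp [hs, input])).mono ?_))
  rintro T1 s1 ⟨hT1, h28, a, b, ha, hb, hda, hdb, hB⟩ hF1
  set B : ℝ := 1 + a + 4 * r * (n * n) * (a * a) * b with hBdef
  have hr1 : (1 : ℝ) ≤ r := by exact_mod_cast hr
  have hn1 : (1 : ℝ) ≤ n := by exact_mod_cast hn
  have hpos : 0 ≤ 4 * r * (n * n) * (a * a) * b := by positivity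
  have hdB : ∀ x y, distMatrix p x y ≤ B := fun x y => (hda x y).trans (by rw [hBdef]; linarith)
  have hB0 : 0 < B := by rw [hBdef]; linarith
  refine run_seq (run_frame ((run_initGraph (n := n) (p := p) (G := G) (B := B) s1 ?_ ?_ ?_ hB
    ?_).mono ?_))
  · rw [hF1.1 0 (by decide), i0]
  · rw [hF1.2 0 (by decide), id]
  · rw [hF1.1 3 (by decide)]; exact input_adj p G k r δ
  · rw [hF1.2 2 (by decide)]; simp [hs, input]
  rintro T2 s2 ⟨hT2, hE⟩ hF2
  have hF12 : ∀ a, a ∉ bounds.nats → a ∉ initGraph.nats → s2.nat a = s.nat a := fun a h1 h2 =>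
    (hF2.1 a h2).trans (hF1.1 a h1)
  refine run_seq (run_frame ((run_floydWarshall (n := n) (p := p) (G := G) (B := B) s2 ?_ hdB
    hE).mono ?_))
  · rw [hF12 0 (by decide) (by decide), i0]
  rintro T3 s3 ⟨hT3, hD⟩ hF3
  refine run_seq (run_frame ((run_sortRows (n := n) 2 7 s3 ?_ (by decide)).mono ?_))
  · rw [hF3.1 0 (by decide), hF12 0 (by decide) (by decide), i0]
  rintro T4 s4 ⟨hT4, ho4⟩ hF4
  have e0 : s4.nat 0 0 0 = n := by
    rw [hF4.1 0 (by decide), hF3.1 0 (by decide), hF12 0 (by decide) (by decide), i0]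
  refine run_seq (run_frame ((run_sortRows (n := n) 0 8 s4 e0 (by decide)).mono ?_))
  rintro T5 s5 ⟨hT5, ho5⟩ hF5
  -- cells which have not been changed so far
  have f : ∀ a, a ∉ bounds.nats ++ initGraph.nats ++ floydWarshall.nats ++ (sortRows 2 7).nats ++
      (sortRows 0 8).nats → s5.nat a = s.nat a := fun a h => by
    simp only [List.mem_append, not_or] at h
    rw [hF5.1 a h.2, hF4.1 a h.1.2, hF3.1 a h.1.1.2, hF12 a h.1.1.1.1 h.1.1.1.2]
  have g : ∀ a, a ∉ bounds.reals ++ initGraph.reals ++ floydWarshall.reals ++ (sortRows 2 7).reals ++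
      (sortRows 0 8).reals → s5.real a = s.real a := fun a h => by
    simp only [List.mem_append, not_or] at h
    rw [hF5.2 a h.2, hF4.2 a h.1.2, hF3.2 a h.1.1.2, hF2.2 a h.1.1.1.2, hF1.2 a h.1.1.1.1]
  have g0 : s5.real 0 = distMatrix p := by rw [g 0 (by decide), id]
  have g45 : s5.real 0 = s4.real 0 := hF5.2 0 (by decide)
  have e28 : s5.nat 28 0 0 = n * n := by
    rw [hF5.1 28 (by decide), hF4.1 28 (by decide), hF3.1 28 (by decide), hF2.1 28 (by decide), h28]
  refine run_seq (run_frame ((run_mergeRows s5 (n := n) ?_ e28 ?_ ?_).mono ?_))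
  · rw [f 0 (by decide), i0]
  · rw [g45]; exact ho5
  · intro w
    rw [f 9 (by decide)]
    simp [hs, input]
  rintro T6 s6 ⟨hT6, hsort⟩ hF6
  rw [g0] at hsort
  have g2 : s6.real 2 = s3.real 2 := by
    rw [hF6.2 2 (by decide), hF5.2 2 (by decide), hF4.2 2 (by decide)]
  have hp6 : Prepared p G k r B (s3.real 2) (fun i => s6.nat 10 i 0) (fun i => s6.nat 11 i 0) s6 := by
    refine ⟨?_, ?_, ?_, ?_, ?_, g2, hD, ?_, fun _ => rfl, fun _ => rfl, hsort⟩
    · rw [hF6.1 0 (by decide), f 0 (by decide), i0]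
    · rw [hF6.1 1 (by decide), f 1 (by decide), i1]
    · rw [hF6.1 2 (by decide), f 2 (by decide), i2]
    · rw [hF6.1 28 (by decide), e28]
    · rw [hF6.2 0 (by decide), g0]
    · rw [hF6.1 7 (by decide), hF5.1 7 (by decide)]
      exact ho4
  refine run_seq (run_frame ((run_ratios s6 hB0 hn hp6).mono ?_))
  rintro T7 s7 ⟨hT7, hm, z, hst⟩ hF7
  refine run_frame ((run_selectRatio (k := k) (m := s7.nat 41 0 0) (t := fun j => s7.real 7 j 0) s7
    rfl hst.prepared.nat_k fun _ => rfl).mono ?_)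
  rintro T8 s8 ⟨hT8, -, h1, h2⟩ hF8
  refine ⟨?_, B, _, _, _, hst.prepared.of_frame hF8 (by decide) (by decide), ⟨?_, ?_, ?_⟩,
    ?_, ?_⟩
  · have q0 : s7.nat 41 0 0 * (s7.nat 41 0 0 * 60 + 100) ≤ n * (n * 60 + 100) := by gcongr
    have q1 : n * (n * 60 + 100) = 60 * n ^ 2 + 100 * n := by ring
    have q2 : n * n * (100 * n + 100) = 100 * n ^ 3 + 100 * n ^ 2 := by ring
    have q3 : n * (n * (80 * n + 50) + 28) = 80 * n ^ 3 + 50 * n ^ 2 + 28 * n := by ring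
    have q4 : n * (n * (n * 100 + 28) + 28) = 100 * n ^ 3 + 28 * n ^ 2 + 28 * n := by ring
    have q5 : n * (n * 100 + 28) = 100 * n ^ 2 + 28 * n := by ring
    have q6 : n * (n * 100 + 68) = 100 * n ^ 2 + 68 * n := by ring
    have h6 : n ^ 2 ≤ n ^ 3 := Nat.pow_le_pow_right hn (by norm_num)
    have h7 : n ≤ n ^ 3 := Nat.le_self_pow (by norm_num) n
    omega
  · intro t ht hopt
    rcases h1 with h1 | h1
    · rw [h1]; positivity
    · obtain ⟨S, hS, hdil⟩ := exists_dilation_le_of_optDilation_le p hopt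
      exact hst.inv.le_of_card ht h1 hS hdil
  · intro hτ
    exact hst.inv.optDilation_le hsort h2 hτ
  · intro hne
    refine ⟨n * (a * b), by positivity, ?_, fun x y => ?_⟩
    · obtain ⟨S, hS, hdil⟩ := exists_dilation_le_of_optDilation_le p (le_refl (optDilation p G k))
      exact (optDilation_le p hS).trans (dilation_le_of_ne_top (ne_top_of_le_ne_top hne hdil) hda hdb)
    · have h3 : 4 * r * n * (n * (a * b)) * distMatrix p x y ≤ 4 * r * n * (n * (a * b)) * a :=
        mul_le_mul_of_nonneg_left (hda x y) (by positivity)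
      have h4 : 4 * r * n * (n * (a * b)) * a = 4 * r * (n * n) * (a * a) * b := by ring
      rw [hBdef]
      linarith
  · rw [hF8.2 1 (by decide), hF7.2 1 (by decide), hF6.2 1 (by decide), g 1 (by decide), iδ]
  · intro x y
    rw [hF8.1 4 (by decide), hF7.1 4 (by decide), hF6.1 4 (by decide), f 4 (by decide)]
    simp [hs, input]

end RealRAM

/-! ### The search for the dilation -/

namespace RealRAM

open MetricGraph

variable {M : Type*} [MetricSpace M] {n : ℕ} {p : Fin n ↪ M} {G : SimpleGraph (Fin n)}
  {k r : ℕ} {B δ τ : ℝ} {D : ℕ → ℕ → ℝ} {eu ev : ℕ → ℕ}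

/-- The state of the search: the real arrays `13`, `14` contain a lower bound `lo` of the optimal
dilation and a dilation `hi`, which is the one achieved, up to the factor `2 * r`, by the edges in the
integer array `4`, or, before the first success, the one tried last. -/
structure SearchState (p : Fin n ↪ M) (G : SimpleGraph (Fin n)) (k r : ℕ) (B δ : ℝ)
    (D : ℕ → ℕ → ℝ) (eu ev : ℕ → ℕ) (s : State) (lo hi : ℝ) : Prop where
  prepared : Prepared p G k r B D eu ev s
  delta : s.real 1 0 0 = δ
  lower : s.real 13 0 0 = lo
  upper : s.real 14 0 0 = hi
  one_le : 1 ≤ lo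
  le : lo ≤ hi
  le_two_mul : hi ≤ 2 * lo
  lo_le : ENNReal.ofReal lo ≤ optDilation p G k

/-- The last attempt has failed, and no attempt has been successful. -/
def NoSuccess (p : Fin n ↪ M) (G : SimpleGraph (Fin n)) (k : ℕ) (s : State) (hi : ℝ) : Prop :=
  s.nat 30 0 0 = 0 ∧ (∀ x y, s.nat 4 x y = 0) ∧ ENNReal.ofReal hi ≤ optDilation p G k

theorem SearchState.of_frame {s s' : State} {K L : List ℕ} {lo hi : ℝ}
    (h : SearchState p G k r B δ D eu ev s lo hi) (hF : Frame K L s s')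
    (hK : ∀ a ∈ [0, 1, 2, 28, 7, 10, 11], a ∉ K) (hL : ∀ a ∈ [0, 2, 1, 13, 14], a ∉ L) :
    SearchState p G k r B δ D eu ev s' lo hi where
  prepared := h.prepared.of_frame hF hK fun a ha => hL a (by
    simp only [List.mem_cons, List.not_mem_nil, or_false] at ha ⊢
    omega)
  delta := by rw [hF.2 _ (hL _ (by decide)), h.delta]
  lower := by rw [hF.2 _ (hL _ (by decide)), h.lower]
  upper := by rw [hF.2 _ (hL _ (by decide)), h.upper]
  one_le := h.one_le
  le := h.le
  le_two_mul := h.le_two_mul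
  lo_le := h.lo_le

/-- Program for the first attempt. -/
def searchInit : Cmd :=
  .seq (setR 21 (.div (rv 18) (.ofNat (nv 0))))
    (.seq (.cond (.realLt (rv 21) (.ofNat (.lit 1))) (setR 21 (.ofNat (.lit 1))) .skip)
      (.seq (setR 13 (rv 21)) (.seq (setR 14 (rv 21)) (.seq (setR 15 (rv 21)) attempt))))

theorem run_searchInit (s : State) (hn : 2 ≤ n) (hr : 1 ≤ r) (h : Prepared p G k r B D eu ev s)
    (hτ : IsEstimate p G k r B τ) (h18 : s.real 18 0 0 = τ) (hδ : s.real 1 0 0 = δ)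
    (h4 : ∀ x y, s.nat 4 x y = 0) :
    Run searchInit s fun T s' => T ≤ 2100 * r * n ^ 3 ∧ s'.real 21 0 0 = max 1 (τ / n) ∧
      SearchState p G k r B δ D eu ev s' (max 1 (τ / n)) (max 1 (τ / n)) ∧
      (NoSuccess p G k s' (max 1 (τ / n)) ∨
        s'.nat 30 0 0 = 1 ∧ IsGood p G k r B (max 1 (τ / n)) (s'.nat 4)) := by
  set t₀ := max 1 (τ / n) with ht₀
  have hn0 : (0 : ℝ) < n := by exact_mod_cast (by omega : 0 < n)
  have h1 : 1 ≤ t₀ := le_max_left _ _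
  have hopt : ENNReal.ofReal t₀ ≤ optDilation p G k := by
    by_cases htop : optDilation p G k = ⊤
    · rw [htop]; exact le_top
    · have e := ENNReal.ofReal_toReal htop
      rw [← e]
      refine ENNReal.ofReal_le_ofReal (max_le ?_ ?_)
      · rw [← ENNReal.ofReal_le_ofReal_iff ENNReal.toReal_nonneg, e, ENNReal.ofReal_one]
        exact one_le_optDilation p hn k
      · rw [div_le_iff₀ hn0, mul_comm]
        exact hτ.le _ ENNReal.toReal_nonneg e.ge
  refine run_seq (run_setReal (run_seq (Run.mono (Q := fun T s' => T ≤ 20 ∧ s'.nat = s.nat ∧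
    (∀ a, a ≠ 21 → s'.real a = s.real a) ∧ s'.real 21 0 0 = t₀) ?_ ?_)))
  · have e21 : s.real 18 0 0 / (s.nat 0 0 0 : ℝ) = τ / n := by rw [h18, h.nat_n]
    simp only [nv, rv, NExpr.eval, RExpr.eval, e21]
    refine run_cond (fun hc => run_setReal ?_) (fun hc => run_skip ?_)
    · simp only [BExpr.holds, RExpr.eval, NExpr.eval, State.setReal_real_apply, and_self, if_true,
        Nat.cast_one] at hc
      refine ⟨by simp, rfl, fun a ha => ?_, ?_⟩
      · rw [State.setReal_real_of_ne _ ha, State.setReal_real_of_ne _ ha]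
      · simp [ht₀, max_eq_left hc.le]
    · simp only [BExpr.holds, RExpr.eval, NExpr.eval, State.setReal_real_apply, and_self, if_true,
        Nat.cast_one, not_lt] at hc
      refine ⟨by simp, rfl, fun a ha => ?_, ?_⟩
      · rw [State.setReal_real_of_ne _ ha]
      · simp [ht₀, max_eq_right hc]
  rintro T1 s1 ⟨hT1, f1, g1, h21⟩
  refine run_seq (run_setReal (run_seq (run_setReal (run_seq (run_setReal ?_)))))
  simp only [nv, rv, NExpr.eval, NExpr.cost, RExpr.eval, RExpr.cost, State.setReal_real_apply]
  norm_num only [h21, and_self, false_and, if_false]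
  set s2 := ((s1.setReal 13 0 0 t₀).setReal 14 0 0 t₀).setReal 15 0 0 t₀ with hs2
  have hF : Frame [] [13, 14, 15, 21] s s2 := by
    refine ⟨fun a _ => congrFun f1 a, fun a ha => ?_⟩
    simp only [List.mem_cons, List.not_mem_nil, or_false, not_or] at ha
    rw [hs2, State.setReal_real_of_ne _ ha.2.2.1, State.setReal_real_of_ne _ ha.2.1,
      State.setReal_real_of_ne _ ha.1, g1 _ ha.2.2.2]
  have hst : SearchState p G k r B δ D eu ev s2 t₀ t₀ := by
    refine ⟨h.of_frame hF (by decide) (by decide), ?_, ?_, ?_, h1, le_rfl, by linarith, hopt⟩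
    · rw [hF.2 1 (by decide), hδ]
    · simp [hs2]
    · simp [hs2]
  have h15 : s2.real 15 0 0 = t₀ := by simp [hs2]
  have h21' : s2.real 21 0 0 = t₀ := by simp [hs2, h21]
  refine run_frame ((run_attempt s2 hst.prepared hr h1 (by omega) h15).mono ?_)
  rintro T s' ⟨hT, -, hres⟩ hF'
  refine ⟨?_, ?_, hst.of_frame hF' (by decide) (by decide), ?_⟩
  · have h8 : 1 * 1 ≤ r * n ^ 3 := Nat.mul_le_mul hr (Nat.one_le_pow _ _ (by omega))
    simp only [mul_assoc] at *
    omega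
  · rw [hF'.2 21 (by decide), h21']
  · rcases hres with ⟨h30, e4, hle⟩ | hres
    · refine Or.inl ⟨h30, fun x y => ?_, hle⟩
      rw [e4, hF.1 4 (by decide), h4]
    · exact Or.inr hres

/-- Program which doubles the dilation until an attempt is successful or an upper bound of all finite
optimal dilations is exceeded. -/
def doubling : Cmd :=
  .loop (.conj (.natLt (nv 30) (.lit 1))
      (.neg (.realLt (.mul (.mul (.ofNat (nv 0)) (.ofNat (nv 0))) (rv 21)) (rv 14))))
    (.seq (setR 13 (rv 14)) (.seq (setR 14 (.add (rv 14) (rv 14)))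
      (.seq (setR 15 (rv 14)) attempt)))

theorem run_doubling (s : State) (hn : 1 ≤ n) (hr : 1 ≤ r) {t₀ : ℝ} (h21 : s.real 21 0 0 = t₀)
    (hst : SearchState p G k r B δ D eu ev s t₀ t₀)
    (hs : NoSuccess p G k s t₀ ∨ s.nat 30 0 0 = 1 ∧ IsGood p G k r B t₀ (s.nat 4)) :
    Run doubling s fun T s' => T ≤ (Nat.log 2 (n * n) + 2) * (2100 * r * n ^ 3) ∧
      ∃ lo hi, SearchState p G k r B δ D eu ev s' lo hi ∧
        (NoSuccess p G k s' hi ∧ n * n * t₀ < hi ∨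
          s'.nat 30 0 0 = 1 ∧ IsGood p G k r B hi (s'.nat 4)) := by
  have h8 : 1 * 1 ≤ r * n ^ 3 := Nat.mul_le_mul hr (Nat.one_le_pow _ _ hn)
  have ht₀ : 1 ≤ t₀ := hst.one_le
  refine run_loop (Nat.log 2 (n * n) + 1) (fun j T s' => j ≤ Nat.log 2 (n * n) + 1 ∧
    T ≤ j * (2100 * r * n ^ 3) ∧
    ∃ lo, SearchState p G k r B δ D eu ev s' lo (t₀ * 2 ^ j) ∧
      (NoSuccess p G k s' (t₀ * 2 ^ j) ∨ s'.nat 30 0 0 = 1 ∧ IsGood p G k r B (t₀ * 2 ^ j) (s'.nat 4)))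
    ⟨Nat.zero_le _, by simp, t₀, by simpa using hst, by simpa using hs⟩ ?_ ?_
  · rintro j T s' hF ⟨-, hT, lo, hst', hs'⟩ hb
    have e21 : s'.real 21 0 0 = t₀ := by rw [hF.2 21 (by decide), h21]
    simp only [BExpr.holds, RExpr.eval, NExpr.eval, nv, rv, hst'.prepared.nat_n, hst'.upper, e21,
      not_lt, Nat.lt_one_iff] at hb
    have hns : NoSuccess p G k s' (t₀ * 2 ^ j) := by
      rcases hs' with hs' | hs'
      · exact hs'
      · omega
    have hjlt : j < Nat.log 2 (n * n) + 1 := by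
      have h1 : (2 : ℝ) ^ j ≤ n * n := by
        have h2 : t₀ * 2 ^ j ≤ t₀ * (n * n) := by linarith [hb.2]
        exact le_of_mul_le_mul_left h2 (by linarith)
      have h2 : 2 ^ j ≤ n * n := by exact_mod_cast h1
      exact Nat.lt_succ_of_le (Nat.le_log_of_pow_le (by norm_num) h2)
    refine ⟨hjlt, ?_⟩
    set hi := t₀ * 2 ^ j with hhi
    have hi1 : 1 ≤ hi := hst'.one_le.trans hst'.le
    have e2 : t₀ * 2 ^ (j + 1) = hi + hi := by rw [hhi, pow_succ]; ring
    rw [e2]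
    refine run_seq (run_setReal (run_seq (run_setReal (run_seq (run_setReal ?_)))))
    simp only [nv, rv, NExpr.eval, NExpr.cost, RExpr.eval, RExpr.cost, BExpr.cost,
      State.setReal_real_apply]
    norm_num only [hst'.upper, and_self, false_and, if_false]
    set s2 := ((s'.setReal 13 0 0 hi).setReal 14 0 0 (hi + hi)).setReal 15 0 0 (hi + hi) with hs2
    have hF2 : Frame [] [13, 14, 15] s' s2 := by
      refine ⟨fun a _ => rfl, fun a ha => ?_⟩
      simp only [List.mem_cons, List.not_mem_nil, or_false, not_or] at ha
      rw [hs2, State.setReal_real_of_ne _ ha.2.2, State.setReal_real_of_ne _ ha.2.1,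
        State.setReal_real_of_ne _ ha.1]
    have hst2 : SearchState p G k r B δ D eu ev s2 hi (hi + hi) := by
      refine ⟨hst'.prepared.of_frame hF2 (by decide) (by decide), ?_, ?_, ?_, hi1, by linarith,
        by linarith, hns.2.2⟩
      · rw [hF2.2 1 (by decide), hst'.delta]
      · simp [hs2]
      · simp [hs2]
    have h15 : s2.real 15 0 0 = hi + hi := by simp [hs2]
    refine run_frame ((run_attempt s2 hst2.prepared hr (by linarith : 1 ≤ hi + hi) hn h15).mono ?_)
    rintro T' s3 ⟨hT', -, hres⟩ hF3
    refine ⟨hjlt, ?_, hi, hst2.of_frame hF3 (by decide) (by decide), ?_⟩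
    · rw [add_mul]
      simp only [mul_assoc] at *
      omega
    · rcases hres with ⟨h30, e4, hle⟩ | hres
      · refine Or.inl ⟨h30, fun x y => ?_, hle⟩
        rw [e4, hF2.1 4 (by decide), hns.2.1]
      · exact Or.inr hres
  · rintro j T s' hF ⟨hj, hT, lo, hst', hs'⟩ hb
    have e21 : s'.real 21 0 0 = t₀ := by rw [hF.2 21 (by decide), h21]
    simp only [BExpr.holds, RExpr.eval, NExpr.eval, nv, rv, hst'.prepared.nat_n, hst'.upper, e21,
      not_lt, Nat.lt_one_iff, not_and, not_le] at hb
    refine ⟨?_, lo, _, hst', ?_⟩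
    · have h1 : j * (2100 * r * n ^ 3) ≤ (Nat.log 2 (n * n) + 1) * (2100 * r * n ^ 3) := by gcongr
      have h2 : (Nat.log 2 (n * n) + 2) * (2100 * r * n ^ 3) =
        (Nat.log 2 (n * n) + 1) * (2100 * r * n ^ 3) + 2100 * (r * n ^ 3) := by ring
      simp only [BExpr.cost, NExpr.cost, RExpr.cost, nv, rv]
      omega
    · rcases hs' with hs' | hs'
      · exact Or.inl ⟨hs', hb hs'.1⟩
      · exact Or.inr hs'

/-- Program for the bisection after a successful attempt. -/
def bisection : Cmd :=
  .cond (.natLt (.lit 0) (nv 30))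
    (.loop (.realLt (.add (rv 13) (.mul (rv 1) (rv 13))) (rv 14))
      (.seq (setR 15 (.div (.add (rv 13) (rv 14)) (.ofNat (.lit 2)))) (.seq attempt
        (.cond (.natLt (.lit 0) (nv 30)) (setR 14 (rv 15)) (setR 13 (rv 15)))))) .skip

/-- As `hi - lo ≤ lo` at the beginning and `lo` does not decrease, `j` rounds reduce `hi - lo` to at
most `lo / 2 ^ j`. -/
theorem run_bisection (s : State) (hn : 1 ≤ n) (hr : 1 ≤ r) (hδ : 0 < δ) {lo hi : ℝ}
    (hst : SearchState p G k r B δ D eu ev s lo hi) (h30 : s.nat 30 0 0 = 1)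
    (hgood : IsGood p G k r B hi (s.nat 4)) :
    Run bisection s fun T s' => T ≤ (⌈Real.logb 2 (1 / δ)⌉₊ + 1) * (2100 * r * n ^ 3) ∧
      ∃ lo hi, SearchState p G k r B δ D eu ev s' lo hi ∧ hi ≤ (1 + δ) * lo ∧
        IsGood p G k r B hi (s'.nat 4) := by
  have h8 : 1 * 1 ≤ r * n ^ 3 := Nat.mul_le_mul hr (Nat.one_le_pow _ _ hn)
  refine run_cond (fun _ => ?_) (fun hc => ?_)
  swap
  · simp [h30] at hc
  refine run_loop ⌈Real.logb 2 (1 / δ)⌉₊ (fun j T s' => j ≤ ⌈Real.logb 2 (1 / δ)⌉₊ ∧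
    T ≤ j * (2100 * r * n ^ 3) ∧
    ∃ lo' hi', lo ≤ lo' ∧ (hi' - lo') * 2 ^ j ≤ lo ∧ SearchState p G k r B δ D eu ev s' lo' hi' ∧
      IsGood p G k r B hi' (s'.nat 4))
    ⟨Nat.zero_le _, by simp, lo, hi, le_rfl, by linarith [hst.le_two_mul], hst, hgood⟩ ?_ ?_
  · rintro j T s' hF ⟨-, hT, lo', hi', hlo, hdiff, hst', hgood'⟩ hb
    simp only [BExpr.holds, RExpr.eval, NExpr.eval, rv, hst'.lower, hst'.upper, hst'.delta] at hb
    have hjlt : j < ⌈Real.logb 2 (1 / δ)⌉₊ := by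
      rw [Nat.lt_ceil, Real.lt_logb_iff_rpow_lt (by norm_num) (by positivity), Real.rpow_natCast,
        lt_div_iff₀ hδ]
      have h1 : δ * lo ≤ δ * lo' := mul_le_mul_of_nonneg_left hlo hδ.le
      have h2 : δ * lo * 2 ^ j < lo :=
        lt_of_lt_of_le (mul_lt_mul_of_pos_right (by linarith) (by positivity)) hdiff
      have h3 : 0 < lo := by linarith [hst.one_le]
      have h4 : (2 ^ j * δ) * lo < 1 * lo := by linarith
      exact lt_of_mul_lt_mul_right h4 h3.le
    refine ⟨hjlt, run_seq (run_setReal ?_)⟩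
    simp only [rv, NExpr.eval, NExpr.cost, RExpr.eval, RExpr.cost, hst'.lower, hst'.upper]
    set t := (lo' + hi') / ((2 : ℕ) : ℝ) with ht
    have ht2 : 2 * t = lo' + hi' := by rw [ht]; push_cast; ring
    have h1 := hst'.one_le
    have h2 := hst'.le
    have h3 := hst'.le_two_mul
    set s2 := s'.setReal 15 0 0 t with hs2
    have hF2 : Frame [] [15] s' s2 :=
      ⟨fun a _ => rfl, fun a ha => State.setReal_real_of_ne _ (by simpa using ha)⟩
    have hst2 := hst'.of_frame hF2 (by decide) (by decide)
    have h15 : s2.real 15 0 0 = t := by simp [hs2]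
    refine run_seq (run_frame ((run_attempt s2 hst2.prepared hr (by linarith : 1 ≤ t) hn h15).mono
      ?_))
    rintro T' s3 ⟨hT', -, hres⟩ hF3
    have hst3 := hst2.of_frame hF3 (by decide) (by decide)
    have h15' : s3.real 15 0 0 = t := by rw [hF3.2 15 (by decide), h15]
    have htime : ∀ c, c ≤ 60 → T + c + T' ≤ (j + 1) * (2100 * r * n ^ 3) := fun c hc => by
      rw [add_mul]
      simp only [mul_assoc] at *
      omega
    have hpow : ∀ x y : ℝ, 2 * (y - x) = hi' - lo' → (y - x) * 2 ^ (j + 1) ≤ lo := fun x y h => by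
      calc (y - x) * 2 ^ (j + 1) = 2 * (y - x) * 2 ^ j := by rw [pow_succ]; ring
        _ ≤ lo := by rw [h]; exact hdiff
    refine run_cond (fun hc => run_setReal ?_) (fun hc => run_setReal ?_)
    · simp only [BExpr.holds, NExpr.eval, nv] at hc
      refine ⟨hjlt, ?_, lo', t, hlo, hpow _ _ (by linarith), ?_, ?_⟩
      · refine (le_of_eq ?_).trans (htime 41 (by norm_num))
        simp
        ring
      · have hF4 : Frame [] [14] s3 (s3.setReal 14 0 0 t) :=
          ⟨fun a _ => rfl, fun a ha => State.setReal_real_of_ne _ (by simpa using ha)⟩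
        simp only [NExpr.eval, RExpr.eval, h15']
        refine ⟨hst3.prepared.of_frame hF4 (by decide) (by decide), ?_, ?_, by simp, h1,
          by linarith, by linarith, hst3.lo_le⟩
        · rw [hF4.2 1 (by decide), hst3.delta]
        · rw [hF4.2 13 (by decide), hst3.lower]
      · rcases hres with ⟨h, -⟩ | ⟨-, h⟩
        · omega
        · exact h
    · simp only [BExpr.holds, NExpr.eval, nv] at hc
      rcases hres with ⟨-, e4, hle⟩ | ⟨h, -⟩
      swap
      · omega
      refine ⟨hjlt, ?_, t, hi', by linarith, hpow _ _ (by linarith), ?_, ?_⟩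
      · refine (le_of_eq ?_).trans (htime 41 (by norm_num))
        simp
        ring
      · have hF4 : Frame [] [13] s3 (s3.setReal 13 0 0 t) :=
          ⟨fun a _ => rfl, fun a ha => State.setReal_real_of_ne _ (by simpa using ha)⟩
        simp only [NExpr.eval, RExpr.eval, h15']
        refine ⟨hst3.prepared.of_frame hF4 (by decide) (by decide), ?_, by simp, ?_, by linarith,
          by linarith, by linarith, hle⟩
        · rw [hF4.2 1 (by decide), hst3.delta]
        · rw [hF4.2 14 (by decide), hst3.upper]
      · rw [State.setReal_nat, e4, hF2.1 4 (by decide)]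
        exact hgood'
  · rintro j T s' hF ⟨hj, hT, lo', hi', hlo, hdiff, hst', hgood'⟩ hb
    simp only [BExpr.holds, RExpr.eval, NExpr.eval, rv, hst'.lower, hst'.upper, hst'.delta,
      not_lt] at hb
    refine ⟨?_, lo', hi', hst', by linarith, hgood'⟩
    have h1 : j * (2100 * r * n ^ 3) ≤ ⌈Real.logb 2 (1 / δ)⌉₊ * (2100 * r * n ^ 3) := by gcongr
    rw [add_mul]
    simp only [BExpr.cost, NExpr.cost, RExpr.cost, nv, rv]
    simp only [mul_assoc] at *
    omega

/-- The approximation algorithm. -/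
def approximation : Cmd := .seq prepare (.seq searchInit (.seq doubling bisection))

theorem run_approximation (p : Fin n ↪ M) (G : SimpleGraph (Fin n)) (k : ℕ) (hn : 2 ≤ n) (hr : 1 ≤ r)
    (hδ : 0 < δ) :
    Run approximation (input p G k r δ) fun T s' =>
      T ≤ (Nat.log 2 (n * n) + ⌈Real.logb 2 (1 / δ)⌉₊ + 6) * (2100 * r * n ^ 3) ∧
      (output n s').edgeSet.ncard ^ r ≤ (2 * k) ^ (r + 1) ∧
      dilation p (G ⊔ output n s') ≤
        ENNReal.ofReal ((1 + δ) * (2 * r)) * optDilation p G k := by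
  have h8 : 1 * n ^ 3 ≤ r * n ^ 3 := by gcongr
  have h9 : 1 ≤ n ^ 3 := Nat.one_le_pow _ _ (by omega)
  have hrpos : (1 : ℝ) ≤ r := by exact_mod_cast hr
  have hn1 : (1 : ℝ) ≤ n := by exact_mod_cast (by omega : 1 ≤ n)
  refine run_seq ((run_prepare (by omega) hr).mono ?_)
  rintro T1 s1 ⟨hT1, B, D, eu, ev, hp1, hest, hδ1, h4⟩
  refine run_seq ((run_searchInit s1 hn hr hp1 hest rfl hδ1 h4).mono ?_)
  set τ := s1.real 18 0 0 with hτ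
  rintro T2 s2 ⟨hT2, h21, hst2, hs2⟩
  refine run_seq ((run_doubling s2 (by omega) hr h21 hst2 hs2).mono ?_)
  rintro T3 s3 ⟨hT3, lo, hi, hst3, ⟨hno, hlt⟩ | ⟨h30, hgood⟩⟩
  · -- no attempt was successful, so the optimal dilation is infinite
    have htop : optDilation p G k = ⊤ := by
      by_contra hne
      obtain ⟨F, hF0, hF, hFB⟩ := hest.bound hne
      have h1 := hest.le F hF0 hF
      have h2 := hest.optDilation_le fun x y => by
        refine lt_of_le_of_lt ?_ (hFB x y)
        refine mul_le_mul_of_nonneg_right (h1.trans ?_) (distMatrix_nonneg p x y)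
        have : 0 ≤ n * F := by positivity
        nlinarith
      have h3 : hi ≤ n * max 1 τ :=
        (ENNReal.ofReal_le_ofReal_iff (by positivity)).mp (hno.2.2.trans h2)
      have h4 : (n : ℝ) * max 1 τ ≤ n * n * max 1 (τ / n) := by
        rw [mul_assoc]
        refine mul_le_mul_of_nonneg_left (max_le ?_ ?_) (by positivity)
        · have : (1 : ℝ) ≤ max 1 (τ / n) := le_max_left _ _
          nlinarith
        · have : τ / n ≤ max 1 (τ / n) := le_max_right _ _
          rw [div_le_iff₀ (by linarith)] at this
          linarith
      linarith
    refine run_cond (fun hc => ?_) (fun hc => run_skip ?_)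
    · simp [hno.1] at hc
    have hempty : output n s3 = ⊥ := by
      rw [eq_bot_iff]
      intro u v huv
      rw [output, SimpleGraph.fromRel_adj, hno.2.1, hno.2.1] at huv
      simp at huv
    refine ⟨?_, ?_, ?_⟩
    · simp only [BExpr.cost, NExpr.cost, nv]
      have : 0 ≤ ⌈Real.logb 2 (1 / δ)⌉₊ * (2100 * r * n ^ 3) := Nat.zero_le _
      simp only [add_mul] at *
      simp only [mul_assoc] at *
      omega
    · rw [hempty]
      simp [zero_pow (by omega : r ≠ 0)]
    · rw [htop, ENNReal.mul_top]
      · exact le_top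
      · rw [Ne, ENNReal.ofReal_eq_zero, not_le]
        positivity
  · refine (run_bisection s3 (by omega) hr hδ hst3 h30 hgood).mono ?_
    rintro T4 s4 ⟨hT4, lo, hi, hst4, hhi, hgood4⟩
    refine ⟨?_, hgood4.1, ?_⟩
    · simp only [add_mul] at *
      simp only [mul_assoc] at *
      omega
    · by_cases htop : optDilation p G k = ⊤
      · rw [htop, ENNReal.mul_top]
        · exact le_top
        · rw [Ne, ENNReal.ofReal_eq_zero, not_le]
          positivity
      · obtain ⟨F, hF0, hF, hFB⟩ := hest.bound htop
        have hloF : lo ≤ F := (ENNReal.ofReal_le_ofReal_iff hF0).mp (hst4.lo_le.trans hF)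
        refine (hgood4.2 fun x y => lt_of_le_of_lt ?_ (hFB x y)).trans ?_
        · refine mul_le_mul_of_nonneg_right ?_ (distMatrix_nonneg p x y)
          have h1 : hi ≤ 2 * F := hst4.le_two_mul.trans (by linarith)
          have h2 : 2 * r * hi ≤ 2 * r * (2 * F) := mul_le_mul_of_nonneg_left h1 (by positivity)
          have h3 : 1 * (4 * r * F) ≤ n * (4 * r * F) :=
            mul_le_mul_of_nonneg_right hn1 (by positivity)
          linarith
        · calc ENNReal.ofReal (2 * r * hi) ≤ ENNReal.ofReal ((1 + δ) * (2 * r) * lo) := by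
                refine ENNReal.ofReal_le_ofReal ?_
                have := mul_le_mul_of_nonneg_left hhi (by positivity : (0 : ℝ) ≤ 2 * r)
                linarith
            _ = ENNReal.ofReal ((1 + δ) * (2 * r)) * ENNReal.ofReal lo :=
                ENNReal.ofReal_mul (by positivity)
            _ ≤ _ := by gcongr; exact hst4.lo_le

end RealRAM

/-! ### The bounds in closed form -/

namespace RealRAM

/-- The number of rounds of the search in natural logarithms; `log n ≥ log 2` absorbs the additive
constants. -/
theorem search_rounds_le {n : ℕ} (hn : 2 ≤ n) (δ : ℝ) :
    ((Nat.log 2 (n * n) + ⌈Real.logb 2 (1 / δ)⌉₊ + 6 : ℕ) : ℝ) ≤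
      9 / Real.log 2 * (Real.log n + max 0 (Real.log (1 / δ))) := by
  have h2 : 0 < Real.log 2 := Real.log_pos one_lt_two
  have hn0 : (0 : ℝ) < n := by positivity
  have hlog : Real.log 2 ≤ Real.log n :=
    Real.log_le_log two_pos (by exact_mod_cast hn)
  have h1 : (Nat.log 2 (n * n) : ℝ) * Real.log 2 ≤ 2 * Real.log n := by
    have h := Real.natLog_le_logb (n * n) 2
    rw [Nat.cast_mul, Nat.cast_two, Real.logb, le_div_iff₀ h2, Real.log_mul hn0.ne' hn0.ne'] at h
    linarith
  have h3 : (⌈Real.logb 2 (1 / δ)⌉₊ : ℝ) * Real.log 2 ≤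
      max 0 (Real.log (1 / δ)) + Real.log 2 := by
    have hmax : (⌈Real.logb 2 (1 / δ)⌉₊ : ℝ) ≤ max 0 (Real.log (1 / δ)) / Real.log 2 + 1 := by
      have hle : Real.logb 2 (1 / δ) ≤ max 0 (Real.log (1 / δ)) / Real.log 2 :=
        div_le_div_of_nonneg_right (le_max_right _ _) h2.le
      have hnn : 0 ≤ max 0 (Real.log (1 / δ)) / Real.log 2 := by positivity
      exact (Nat.cast_le.mpr (Nat.ceil_mono hle)).trans (Nat.ceil_lt_add_one hnn).le
    calc _ ≤ (max 0 (Real.log (1 / δ)) / Real.log 2 + 1) * Real.log 2 :=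
          mul_le_mul_of_nonneg_right hmax h2.le
      _ = _ := by field_simp
  have h0 : 0 ≤ max 0 (Real.log (1 / δ)) := le_max_left _ _
  rw [div_mul_eq_mul_div, le_div_iff₀ h2]
  push_cast
  linarith

/-- The `r`-th root of the bound `m ^ r ≤ (2 * k) ^ (r + 1)` on the number of new edges. -/
theorem le_rpow_of_pow_le {m k r : ℕ} (hr : 1 ≤ r) (h : m ^ r ≤ (2 * k) ^ (r + 1)) :
    (m : ℝ) ≤ (2 * (2 : ℝ) ^ (1 / (r : ℝ)) * (k : ℝ) ^ (1 / (r : ℝ))) * k := by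
  have hr0 : r ≠ 0 := by omega
  refine le_of_pow_le_pow_left₀ hr0 (by positivity) ?_
  rw [mul_pow, mul_pow, mul_pow, one_div, Real.rpow_inv_natCast_pow two_pos.le hr0,
    Real.rpow_inv_natCast_pow k.cast_nonneg hr0]
  have h' : (m : ℝ) ^ r ≤ (2 * k) ^ (r + 1) := by exact_mod_cast h
  refine h'.trans (le_of_eq ?_)
  rw [pow_succ, mul_pow]
  ring

end RealRAM

theorem theorem1 :
    ∃ P : RealRAM.Cmd, ∀ r : ℕ, 1 ≤ r → ∃ C : ℝ,
      ∀ (M : Type*) [MetricSpace M] (n : ℕ) (p : Fin n ↪ M) (G : SimpleGraph (Fin n))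
        (k : ℕ) (δ : ℝ), 2 ≤ n → 1 ≤ k → 0 < δ →
        ∃ (T : ℕ) (s : RealRAM.State),
          RealRAM.Exec P (RealRAM.input p G k r δ) T s ∧
          (T : ℝ) ≤ C * ((n : ℝ) ^ 3 * (Real.log n + max 0 (Real.log (1 / δ)))) ∧
          ((RealRAM.output n s).edgeSet.ncard : ℝ) ≤
            (2 * (2 : ℝ) ^ (1 / (r : ℝ)) * (k : ℝ) ^ (1 / (r : ℝ))) * k ∧
          MetricGraph.dilation p (G ⊔ RealRAM.output n s) ≤
            ENNReal.ofReal ((1 + δ) * (2 * r)) * MetricGraph.optDilation p G k := by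
  refine ⟨RealRAM.approximation, fun r hr => ⟨2100 * r * (9 / Real.log 2), ?_⟩⟩
  intro M _ n p G k δ hn _ hδ
  obtain ⟨T, s, hexec, hT, hcard, hdil⟩ := RealRAM.run_approximation p G k hn hr hδ
  refine ⟨T, s, hexec, ?_, RealRAM.le_rpow_of_pow_le hr hcard, hdil⟩
  calc (T : ℝ)
      ≤ ((Nat.log 2 (n * n) + ⌈Real.logb 2 (1 / δ)⌉₊ + 6 : ℕ) : ℝ) * (2100 * r * n ^ 3) := by
        exact_mod_cast hT
    _ ≤ 9 / Real.log 2 * (Real.log n + max 0 (Real.log (1 / δ))) * (2100 * r * n ^ 3) :=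
        mul_le_mul_of_nonneg_right (RealRAM.search_rounds_le hn δ) (by positivity)
    _ = _ := by ring
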